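/- Let $\mathbb D$ be the open unit disc with the hyperbolic metric $\mathbf g=\frac{4(dx^2+dy^2)}{(1-|z|^2)^2}$, and let $\Gamma$ be a discrete cocompact subgroup of $\mathrm{PSU}(1,1)=\mathrm{Isom}^+(\mathbb D)$, acting by $\gamma(z)=\frac{az+b}{\bar b z+\bar a}$, $|a|^2-|b|^2=1$. Notation. Vector fields on $\mathbb D$ are functions $X:\mathbb D\to\mathbb C$, with $\gamma^*X=X(\gamma)\,\gamma'^{-1}$ and $(\delta X)(\gamma)=\gamma^*X-X$. $\mathfrak g$ is the real vector space of Killing vector fields of $(\mathbb D,\mathbf g)$, and $H^1(\Gamma;\mathfrak g)$ is the quotient of the space of cocycles ($c:\Gamma\to\mathfrak g$ with $c_{\gamma_1\gamma_2}=\gamma_2^*c_{\gamma_1}+c_{\gamma_2}$) by the space of coboundaries $\delta X$, $X\in\mathfrak g$. $\mathrm{HQD}(\mathbb D,\Gamma)$ is the space of holomorphic $q=f\,dz^2$ on $\mathbb D$ with $f(\gamma(z))\gamma'(z)^2=f(z)$ for all $\gamma\in\Gamma$, $z\in\mathbb D$. For a smooth vector field $X$, $(\mathcal L_X\mathbf g)^{(2,0)}=f\,dz^2$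 is the quadratic differential whose real part is the trace-free part of the Lie derivative $\mathcal L_X\mathbf g$. A smooth vector field $\xi$ on $\mathbb D$ is harmonic if there is a smooth family of smooth maps $\phi_t:\mathbb D\to\mathbb D$, $t\in[0,\epsilon)$, with $\phi_0=\mathrm{id}$, $\frac{d}{dt}\big|_{t=0}\phi_t=\xi$ and $\frac{d}{dt}\big|_{t=0}\tau(\phi_t)(z)=0$ for all $z\in\mathbb D$, where $\tau$ is the tension field. A vector field $X$ on $\mathbb D$ has $L^2$-boundary value $X^\sharp\in L^2(\mathbb S^1,\mathbb C)$ if $X(r\,\cdot)\to X^\sharp$ in $L^2(\mathbb S^1)$ as $r\to1^-$; and $X^\sharp$ is tangential if $X^\sharp(w)=f(w)\,\iota w$ for almost all $w$, with $f$ real-valued. For a tangential $L^2$-field $X(w)=f(w)\,\iota w$ put $$\mathcal F(X)(z)=\frac1{2\pi}\int_{\mathbb S^1}f(w)\,w\,\mathbf K(zw^{-1})\,|dw|,\qquad \mathbf K(z)=\frac{\iota(1-|z|^2)^3}{|1-\bar z|^2(1-\bar z)^2}.$$ Statement. The following two maps are well defined, and $\varPsi$ is a homomorphism of real vector spaces.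 (1) $\varPhi:\mathrm{HQD}(\mathbb D,\Gamma)\to H^1(\Gamma;\mathfrak g)$, $q\mapsto[\delta\chi]$, where $\chi$ is any harmonic vector field on $\mathbb D$ which has a tangential $L^2$-boundary value and satisfies $(\mathcal L_\chi\mathbf g)^{(2,0)}=q$. (Such a $\chi$ exists, $\delta\chi$ is a cocycle with values in $\mathfrak g$, and its class does not depend on the choice of $\chi$.) (2) $\varPsi:H^1(\Gamma;\mathfrak g)\to\mathrm{HQD}(\mathbb D,\Gamma)$, $[c]\mapsto(\mathcal L_{\mathcal F(\psi^\sharp)}\mathbf g)^{(2,0)}$, where $\psi$ is any smooth vector field on $\mathbb D$ with $\delta\psi=c$ and $\psi^\sharp$ is its $L^2$-boundary value. (Such a $\psi$ exists; every such $\psi$ has an $L^2$-boundary value, which is tangential; $\mathcal F(\psi^\sharp)$ is harmonic; and the result depends only on $[c]$.) Moreover $\varPhi\circ\varPsi=\mathrm{Id}$ on $H^1(\Gamma;\mathfrak g)$. -/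

import Mathlib

open MeasureTheory Set Filter Topology Complex
open scoped UnitDisc ContDiff ComplexConjugate Real ENNReal

noncomputable section

namespace HarmonicVF

/-! ### The group `PSU(1,1)` and its action on the unit disc -/

/-- `SU(1,1)`: the matrices `[[a, b], [conj b, conj a]]` with `|a|^2 - |b|^2 = 1`
(the last condition is `det = 1`). -/
def SU11 : Subgroup (Matrix.SpecialLinearGroup (Fin 2) ℂ) where
  carrier := {A | A 1 0 = conj (A 0 1) ∧ A 1 1 = conj (A 0 0)}
  one_mem' := by simp
  mul_mem' := by
    rintro A B ⟨hA, hA'⟩ ⟨hB, hB'⟩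
    simp only [mem_ofPred_eq, Matrix.SpecialLinearGroup.coe_mul, Matrix.mul_apply,
      Fin.sum_univ_two, map_add, map_mul]
    constructor
    · rw [hA, hA', hB, hB']; simp; ring
    · rw [hA, hA', hB, hB']; simp; ring
  inv_mem' := by
    rintro A ⟨hA, hA'⟩
    simp only [mem_ofPred_eq, Matrix.SpecialLinearGroup.coe_inv, Matrix.adjugate_fin_two]
    simp [hA, hA']

/-- The subgroup `{±Id}` of `SU(1,1)`. -/
def pmOne : Subgroup SU11 where
  carrier := {A | (A.1.1 : Matrix (Fin 2) (Fin 2) ℂ) = 1 ∨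
    (A.1.1 : Matrix (Fin 2) (Fin 2) ℂ) = -1}
  one_mem' := by simp
  mul_mem' := by
    rintro A B (hA | hA) (hB | hB) <;>
    simp [hA, hB]
  inv_mem' := by
    rintro A (hA | hA)
    · left; simp [Matrix.SpecialLinearGroup.coe_inv, hA]
    · right
      simp only [Subgroup.coe_inv, Matrix.SpecialLinearGroup.coe_inv, hA]
      ext i j
      fin_cases i <;> fin_cases j <;> simp [Matrix.adjugate_fin_two]

instance : pmOne.Normal where
  conj_mem := by
    rintro A hA B
    have hB : (B.1.1 : Matrix (Fin 2) (Fin 2) ℂ) * (B⁻¹).1.1 = 1 := by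
      exact congrArg (fun C : SU11 => (C.1.1 : Matrix (Fin 2) (Fin 2) ℂ)) (mul_inv_cancel B)
    rcases hA with hA | hA
    · left
      change B.1.1 * A.1.1 * (B⁻¹).1.1 = 1
      rw [hA, mul_one, hB]
    · right
      change B.1.1 * A.1.1 * (B⁻¹).1.1 = -1
      rw [hA, mul_neg, mul_one, neg_mul, hB]

/-- `PSU(1,1) = SU(1,1) / {±Id}`, with the quotient topology. -/
abbrev PSU11 : Type := SU11 ⧸ pmOne

lemma normSq_sub (A : SU11) : normSq (A.1 0 0) - normSq (A.1 0 1) = 1 := by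
  have h := A.1.2
  rw [Matrix.det_fin_two] at h
  have h1 : A.1.1 1 0 = conj (A.1.1 0 1) := A.2.1
  have h2 : A.1.1 1 1 = conj (A.1.1 0 0) := A.2.2
  rw [h1, h2, mul_conj, mul_conj] at h
  exact_mod_cast h

lemma normSq_denom (A : SU11) (z : ℂ) :
    normSq (conj (A.1 0 1) * z + conj (A.1 0 0)) - normSq (A.1 0 0 * z + A.1 0 1)
      = 1 - normSq z := by
  have h := normSq_sub A
  simp only [normSq_apply, add_re, add_im, mul_re, mul_im, conj_re, conj_im] at h ⊢
  linear_combination (1 - z.re * z.re - z.im * z.im) * h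

lemma denom_ne_zero (A : SU11) (z : 𝔻) : conj (A.1 0 1) * (z : ℂ) + conj (A.1 0 0) ≠ 0 := by
  intro h
  have h1 := normSq_denom A z
  rw [h, map_zero] at h1
  have h2 := z.normSq_lt_one
  have h3 := normSq_nonneg (A.1 0 0 * (z : ℂ) + A.1 0 1)
  linarith

lemma norm_moebius_lt_one (A : SU11) (z : 𝔻) :
    ‖(A.1 0 0 * (z : ℂ) + A.1 0 1) / (conj (A.1 0 1) * (z : ℂ) + conj (A.1 0 0))‖ < 1 := by
  rw [norm_div, div_lt_one (norm_pos_iff.2 (denom_ne_zero A z))]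
  have h1 := normSq_denom A z
  have h2 := z.normSq_lt_one
  rw [normSq_eq_norm_sq, normSq_eq_norm_sq] at h1
  exact lt_of_pow_lt_pow_left₀ 2 (norm_nonneg _) (by linarith)

/-- The action `z ↦ (a z + b) / (conj b z + conj a)` on the unit disc. -/
instance : MulAction SU11 𝔻 where
  smul A z := UnitDisc.mk _ (norm_moebius_lt_one A z)
  one_smul z := by
    apply UnitDisc.coe_injective
    change (_ / _ : ℂ) = _
    simp
  mul_smul A B z := by
    apply UnitDisc.coe_injective
    have hB := denom_ne_zero B z
    have hA := denom_ne_zero A (UnitDisc.mk _ (norm_moebius_lt_one B z))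
    have hAB := denom_ne_zero (A * B) z
    rw [UnitDisc.coe_mk] at hA
    have hB1 : B.1 1 0 = conj (B.1 0 1) := B.2.1
    have hB2 : B.1 1 1 = conj (B.1 0 0) := B.2.2
    change (_ / _ : ℂ) = (_ * (_ / _) + _) / (_ * (_ / _) + _)
    rw [div_eq_div_iff hAB hA]
    simp only [Subgroup.coe_mul, Matrix.SpecialLinearGroup.coe_mul, Matrix.mul_apply,
      Fin.sum_univ_two, map_add, map_mul, hB1, hB2, conj_conj]
    field_simp
    ring

lemma coe_smul (A : SU11) (z : 𝔻) :
    ((A • z : 𝔻) : ℂ) = (A.1 0 0 * (z : ℂ) + A.1 0 1) /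
      (conj (A.1 0 1) * (z : ℂ) + conj (A.1 0 0)) := rfl

lemma pmOne_le_ker : ∀ A ∈ pmOne, MulAction.toPermHom SU11 𝔻 A = 1 := by
  rintro A hA
  refine Equiv.ext fun z => UnitDisc.coe_injective ?_
  rw [MulAction.toPermHom_apply, MulAction.toPerm_apply, coe_smul]
  rcases hA with hA | hA
  · simp [hA]
  · simp [hA]

/-- The induced action of `PSU(1,1)` on the unit disc. -/
instance : MulAction PSU11 𝔻 :=
  MulAction.compHom 𝔻 (QuotientGroup.lift pmOne (MulAction.toPermHom SU11 𝔻) pmOne_le_ker)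

lemma mk_smul (A : SU11) (z : 𝔻) : ((A : PSU11) • z : 𝔻) = A • z := rfl

/-! ### Functions and vector fields on the disc

A vector field on the disc is a function `𝔻 → ℂ`, through `T_z 𝔻 = ℂ`. -/

/-- Extension by zero to `ℂ`, used only to differentiate at points of the open disc. -/
def zeroExt (X : 𝔻 → ℂ) (z : ℂ) : ℂ := if h : ‖z‖ < 1 then X (UnitDisc.mk z h) else 0

lemma zeroExt_coe (X : 𝔻 → ℂ) (z : 𝔻) : zeroExt X z = X z := by
  simp [zeroExt, z.norm_lt_one]

lemma zeroExt_add (X Y : 𝔻 → ℂ) : zeroExt (X + Y) = zeroExt X + zeroExt Y := by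
  ext z; by_cases h : ‖z‖ < 1 <;> simp [zeroExt, h]

lemma zeroExt_zero : zeroExt 0 = 0 := by
  ext z; by_cases h : ‖z‖ < 1 <;> simp [zeroExt, h]

lemma zeroExt_smul {R : Type*} [SMulZeroClass R ℂ] (a : R) (X : 𝔻 → ℂ) :
    zeroExt (a • X) = a • zeroExt X := by
  ext z; by_cases h : ‖z‖ < 1 <;> simp [zeroExt, h]

/-- `C^∞` functions (vector fields) on the open disc. -/
def IsSmooth (X : 𝔻 → ℂ) : Prop := ContDiffOn ℝ ∞ (zeroExt X) (Metric.ball 0 1)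

lemma IsSmooth.differentiableAt {X : 𝔻 → ℂ} (hX : IsSmooth X) (z : 𝔻) :
    DifferentiableAt ℝ (zeroExt X) z :=
  ((hX.contDiffAt (Metric.isOpen_ball.mem_nhds (by simp [z.norm_lt_one]))).differentiableAt
    (by simp))

/-- The complex derivative `γ'(z)` of `γ ∈ PSU(1,1)` acting on the disc. -/
def derivAct (γ : PSU11) (z : 𝔻) : ℂ := deriv (zeroExt fun w => ((γ • w : 𝔻) : ℂ)) z

/-- `γ^* X = X(γ) γ'^{-1}`. -/
def pull (γ : PSU11) (X : 𝔻 → ℂ) : 𝔻 → ℂ := fun z => X (γ • z) * (derivAct γ z)⁻¹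

lemma pull_add (γ : PSU11) (X Y : 𝔻 → ℂ) : pull γ (X + Y) = pull γ X + pull γ Y := by
  ext z; simp [pull, add_mul]

lemma pull_smul (γ : PSU11) (a : ℝ) (X : 𝔻 → ℂ) : pull γ (a • X) = a • pull γ X := by
  ext z; simp [pull, mul_assoc]

lemma pull_zero (γ : PSU11) : pull γ 0 = 0 := by
  ext z; simp [pull]

/-! ### The hyperbolic metric, Lie derivatives, Killing fields -/

/-- The hyperbolic metric `4 (dx^2 + dy^2) / (1 - |z|^2)^2`, evaluated on `u, v ∈ T_z 𝔻 = ℂ`. -/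
def hypMetric (z u v : ℂ) : ℝ := 4 / (1 - ‖z‖ ^ 2) ^ 2 * (u * conj v).re

/-- The Lie derivative `(L_X g)_z (u, v) = (X g)(u, v) + g(dX u, v) + g(u, dX v)` of the
hyperbolic metric, in the standard coordinate of the disc. -/
def lieMetric (X : 𝔻 → ℂ) (z : 𝔻) (u v : ℂ) : ℝ :=
  fderiv ℝ (fun w : ℂ => hypMetric w u v) z (X z)
    + hypMetric z (fderiv ℝ (zeroExt X) z u) v + hypMetric z u (fderiv ℝ (zeroExt X) z v)

/-- The function `f` with `(L_X g)^{(2,0)} = f dz^2`: the trace-free part `TF` of `L_X g`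
is the real part of `f dz^2`, that is, `f = TF_{11} - i TF_{12}`. -/
def quadDiff (X : 𝔻 → ℂ) (z : 𝔻) : ℂ :=
  (((lieMetric X z 1 1 - lieMetric X z I I) / 2 : ℝ) : ℂ) - I * (lieMetric X z 1 I : ℝ)

/-- The real vector space `𝔤` of Killing vector fields on the disc. -/
def killing : Submodule ℝ (𝔻 → ℂ) where
  carrier := {X | IsSmooth X ∧ ∀ z u v, lieMetric X z u v = 0}
  zero_mem' := by
    refine ⟨?_, fun z u v => ?_⟩
    · rw [IsSmooth, zeroExt_zero]; exact contDiffOn_const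
    · simp [lieMetric, zeroExt_zero, hypMetric]
  add_mem' := by
    rintro X Y ⟨hX, hX'⟩ ⟨hY, hY'⟩
    refine ⟨?_, fun z u v => ?_⟩
    · rw [IsSmooth, zeroExt_add]; exact ContDiffOn.add hX hY
    · have h1 := hX' z u v
      have h2 := hY' z u v
      simp only [lieMetric, zeroExt_add] at h1 h2 ⊢
      rw [fderiv_add (hX.differentiableAt z) (hY.differentiableAt z)]
      simp only [_root_.add_apply, Pi.add_apply, map_add, hypMetric, add_mul, mul_add,
        add_re] at h1 h2 ⊢
      linarith
  smul_mem' := by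
    rintro a X ⟨hX, hX'⟩
    refine ⟨?_, fun z u v => ?_⟩
    · rw [IsSmooth, zeroExt_smul]; exact ContDiffOn.const_smul a hX
    · have h1 := hX' z u v
      simp only [lieMetric, zeroExt_smul] at h1 ⊢
      rw [fderiv_const_smul (hX.differentiableAt z)]
      simp only [_root_.smul_apply, Pi.smul_apply, map_smul, smul_eq_mul] at h1 ⊢
      simp only [hypMetric, real_smul, map_mul, conj_ofReal, mul_assoc, re_ofReal_mul,
        mul_left_comm _ (a : ℂ)] at h1 ⊢
      linear_combination a * h1

/-! ### Tension field and harmonic vector fields -/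

/-- The coordinate frame `∂_x = 1`, `∂_y = i`. -/
def frame : Fin 2 → ℂ := ![1, I]

/-- The real coordinates `x, y` of a complex number. -/
def coord (α : Fin 2) (z : ℂ) : ℝ := ![z.re, z.im] α

/-- The partial derivative `∂_i`. -/
def partialD (i : Fin 2) (f : ℂ → ℝ) (z : ℂ) : ℝ := fderiv ℝ f z (frame i)

/-- The coefficients `g_{ij}` of the hyperbolic metric. -/
def gCoef (i j : Fin 2) (z : ℂ) : ℝ := hypMetric z (frame i) (frame j)

/-- The coefficients `g^{ij}` of the inverse matrix. -/
def gInv (i j : Fin 2) (z : ℂ) : ℝ := if i = j then (1 - ‖z‖ ^ 2) ^ 2 / 4 else 0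

lemma sum_gCoef_mul_gInv (z : 𝔻) (i k : Fin 2) :
    ∑ j, gCoef i j z * gInv j k z = if i = k then 1 else 0 := by
  have h : (1 - ‖(z : ℂ)‖ ^ 2) ≠ 0 := by have := z.sq_norm_lt_one; linarith
  fin_cases i <;> fin_cases k <;>
    simp [gCoef, gInv, hypMetric, frame] <;> field_simp <;> exact h

/-- The Christoffel symbols `Γ^k_{ij}` of the hyperbolic metric. -/
def christoffel (k i j : Fin 2) (z : ℂ) : ℝ :=
  1 / 2 * ∑ l, gInv k l z *
    (partialD i (gCoef j l) z + partialD j (gCoef i l) z - partialD l (gCoef i j) z)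

/-- The component `τ^α(φ)(z)` of the tension field of a map `φ` from the disc to the disc,
both with the hyperbolic metric. -/
def tension (φ : ℂ → ℂ) (α : Fin 2) (z : ℂ) : ℝ :=
  ∑ i, ∑ j, gInv i j z *
    (partialD i (partialD j fun w => coord α (φ w)) z
      - ∑ k, christoffel k i j z * partialD k (fun w => coord α (φ w)) z
      + ∑ β, ∑ γ, christoffel α β γ (φ z) *
          partialD i (fun w => coord β (φ w)) z * partialD j (fun w => coord γ (φ w)) z)

/-- Harmonic vector fields on the disc: `ξ` is the initial velocity of a smooth family
`φ_t : 𝔻 → 𝔻`, `t ∈ [0, ε)`, of smooth maps with `φ_0` the identity and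
`d/dt τ(φ_t)(z) = 0` at `t = 0` for every `z`. -/
def IsHarmonic (ξ : 𝔻 → ℂ) : Prop :=
  IsSmooth ξ ∧ ∃ (ε : ℝ) (φ : ℝ → ℂ → ℂ), 0 < ε ∧
    ContDiffOn ℝ ∞ (fun p : ℝ × ℂ => φ p.1 p.2) (Ico 0 ε ×ˢ Metric.ball 0 1) ∧
    (∀ t ∈ Ico 0 ε, MapsTo (φ t) (Metric.ball 0 1) (Metric.ball 0 1)) ∧
    (∀ z : 𝔻, φ 0 z = z) ∧
    (∀ z : 𝔻, HasDerivWithinAt (fun t => φ t z) (ξ z) (Ici 0) 0) ∧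
    (∀ (z : 𝔻) (α : Fin 2), HasDerivWithinAt (fun t => tension (φ t) α z) 0 (Ici 0) 0)

/-! ### Boundary values and the Poisson map for vector fields

The circle `𝕊¹` is `ℝ / 2πℤ` through `θ ↦ e^{iθ}`, with the normalised Haar measure
`dθ / 2π`; an `L²` vector field on `𝕊¹` is an element of `L²(𝕊¹, ℂ)`. -/

/-- The circle `ℝ / 2πℤ`. -/
abbrev S1 : Type := AddCircle (2 * π)

instance factTwoPi : Fact (0 < 2 * π) := ⟨Real.two_pi_pos⟩

/-- The point `e^{iθ}` of the unit circle. -/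
def pt (θ : S1) : ℂ := (AddCircle.toCircle θ : ℂ)

/-- The space of `L²` vector fields on the circle. -/
abbrev L2S1 : Type := Lp ℂ 2 (AddCircle.haarAddCircle (T := 2 * π))

/-- `Y` is the `L²` boundary value of `X`: the restrictions of `X` to the circles of radius `r`
converge to `Y` in `L²` as `r → 1`. -/
def HasL2Extension (X : 𝔻 → ℂ) (Y : L2S1) : Prop :=
  Tendsto (fun r : ℝ => eLpNorm (fun θ : S1 => zeroExt X (r * pt θ) - Y θ) 2
    AddCircle.haarAddCircle) (𝓝[<] 1) (𝓝 0)

/-- `Y` is tangential: a real function times the unit tangent field `w ↦ i w`. -/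
def IsTangential (Y : L2S1) : Prop :=
  ∀ᵐ θ ∂(AddCircle.haarAddCircle (T := 2 * π)), ∃ s : ℝ, Y θ = s * (I * pt θ)

/-- The Poisson kernel vector field `i (1-|z|^2)^3 / (|1-conj z|^2 (1-conj z)^2)`. -/
def poissonKernel (z : ℂ) : ℂ :=
  I * ((1 - ‖z‖ ^ 2 : ℝ) : ℂ) ^ 3 / (((‖1 - conj z‖ ^ 2 : ℝ) : ℂ) * (1 - conj z) ^ 2)

/-- The normalised convolution of `f` with the Poisson kernel vector field `K`, where
`Y(w) = f(w) i w`. The rotate of the vector field `K` by `w` is `z ↦ w K(z w⁻¹)`, so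
`(f * K)(z) = 1/(2π) ∫ f(w) w K(z w⁻¹) dw`. -/
def poissonMap (Y : L2S1) : 𝔻 → ℂ := fun z =>
  ∫ θ : S1, (Y θ / (I * pt θ)) * (pt θ * poissonKernel (z * (pt θ)⁻¹))
    ∂(AddCircle.haarAddCircle (T := 2 * π))

/-! ### Quadratic differentials, group cohomology, and the two maps -/

/-- `HQD(𝔻, Γ)`: the holomorphic functions `f` on the disc with `f(γ z) γ'(z)^2 = f(z)`. -/
def HQD (Γ : Subgroup PSU11) : Submodule ℂ (𝔻 → ℂ) where
  carrier := {f | DifferentiableOn ℂ (zeroExt f) (Metric.ball 0 1) ∧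
    ∀ γ ∈ Γ, ∀ z : 𝔻, f (γ • z) * derivAct γ z ^ 2 = f z}
  zero_mem' := by
    refine ⟨?_, fun γ _ z => by simp⟩
    rw [zeroExt_zero]; exact differentiableOn_const 0
  add_mem' := by
    rintro f g ⟨hf, hf'⟩ ⟨hg, hg'⟩
    refine ⟨?_, fun γ hγ z => ?_⟩
    · rw [zeroExt_add]; exact hf.add hg
    · simp [add_mul, hf' γ hγ z, hg' γ hγ z]
  smul_mem' := by
    rintro a f ⟨hf, hf'⟩
    refine ⟨?_, fun γ hγ z => ?_⟩
    · rw [zeroExt_smul]; exact hf.const_smul a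
    · simp [mul_assoc, hf' γ hγ z]

/-- The coboundary `(δX)(γ) = γ^* X - X`. -/
def delta (Γ : Subgroup PSU11) (X : 𝔻 → ℂ) : Γ → (𝔻 → ℂ) := fun γ => pull γ X - X

/-- `Z¹(Γ; 𝔤)`: the maps `c : Γ → 𝔤` with `c(γ₁ γ₂) = γ₂^* c(γ₁) + c(γ₂)`. -/
def Z1 (Γ : Subgroup PSU11) : Submodule ℝ (Γ → (𝔻 → ℂ)) where
  carrier := {c | (∀ γ, c γ ∈ killing) ∧
    ∀ γ₁ γ₂ : Γ, c (γ₁ * γ₂) = pull γ₂ (c γ₁) + c γ₂}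
  zero_mem' := ⟨fun _ => killing.zero_mem, fun _ _ => by simp [pull_zero]⟩
  add_mem' := by
    rintro c d ⟨hc, hc'⟩ ⟨hd, hd'⟩
    refine ⟨fun γ => killing.add_mem (hc γ) (hd γ), fun γ₁ γ₂ => ?_⟩
    simp only [Pi.add_apply, hc', hd', pull_add]
    abel
  smul_mem' := by
    rintro a c ⟨hc, hc'⟩
    refine ⟨fun γ => killing.smul_mem a (hc γ), fun γ₁ γ₂ => ?_⟩
    simp only [Pi.smul_apply, hc', pull_smul, smul_add]

/-- `B¹(Γ; 𝔤)`: the coboundaries of elements of `𝔤`. -/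
def B1 (Γ : Subgroup PSU11) : Submodule ℝ (Γ → (𝔻 → ℂ)) where
  carrier := {c | ∃ X ∈ killing, c = delta Γ X}
  zero_mem' := ⟨0, killing.zero_mem, by ext γ; simp [delta, pull_zero]⟩
  add_mem' := by
    rintro _ _ ⟨X, hX, rfl⟩ ⟨Y, hY, rfl⟩
    refine ⟨X + Y, killing.add_mem hX hY, ?_⟩
    funext γ
    simp only [delta, Pi.add_apply, pull_add]
    abel
  smul_mem' := by
    rintro a _ ⟨X, hX, rfl⟩
    refine ⟨a • X, killing.smul_mem a hX, ?_⟩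
    funext γ
    simp only [delta, Pi.smul_apply, pull_smul, smul_sub]

/-- `H¹(Γ; 𝔤) = Z¹(Γ; 𝔤) / B¹(Γ; 𝔤)`. -/
abbrev H1 (Γ : Subgroup PSU11) : Type := Z1 Γ ⧸ (B1 Γ).submoduleOf (Z1 Γ)

/-- The class `[c]` of a cocycle. -/
def H1.mk (Γ : Subgroup PSU11) (c : Z1 Γ) : H1 Γ := ((B1 Γ).submoduleOf (Z1 Γ)).mkQ c

/-- `χ` is a harmonic vector field on the disc with a tangential `L²` boundary value and
`(L_χ g)^{(2,0)} = q`. -/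
def IsHarmonicPotential (χ q : 𝔻 → ℂ) : Prop :=
  IsHarmonic χ ∧ (∃ Y : L2S1, HasL2Extension χ Y ∧ IsTangential Y) ∧ quadDiff χ = q

/-- `Φ` is the map `q ↦ [δχ]`, where `χ` is a harmonic vector field with tangential `L²` boundary
value and `(L_χ g)^{(2,0)} = q`: such a `χ` exists for every `q`, and for every such `χ` the
coboundary `δχ` is a `𝔤`-valued cocycle with class `Φ q`. -/
def IsPhi (Γ : Subgroup PSU11) (Φ : HQD Γ → H1 Γ) : Prop :=
  (∀ q : HQD Γ, ∃ χ : 𝔻 → ℂ, IsHarmonicPotential χ q) ∧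
  ∀ (q : HQD Γ) (χ : 𝔻 → ℂ), IsHarmonicPotential χ q →
    ∃ h : delta Γ χ ∈ Z1 Γ, Φ q = H1.mk Γ ⟨delta Γ χ, h⟩

/-- `Ψ` is the map `[c] ↦ (L_{F(ψ♯)} g)^{(2,0)}`, where `ψ` is a smooth vector field on the disc
with `δψ = c` and `ψ♯` is its `L²` boundary value: such a `ψ` exists for every cocycle `c`, and
every such `ψ` has a tangential `L²` boundary value `ψ♯`, with `F(ψ♯)` harmonic and with
`(L_{F(ψ♯)} g)^{(2,0)} = Ψ [c]`. -/
def IsPsi (Γ : Subgroup PSU11) (Ψ : H1 Γ → HQD Γ) : Prop :=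
  (∀ c : Z1 Γ, ∃ ψ : 𝔻 → ℂ, IsSmooth ψ ∧ delta Γ ψ = c) ∧
  ∀ (c : Z1 Γ) (ψ : 𝔻 → ℂ), IsSmooth ψ → delta Γ ψ = c →
    ∃ Y : L2S1, HasL2Extension ψ Y ∧ IsTangential Y ∧ IsHarmonic (poissonMap Y) ∧
      (Ψ (H1.mk Γ c) : 𝔻 → ℂ) = quadDiff (poissonMap Y)

end HarmonicVF

end

open HarmonicVF

/-!
For a smooth field `X`, the form `(L_X g)^{(2,0)}` is `4 (1-|z|²)⁻²` times the conjugate of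
`∂_x X + i ∂_y X` (`quadDiff_eq`). Linearising the tension field at the identity shows that `X` is
harmonic if and only if this form is holomorphic (`isHarmonic_iff`). Integrating three times gives
the general harmonic field in terms of two holomorphic functions (`IsHarmonic.exists_harmForm`), and
hence the Fourier coefficients of its restrictions to circles. It follows that a harmonic field is
determined by its `L²` boundary value (`IsHarmonic.eq_of_hasL2Extension`) and that a smooth field
with tangential boundary value and vanishing `(2,0)`-form is a Killing field
(`mem_killing_of_tangential`).

The same analysis applies to the Poisson map: `poissonMap Y` is harmonic with boundary value `Y`
for every `L²` field `Y` (`isHarmonic_poissonMap`, `hasL2Extension_poissonMap`), so that every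
harmonic field with an `L²` boundary value is the Poisson integral of it
(`IsHarmonic.eq_poissonMap`). By the change of variables formula on the circle the Poisson map is
equivariant under `PSU(1,1)` (`pull_poissonMap`).

*The map `Φ`.* By cocompactness an element `q` of `HQD` has bounded hyperbolic norm, so its Taylor
coefficients grow at most quadratically and `q` is the `(2,0)`-form of the Poisson integral of a
tangential `L²` field (`exists_tangential_quadDiff_eq`). If `χ` is any harmonic field with
tangential boundary value and form `q`, then `γ^* χ - χ` has vanishing form, because `q` is
invariant, and tangential boundary value, by equivariance; so it is Killing. The difference of two
such `χ` is Killing for the same reason, and `[δχ]` is well defined.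

*The map `Ψ`.* A cocycle `c` is the coboundary of a smooth field, by averaging with a cutoff
(`exists_isSmooth_delta_eq`). Let `δψ = c`. By cocompactness there is a constant `M` such that each
translate `g^* ψ`, `g ∈ PSU(1,1)`, is within `M` of a Killing field on a fixed disc
(`exists_killing_approx`). Along a radius, the increments of these Killing fields from one dyadic
scale to the next are controlled in the eigenbasis of the transvections along this radius, and the
coordinate which determines the value at the end point converges geometrically
(`exists_radial_limit`). So `ψ` has a continuous tangential boundary value
(`exists_hasUniformExtension`), which satisfies `γ^* ψ♯ - ψ♯ = c_γ` on the circle. By equivariance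
the Poisson integral of `ψ♯` has coboundary `c` (`delta_poissonMap`), and its `(2,0)`-form is
invariant. Two choices of `ψ` differ by an invariant field, which is `O(1-|z|²)` and so does not
change the boundary value (`HasL2Extension.eq_of_delta_eq`).

Finally, `poissonMap ψ♯` is an admissible `χ` for `q = Ψ [c]`, and `δ(poissonMap ψ♯) = c`, so
`Φ (Ψ [c]) = [c]`.
-/


noncomputable section

namespace HarmonicVF

/-! ### The disc, extensions by zero and the operator `∂_x + i ∂_y` -/

/-- The open unit disc as a subset of `ℂ`. -/
abbrev disc : Set ℂ := Metric.ball 0 1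

lemma mem_disc {z : ℂ} : z ∈ disc ↔ ‖z‖ < 1 := mem_ball_zero_iff

lemma coe_mem_disc (z : 𝔻) : (z : ℂ) ∈ disc := mem_disc.2 z.norm_lt_one

lemma isOpen_disc : IsOpen disc := Metric.isOpen_ball

lemma disc_mem_nhds (z : 𝔻) : disc ∈ 𝓝 (z : ℂ) := isOpen_disc.mem_nhds (coe_mem_disc z)

lemma one_sub_normSq_pos (z : 𝔻) : 0 < 1 - ‖(z : ℂ)‖ ^ 2 := by
  have := z.sq_norm_lt_one; linarith

lemma eqOn_zeroExt {X : 𝔻 → ℂ} {F : ℂ → ℂ} (h : ∀ z : 𝔻, X z = F z) : EqOn (zeroExt X) F disc := by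
  intro z hz
  exact (zeroExt_coe X ⟨z, hz⟩).trans (h ⟨z, hz⟩)

lemma zeroExt_eventuallyEq {X : 𝔻 → ℂ} {F : ℂ → ℂ} (h : ∀ z : 𝔻, X z = F z) (z : 𝔻) :
    zeroExt X =ᶠ[𝓝 (z : ℂ)] F := by
  filter_upwards [disc_mem_nhds z] with w hw using eqOn_zeroExt h hw

lemma isSmooth_of_eq {X : 𝔻 → ℂ} {F : ℂ → ℂ} (h : ∀ z : 𝔻, X z = F z)
    (hF : ContDiffOn ℝ ∞ F disc) : IsSmooth X :=
  hF.congr (eqOn_zeroExt h)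

lemma IsSmooth.contDiffAt {X : 𝔻 → ℂ} (hX : IsSmooth X) (z : 𝔻) :
    ContDiffAt ℝ ∞ (zeroExt X) z :=
  ContDiffOn.contDiffAt hX (disc_mem_nhds z)

lemma zeroExt_neg (X : 𝔻 → ℂ) : zeroExt (-X) = -zeroExt X := by
  ext z; by_cases h : ‖z‖ < 1 <;> simp [zeroExt, h]

lemma zeroExt_sub (X Y : 𝔻 → ℂ) : zeroExt (X - Y) = zeroExt X - zeroExt Y := by
  rw [sub_eq_add_neg, zeroExt_add, zeroExt_neg, sub_eq_add_neg]

lemma IsSmooth.add {X Y : 𝔻 → ℂ} (hX : IsSmooth X) (hY : IsSmooth Y) : IsSmooth (X + Y) := by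
  rw [IsSmooth, zeroExt_add]; exact ContDiffOn.add hX hY

lemma IsSmooth.sub {X Y : 𝔻 → ℂ} (hX : IsSmooth X) (hY : IsSmooth Y) : IsSmooth (X - Y) := by
  rw [IsSmooth, zeroExt_sub]; exact ContDiffOn.sub hX hY

lemma IsSmooth.smul {X : 𝔻 → ℂ} (a : ℝ) (hX : IsSmooth X) : IsSmooth (a • X) := by
  rw [IsSmooth, zeroExt_smul]; exact ContDiffOn.const_smul a hX

lemma continuous_of_contDiffOn {X : 𝔻 → ℂ} (hX : ContinuousOn (zeroExt X) disc) :
    Continuous X := by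
  have h : Continuous fun z : 𝔻 => zeroExt X z :=
    hX.comp_continuous UnitDisc.continuous_coe coe_mem_disc
  simpa only [zeroExt_coe] using h

lemma IsSmooth.continuous {X : 𝔻 → ℂ} (hX : IsSmooth X) : Continuous X :=
  continuous_of_contDiffOn (ContDiffOn.continuousOn hX)

/-- The operator `∂_x + i ∂_y`, which is twice the Wirtinger derivative `∂ / ∂ conj z`. -/
def dbar (F : ℂ → ℂ) (z : ℂ) : ℂ := fderiv ℝ F z 1 + I * fderiv ℝ F z I

lemma dbar_congr {F G : ℂ → ℂ} {z : ℂ} (h : F =ᶠ[𝓝 z] G) : dbar F z = dbar G z := by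
  rw [dbar, dbar, h.fderiv_eq]

lemma dbar_eq_zero_of_differentiableAt {F : ℂ → ℂ} {z : ℂ} (h : DifferentiableAt ℂ F z) :
    dbar F z = 0 := by
  have := (differentiableAt_complex_iff_differentiableAt_real.1 h).2
  rw [dbar, this, smul_eq_mul, ← mul_assoc, I_mul_I]; ring

lemma differentiableAt_complex_of_dbar {F : ℂ → ℂ} {z : ℂ} (h : DifferentiableAt ℝ F z)
    (h0 : dbar F z = 0) : DifferentiableAt ℂ F z := by
  refine differentiableAt_complex_iff_differentiableAt_real.2 ⟨h, ?_⟩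
  rw [smul_eq_mul]
  have : I * dbar F z = 0 := by rw [h0, mul_zero]
  rw [dbar, mul_add, ← mul_assoc, I_mul_I] at this
  linear_combination -this

lemma dbar_add {F G : ℂ → ℂ} {z : ℂ} (hF : DifferentiableAt ℝ F z) (hG : DifferentiableAt ℝ G z) :
    dbar (F + G) z = dbar F z + dbar G z := by
  simp only [dbar, fderiv_add hF hG, _root_.add_apply]; ring

lemma dbar_sub {F G : ℂ → ℂ} {z : ℂ} (hF : DifferentiableAt ℝ F z) (hG : DifferentiableAt ℝ G z) :
    dbar (F - G) z = dbar F z - dbar G z := by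
  simp only [dbar, fderiv_sub hF hG, _root_.sub_apply]; ring

lemma dbar_smul {F : ℂ → ℂ} {z : ℂ} (a : ℝ) (hF : DifferentiableAt ℝ F z) :
    dbar (a • F) z = a * dbar F z := by
  simp only [dbar, fderiv_const_smul hF, _root_.smul_apply, real_smul]; ring

lemma dbar_mul {F G : ℂ → ℂ} {z : ℂ} (hF : DifferentiableAt ℝ F z) (hG : DifferentiableAt ℝ G z) :
    dbar (F * G) z = dbar F z * G z + F z * dbar G z := by
  simp only [dbar, fderiv_mul hF hG, _root_.add_apply, _root_.smul_apply, smul_eq_mul]; ring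

lemma fderiv_real_of_hasDerivAt {F : ℂ → ℂ} {z f' : ℂ} (hF : HasDerivAt F f' z) (v : ℂ) :
    fderiv ℝ F z v = v * f' := by
  rw [(hF.hasFDerivAt.restrictScalars ℝ).fderiv]
  simp

/-- The conjugate of a holomorphic function. -/
lemma dbar_conj {F : ℂ → ℂ} {z f' : ℂ} (hF : HasDerivAt F f' z) :
    dbar (fun w => conj (F w)) z = 2 * conj f' := by
  have h1 : HasFDerivAt (fun w => conj (F w)) _ z :=
    (conjCLE.toContinuousLinearMap.hasFDerivAt).comp z (hF.hasFDerivAt.restrictScalars ℝ)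
  simp only [dbar, h1.fderiv]
  simp
  ring_nf
  simp
  ring

/-- The chain rule for composition with a holomorphic map. -/
lemma dbar_comp {F G : ℂ → ℂ} {z g' : ℂ} (hF : DifferentiableAt ℝ F (G z))
    (hG : HasDerivAt G g' z) : dbar (fun w => F (G w)) z = dbar F (G z) * conj g' := by
  have h1 : HasFDerivAt (fun w => F (G w)) _ z :=
    hF.hasFDerivAt.comp z (hG.hasFDerivAt.restrictScalars ℝ)
  simp only [dbar, h1.fderiv]
  have key : ∀ u : ℂ, fderiv ℝ F (G z) u = u.re * fderiv ℝ F (G z) 1 + u.im * fderiv ℝ F (G z) I := by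
    intro u
    conv_lhs => rw [← re_add_im u]
    rw [show (u.re : ℂ) + u.im * I = u.re • (1 : ℂ) + u.im • I by simp, map_add, map_smul, map_smul]
    simp
  simp only [ContinuousLinearMap.comp_apply, ContinuousLinearMap.coe_restrictScalars',
    ContinuousLinearMap.toSpanSingleton_apply, smul_eq_mul, one_mul]
  rw [key g', key (I * g')]
  have : conj g' = g'.re - g'.im * I := by
    apply Complex.ext <;> simp
  rw [this]
  simp
  ring_nf
  simp

/-! ### Möbius maps, their derivatives, and pull back of vector fields -/

/-- The Möbius map of a matrix in `SU(1,1)`, as a function on `ℂ`. -/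
def moebius (A : SU11) (z : ℂ) : ℂ := (A.1 0 0 * z + A.1 0 1) / (conj (A.1 0 1) * z + conj (A.1 0 0))

/-- The automorphy factor `conj b z + conj a`. -/
def autFactor (A : SU11) (z : ℂ) : ℂ := conj (A.1 0 1) * z + conj (A.1 0 0)

lemma autFactor_ne_zero_of_norm_le_one (A : SU11) {z : ℂ} (hz : ‖z‖ ≤ 1) : autFactor A z ≠ 0 := by
  intro h
  have h1 : ‖A.1 0 1‖ ^ 2 < ‖A.1 0 0‖ ^ 2 := by
    have := normSq_sub A
    rw [normSq_eq_norm_sq, normSq_eq_norm_sq] at this; linarith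
  have h2 : ‖A.1 0 1‖ < ‖A.1 0 0‖ := lt_of_pow_lt_pow_left₀ 2 (norm_nonneg _) h1
  have h3 : ‖conj (A.1 0 0)‖ = ‖conj (A.1 0 1) * z‖ := by
    unfold autFactor at h
    rw [eq_neg_of_add_eq_zero_right h, norm_neg]
  rw [norm_mul, norm_conj, norm_conj] at h3
  nlinarith [norm_nonneg (A.1 0 1)]

lemma autFactor_ne_zero (A : SU11) (z : 𝔻) : autFactor A z ≠ 0 := denom_ne_zero A z

lemma coe_mk_smul (A : SU11) (z : 𝔻) : (((A : PSU11) • z : 𝔻) : ℂ) = moebius A z := rfl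

lemma hasDerivAt_moebius (A : SU11) {z : ℂ} (hz : autFactor A z ≠ 0) :
    HasDerivAt (moebius A) ((autFactor A z ^ 2)⁻¹) z := by
  have h1 : HasDerivAt (fun z => A.1 0 0 * z + A.1 0 1) (A.1 0 0) z := by
    simpa using ((hasDerivAt_id z).const_mul (A.1 0 0)).add_const (A.1 0 1)
  have h2 : HasDerivAt (fun z => conj (A.1 0 1) * z + conj (A.1 0 0)) (conj (A.1 0 1)) z := by
    simpa using ((hasDerivAt_id z).const_mul (conj (A.1 0 1))).add_const (conj (A.1 0 0))
  refine (h1.div h2 hz).congr_deriv ?_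
  have h := A.1.2
  rw [Matrix.det_fin_two, show A.1.1 1 0 = conj (A.1.1 0 1) from A.2.1,
    show A.1.1 1 1 = conj (A.1.1 0 0) from A.2.2] at h
  change _ / autFactor A z ^ 2 = (autFactor A z ^ 2)⁻¹
  rw [inv_eq_one_div]
  congr 1
  linear_combination h

lemma derivAct_mk (A : SU11) (z : 𝔻) : derivAct (A : PSU11) z = (autFactor A z ^ 2)⁻¹ := by
  rw [derivAct, (zeroExt_eventuallyEq (coe_mk_smul A) z).deriv_eq]
  exact (hasDerivAt_moebius A (autFactor_ne_zero A z)).deriv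

lemma hasDerivAt_zeroExt_smul (g : PSU11) (z : 𝔻) :
    HasDerivAt (zeroExt fun w => ((g • w : 𝔻) : ℂ)) (derivAct g z) z := by
  obtain ⟨A, rfl⟩ := QuotientGroup.mk_surjective g
  rw [derivAct_mk]
  exact (hasDerivAt_moebius A (autFactor_ne_zero A z)).congr_of_eventuallyEq
    (zeroExt_eventuallyEq (coe_mk_smul A) z)

lemma derivAct_ne_zero (g : PSU11) (z : 𝔻) : derivAct g z ≠ 0 := by
  obtain ⟨A, rfl⟩ := QuotientGroup.mk_surjective g
  rw [derivAct_mk]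
  exact inv_ne_zero (pow_ne_zero 2 (autFactor_ne_zero A z))

lemma derivAct_mul (g h : PSU11) (z : 𝔻) :
    derivAct (g * h) z = derivAct g (h • z) * derivAct h z := by
  have h1 := hasDerivAt_zeroExt_smul g (h • z)
  have h2 := hasDerivAt_zeroExt_smul h z
  rw [← zeroExt_coe (fun w => ((h • w : 𝔻) : ℂ)) z] at h1
  have h3 := h1.comp (z : ℂ) h2
  have h4 : zeroExt (fun w => (((g * h) • w : 𝔻) : ℂ)) =ᶠ[𝓝 (z : ℂ)]
      zeroExt (fun w => ((g • w : 𝔻) : ℂ)) ∘ zeroExt (fun w => ((h • w : 𝔻) : ℂ)) := by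
    refine zeroExt_eventuallyEq (fun w => ?_) z
    rw [Function.comp_apply, zeroExt_coe, zeroExt_coe, mul_smul]
  rw [derivAct, h4.deriv_eq, h3.deriv]

lemma one_sub_normSq_moebius (A : SU11) {z : ℂ} (hz : autFactor A z ≠ 0) :
    1 - ‖moebius A z‖ ^ 2 = (1 - ‖z‖ ^ 2) * ‖(autFactor A z ^ 2)⁻¹‖ := by
  have h := normSq_denom A z
  have h0 : ‖autFactor A z‖ ≠ 0 := norm_ne_zero_iff.2 hz
  rw [← normSq_eq_norm_sq z, ← h, moebius, norm_div, div_pow, norm_inv, norm_pow,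
    normSq_eq_norm_sq, normSq_eq_norm_sq]
  change _ = (‖autFactor A z‖ ^ 2 - _) * _
  rw [show conj (A.1 0 1) * z + conj (A.1 0 0) = autFactor A z from rfl]
  field_simp

lemma one_sub_normSq_smul (g : PSU11) (z : 𝔻) :
    1 - ‖((g • z : 𝔻) : ℂ)‖ ^ 2 = (1 - ‖(z : ℂ)‖ ^ 2) * ‖derivAct g z‖ := by
  obtain ⟨A, rfl⟩ := QuotientGroup.mk_surjective g
  rw [derivAct_mk]
  exact one_sub_normSq_moebius A (autFactor_ne_zero A z)

lemma pull_mul (g h : PSU11) (X : 𝔻 → ℂ) : pull (g * h) X = pull h (pull g X) := by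
  ext z
  simp only [pull, derivAct_mul, mul_smul, mul_inv]
  ring

lemma pull_sub (g : PSU11) (X Y : 𝔻 → ℂ) : pull g (X - Y) = pull g X - pull g Y := by
  ext z; simp [pull, sub_mul]

lemma pull_mk (A : SU11) (X : 𝔻 → ℂ) (z : 𝔻) :
    pull (A : PSU11) X z = zeroExt X (moebius A z) * autFactor A z ^ 2 := by
  rw [pull, derivAct_mk, inv_inv, ← coe_mk_smul, zeroExt_coe]

lemma contDiff_autFactor (A : SU11) : ContDiff ℝ ∞ (autFactor A) := by
  unfold autFactor; fun_prop

lemma contDiffOn_moebius (A : SU11) : ContDiffOn ℝ ∞ (moebius A) disc := by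
  have h : ContDiffOn ℝ ∞ (fun z => A.1 0 0 * z + A.1 0 1) disc := by fun_prop
  unfold moebius
  simp only [div_eq_mul_inv]
  refine h.mul ((contDiff_autFactor A).contDiffOn.inv fun z hz => ?_)
  exact autFactor_ne_zero A ⟨z, hz⟩

lemma mapsTo_moebius (A : SU11) : MapsTo (moebius A) disc disc := fun z hz =>
  mem_disc.2 (norm_moebius_lt_one A ⟨z, hz⟩)

lemma IsSmooth.pull {X : 𝔻 → ℂ} (hX : IsSmooth X) (g : PSU11) : IsSmooth (pull g X) := by
  obtain ⟨A, rfl⟩ := QuotientGroup.mk_surjective g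
  refine isSmooth_of_eq (F := fun z => zeroExt X (moebius A z) * autFactor A z ^ 2) (pull_mk A X)
    (ContDiffOn.mul ?_ ?_)
  · exact ContDiffOn.comp hX (contDiffOn_moebius A) (mapsTo_moebius A)
  · exact ((contDiff_autFactor A).pow 2).contDiffOn

/-! ### The Lie derivative of the metric -/

lemma quadDiff_eq (X : 𝔻 → ℂ) (z : 𝔻) :
    quadDiff X z = 4 / ((1 - ‖(z : ℂ)‖ ^ 2 : ℝ) : ℂ) ^ 2 * conj (dbar (zeroExt X) z) := by
  have h1 : (fun w : ℂ => hypMetric w 1 1) = fun w : ℂ => hypMetric w I I := by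
    ext w; simp [hypMetric]
  have h2 : (fun w : ℂ => hypMetric w 1 I) = fun _ : ℂ => 0 := by
    ext w; simp [hypMetric]
  have h3 : 4 / ((1 - ‖(z : ℂ)‖ ^ 2 : ℝ) : ℂ) ^ 2 = ((4 / (1 - ‖(z : ℂ)‖ ^ 2) ^ 2 : ℝ) : ℂ) := by
    push_cast; rfl
  rw [h3]
  simp only [quadDiff, lieMetric, h1, h2]
  simp only [dbar, hypMetric]
  generalize 4 / (1 - ‖(z : ℂ)‖ ^ 2) ^ 2 = ρ
  apply Complex.ext <;> simp <;> ring

lemma quadDiff_add {X Y : 𝔻 → ℂ} (hX : IsSmooth X) (hY : IsSmooth Y) :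
    quadDiff (X + Y) = quadDiff X + quadDiff Y := by
  ext z
  simp only [Pi.add_apply, quadDiff_eq, zeroExt_add,
    dbar_add (hX.differentiableAt z) (hY.differentiableAt z), map_add, mul_add]

lemma quadDiff_sub {X Y : 𝔻 → ℂ} (hX : IsSmooth X) (hY : IsSmooth Y) :
    quadDiff (X - Y) = quadDiff X - quadDiff Y := by
  ext z
  simp only [Pi.sub_apply, quadDiff_eq, zeroExt_sub,
    dbar_sub (hX.differentiableAt z) (hY.differentiableAt z), map_sub, mul_sub]

lemma quadDiff_smul {X : 𝔻 → ℂ} (a : ℝ) (hX : IsSmooth X) : quadDiff (a • X) = a • quadDiff X := by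
  ext z
  simp only [Pi.smul_apply, quadDiff_eq, zeroExt_smul, dbar_smul a (hX.differentiableAt z), map_mul,
    conj_ofReal, real_smul]
  ring

lemma dbar_eq_zero_of_quadDiff {X : 𝔻 → ℂ} {z : 𝔻} (h : quadDiff X z = 0) :
    dbar (zeroExt X) z = 0 := by
  rw [quadDiff_eq] at h
  have h1 : ((1 - ‖(z : ℂ)‖ ^ 2 : ℝ) : ℂ) ≠ 0 := ofReal_ne_zero.2 (one_sub_normSq_pos z).ne'
  rcases mul_eq_zero.1 h with h | h
  · simp [div_eq_zero_iff] at h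
    exact absurd (mod_cast h) h1
  · simpa using h

/-- A smooth vector field is conformal exactly when it is holomorphic. -/
lemma quadDiff_eq_zero_iff {X : 𝔻 → ℂ} (hX : IsSmooth X) :
    quadDiff X = 0 ↔ DifferentiableOn ℂ (zeroExt X) disc := by
  constructor
  · intro h z hz
    exact (differentiableAt_complex_of_dbar (hX.differentiableAt ⟨z, hz⟩)
      (dbar_eq_zero_of_quadDiff (congrFun h ⟨z, hz⟩))).differentiableWithinAt
  · intro h
    ext z
    rw [quadDiff_eq, dbar_eq_zero_of_differentiableAt ((h.differentiableAt (disc_mem_nhds z)))]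
    simp

/-- Naturality of `(L_X g)^{(2,0)}` under the isometries of the disc. -/
lemma quadDiff_pull {X : 𝔻 → ℂ} (hX : IsSmooth X) (g : PSU11) (z : 𝔻) :
    quadDiff (pull g X) z = quadDiff X (g • z) * derivAct g z ^ 2 := by
  have hN := one_sub_normSq_smul g z
  have h0 := one_sub_normSq_pos z
  rw [quadDiff_eq, quadDiff_eq, hN]
  obtain ⟨A, rfl⟩ := QuotientGroup.mk_surjective g
  have hA := autFactor_ne_zero A z
  have hm := hasDerivAt_moebius A hA
  have hXz := hX.differentiableAt ((A : PSU11) • z)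
  rw [coe_mk_smul] at hXz ⊢
  have hd : DifferentiableAt ℂ (fun w => autFactor A w ^ 2) z := by
    unfold autFactor; fun_prop
  have hc : DifferentiableAt ℝ (fun w => zeroExt X (moebius A w)) z :=
    hXz.comp (z : ℂ) (hm.differentiableAt.restrictScalars ℝ)
  rw [dbar_congr (zeroExt_eventuallyEq (F := fun w => zeroExt X (moebius A w) * autFactor A w ^ 2)
      (pull_mk A X) z),
    show (fun w => zeroExt X (moebius A w) * autFactor A w ^ 2) =
      (fun w => zeroExt X (moebius A w)) * (fun w => autFactor A w ^ 2) from rfl,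
    dbar_mul hc (hd.restrictScalars ℝ), dbar_eq_zero_of_differentiableAt hd, mul_zero, add_zero,
    dbar_comp hXz hm, derivAct_mk]
  have hn : ((‖(autFactor A z ^ 2)⁻¹‖ : ℝ) : ℂ) ^ 2 =
      (autFactor A z ^ 2)⁻¹ * conj ((autFactor A z ^ 2)⁻¹) := by
    rw [mul_conj, normSq_eq_norm_sq]; push_cast; rfl
  have h0' : ((1 - ‖(z : ℂ)‖ ^ 2 : ℝ) : ℂ) ≠ 0 := ofReal_ne_zero.2 h0.ne'
  have hA' : conj (autFactor A z) ≠ 0 := by simpa using hA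
  rw [ofReal_mul, mul_pow, hn]
  simp only [map_mul, map_inv₀, map_pow, conj_conj]
  field_simp

/-! ### Fourier series on the circle -/

/-- The normalised Haar measure of the circle. -/
abbrev haarS1 : Measure S1 := AddCircle.haarAddCircle

lemma norm_pt (θ : S1) : ‖pt θ‖ = 1 := Circle.norm_coe _

lemma pt_ne_zero (θ : S1) : pt θ ≠ 0 := norm_ne_zero_iff.1 (by rw [norm_pt]; exact one_ne_zero)

lemma continuous_pt : Continuous pt :=
  continuous_subtype_val.comp AddCircle.continuous_toCircle

lemma inv_pt (θ : S1) : (pt θ)⁻¹ = conj (pt θ) := by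
  rw [inv_def, normSq_eq_norm_sq, norm_pt]; simp

lemma fourier_eq_zpow (n : ℤ) (θ : S1) : fourier n θ = pt θ ^ n := by
  rw [fourier_apply, AddCircle.toCircle_zsmul, Circle.coe_zpow]; rfl

lemma fourierCoeff_eq (g : S1 → ℂ) (n : ℤ) :
    fourierCoeff g n = ∫ θ, pt θ ^ (-n) * g θ ∂haarS1 := by
  simp only [fourierCoeff, fourier_eq_zpow, smul_eq_mul]

lemma continuous_pt_zpow (n : ℤ) : Continuous fun θ : S1 => pt θ ^ n := by
  simpa only [← fourier_eq_zpow] using (fourier (T := 2 * π) n).continuous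

lemma norm_pt_zpow (θ : S1) (n : ℤ) : ‖pt θ ^ n‖ = 1 := by rw [norm_zpow, norm_pt, one_zpow]

lemma integral_pt_zpow (n : ℤ) : ∫ θ, pt θ ^ n ∂haarS1 = if n = 0 then 1 else 0 := by
  have h := congrFun (fourierCoeff_fourier (T := 2 * π) n) 0
  rw [fourierCoeff_eq] at h
  simp only [neg_zero, zpow_zero, one_mul, fourier_eq_zpow] at h
  rw [h, Pi.single_apply]
  simp only [eq_comm]

lemma integrable_of_continuous {g : S1 → ℂ} (hg : Continuous g) : Integrable g haarS1 :=
  hg.integrable_of_hasCompactSupport (HasCompactSupport.of_compactSpace g)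

lemma memLp_of_continuous {g : S1 → ℂ} (hg : Continuous g) : MemLp g 2 haarS1 := by
  obtain ⟨C, hC⟩ := isCompact_univ.exists_bound_of_continuousOn hg.continuousOn
  exact MemLp.of_bound hg.aestronglyMeasurable C (ae_of_all _ fun θ => hC θ (mem_univ θ))

lemma integrable_L2 (Y : L2S1) : Integrable Y haarS1 := (Lp.memLp Y).integrable (by norm_num)

/-- The Fourier coefficients of an absolutely convergent trigonometric series without terms of
negative frequency. -/
lemma fourierCoeff_of_hasSum {a : ℕ → ℂ} (ha : Summable fun k => ‖a k‖) {g : S1 → ℂ}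
    (hg : ∀ θ, HasSum (fun k => a k * pt θ ^ k) (g θ)) (n : ℤ) :
    fourierCoeff g n = if 0 ≤ n then a n.toNat else 0 := by
  have h1 : ∀ k : ℕ, ∀ θ, pt θ ^ (-n) * (a k * pt θ ^ k) = a k * pt θ ^ ((k : ℤ) - n) := by
    intro k θ
    rw [sub_eq_add_neg, zpow_add₀ (pt_ne_zero θ), zpow_natCast]; ring
  have h2 : HasSum (fun k : ℕ => ∫ θ, pt θ ^ (-n) * (a k * pt θ ^ k) ∂haarS1)
      (∫ θ, ∑' k : ℕ, pt θ ^ (-n) * (a k * pt θ ^ k) ∂haarS1) := by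
    refine hasSum_integral_of_summable_integral_norm (fun k => ?_) ?_
    · exact integrable_of_continuous
        ((continuous_pt_zpow _).mul (continuous_const.mul (continuous_pt.pow k)))
    · refine ha.congr fun k => ?_
      simp only [h1, norm_mul, norm_pt_zpow, mul_one, integral_const]
      simp
  have h3 : fourierCoeff g n = ∫ θ, ∑' k : ℕ, pt θ ^ (-n) * (a k * pt θ ^ k) ∂haarS1 := by
    rw [fourierCoeff_eq]
    exact integral_congr_ae (ae_of_all _ fun θ => ((hg θ).mul_left _).tsum_eq.symm)
  rw [h3]
  refine h2.unique ?_
  simp only [h1, integral_const_mul, integral_pt_zpow]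
  split_ifs with hn
  · convert hasSum_single n.toNat ?_ using 1
    · simp [Int.toNat_of_nonneg hn]
    · intro k hk
      rw [if_neg (by omega), mul_zero]
  · convert hasSum_zero with k
    rw [if_neg (by omega), mul_zero]

/-- The Taylor coefficients at `0`. -/
def taylorCoeff (f : ℂ → ℂ) (n : ℕ) : ℂ := (n.factorial : ℂ)⁻¹ * iteratedDeriv n f 0

lemma hasSum_taylorCoeff {f : ℂ → ℂ} (hf : DifferentiableOn ℂ f disc) {z : ℂ} (hz : z ∈ disc) :
    HasSum (fun n => taylorCoeff f n * z ^ n) (f z) := by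
  have := hasSum_taylorSeries_on_ball hf hz
  refine this.congr_fun ?_ |> id
  intro n
  simp only [taylorCoeff, sub_zero, smul_eq_mul]; ring

lemma taylorCoeff_deriv (f : ℂ → ℂ) (n : ℕ) :
    taylorCoeff (deriv f) n = (n + 1) * taylorCoeff f (n + 1) := by
  rw [taylorCoeff, taylorCoeff, ← iteratedDeriv_succ', Nat.factorial_succ]
  have : ((n.factorial : ℕ) : ℂ) ≠ 0 := Nat.cast_ne_zero.2 n.factorial_ne_zero
  have h2 : (n + 1 : ℂ) ≠ 0 := by exact_mod_cast n.succ_ne_zero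
  push_cast
  field_simp

lemma summable_taylorCoeff {f : ℂ → ℂ} (hf : DifferentiableOn ℂ f disc) {r : ℝ} (h0 : 0 ≤ r)
    (h1 : r < 1) : Summable fun n => ‖taylorCoeff f n * (r : ℂ) ^ n‖ :=
  (hasSum_taylorCoeff hf (z := r) (by simpa [abs_of_nonneg h0] using h1)).summable.norm

lemma mul_pt_mem_disc {r : ℝ} (h0 : 0 ≤ r) (h1 : r < 1) (θ : S1) : (r * pt θ : ℂ) ∈ disc := by
  rw [mem_disc, norm_mul, norm_pt, mul_one, norm_real, Real.norm_of_nonneg h0]; exact h1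

/-- The extension of the Taylor coefficients to negative indices by zero. -/
def taylorCoeffZ (f : ℂ → ℂ) (n : ℤ) : ℂ := if 0 ≤ n then taylorCoeff f n.toNat else 0

lemma taylorCoeffZ_natCast (f : ℂ → ℂ) (n : ℕ) : taylorCoeffZ f n = taylorCoeff f n := by
  simp [taylorCoeffZ]

lemma taylorCoeffZ_of_neg (f : ℂ → ℂ) {n : ℤ} (hn : n < 0) : taylorCoeffZ f n = 0 := by
  rw [taylorCoeffZ, if_neg (by omega)]

lemma taylorCoeffZ_deriv (f : ℂ → ℂ) (n : ℤ) :
    taylorCoeffZ (deriv f) n = (n + 1) * taylorCoeffZ f (n + 1) := by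
  rcases le_or_gt 0 n with hn | hn
  · lift n to ℕ using hn
    rw [taylorCoeffZ_natCast, taylorCoeff_deriv, show (n : ℤ) + 1 = ((n + 1 : ℕ) : ℤ) from rfl,
      taylorCoeffZ_natCast]
    push_cast; rfl
  · rw [taylorCoeffZ_of_neg _ hn]
    rcases eq_or_lt_of_le (show n + 1 ≤ 0 by omega) with h | h
    · rw [show n = -1 by omega]; simp
    · rw [taylorCoeffZ_of_neg _ h, mul_zero]

lemma fourierCoeff_of_holomorphic {f : ℂ → ℂ} (hf : DifferentiableOn ℂ f disc) {r : ℝ} (h0 : 0 < r)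
    (h1 : r < 1) (n : ℤ) :
    fourierCoeff (fun θ : S1 => f (r * pt θ)) n = taylorCoeffZ f n * r ^ n := by
  rw [fourierCoeff_of_hasSum (summable_taylorCoeff hf h0.le h1)]
  · rw [taylorCoeffZ]
    split_ifs with hn
    · congr 1
      conv_rhs => rw [← Int.toNat_of_nonneg hn, zpow_natCast]
    · rw [zero_mul]
  · intro θ
    have := hasSum_taylorCoeff hf (mul_pt_mem_disc h0.le h1 θ)
    simpa only [mul_pow, mul_assoc] using this

lemma fourierCoeff_conj (g : S1 → ℂ) (n : ℤ) :
    fourierCoeff (fun θ => conj (g θ)) n = conj (fourierCoeff g (-n)) := by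
  rw [fourierCoeff_eq, fourierCoeff_eq, ← integral_conj]
  refine integral_congr_ae (ae_of_all _ fun θ => ?_)
  simp only [map_mul, map_zpow₀, ← inv_pt, neg_neg, inv_zpow, zpow_neg]

lemma fourierCoeff_zpow_mul (g : S1 → ℂ) (k n : ℤ) :
    fourierCoeff (fun θ => pt θ ^ k * g θ) n = fourierCoeff g (n - k) := by
  rw [fourierCoeff_eq, fourierCoeff_eq]
  refine integral_congr_ae (ae_of_all _ fun θ => ?_)
  simp only [← mul_assoc, ← zpow_add₀ (pt_ne_zero θ)]
  congr 2; ring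

lemma fourierCoeff_sub {f g : S1 → ℂ} (hf : Integrable f haarS1) (hg : Integrable g haarS1) (n : ℤ) :
    fourierCoeff (f - g) n = fourierCoeff f n - fourierCoeff g n := by
  have h : f - g = f + fun θ => (-1 : ℂ) * g θ := by ext θ; simp [sub_eq_add_neg]
  have := fourierCoeff.add hf (hg.const_mul (-1 : ℂ))
  rw [h, this, Pi.add_apply, fourierCoeff.const_mul]; ring

lemma L2_ext {Y Z : L2S1} (h : ∀ n, fourierCoeff Y n = fourierCoeff Z n) : Y = Z := by
  refine fourierBasis.repr.injective (lp.ext (funext fun n => ?_))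
  rw [fourierBasis_repr, fourierBasis_repr, h]

lemma ae_eq_of_fourierCoeff {f g : S1 → ℂ} (hf : MemLp f 2 haarS1) (hg : MemLp g 2 haarS1)
    (h : ∀ n, fourierCoeff f n = fourierCoeff g n) : f =ᵐ[haarS1] g := by
  have h1 : hf.toLp f = hg.toLp g := L2_ext fun n => by
    rw [fourierCoeff_congr_ae hf.coeFn_toLp, fourierCoeff_congr_ae hg.coeFn_toLp, h]
  exact (MemLp.toLp_eq_toLp_iff hf hg).1 h1

lemma exists_L2_of_fourierCoeff {a : ℤ → ℂ} (ha : Summable fun n => ‖a n‖ ^ 2) :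
    ∃ Y : L2S1, ∀ n, fourierCoeff Y n = a n := by
  have hm : Memℓp a 2 := memℓp_gen (by simpa using ha)
  refine ⟨fourierBasis.repr.symm ⟨a, hm⟩, fun n => ?_⟩
  rw [← fourierBasis_repr, LinearIsometryEquiv.apply_symm_apply]

lemma norm_sq_eq_tsum (Y : L2S1) : ‖Y‖ ^ 2 = ∑' n : ℤ, ‖fourierCoeff Y n‖ ^ 2 := by
  have h := lp.norm_rpow_eq_tsum (p := 2) (by norm_num) (fourierBasis.repr Y)
  rw [LinearIsometryEquiv.norm_map] at h
  simpa [fourierBasis_repr] using h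

lemma summable_sq_fourierCoeff (Y : L2S1) : Summable fun n : ℤ => ‖fourierCoeff Y n‖ ^ 2 :=
  (hasSum_sq_fourierCoeff Y).summable

/-! ### `L²` boundary values -/

lemma continuous_slice {X : 𝔻 → ℂ} (hX : ContinuousOn (zeroExt X) disc) {r : ℝ} (h0 : 0 ≤ r)
    (h1 : r < 1) : Continuous fun θ : S1 => zeroExt X (r * pt θ) :=
  hX.comp_continuous (continuous_const.mul continuous_pt) (mul_pt_mem_disc h0 h1)

lemma eventually_radius : ∀ᶠ r : ℝ in 𝓝[<] 1, 0 < r ∧ r < 1 :=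
  Ioo_mem_nhdsLT one_pos

lemma HasL2Extension.congr_ae {X : 𝔻 → ℂ} {Y : L2S1} {g : S1 → ℂ} (h : Y =ᵐ[haarS1] g) :
    HasL2Extension X Y ↔ Tendsto (fun r : ℝ => eLpNorm (fun θ : S1 => zeroExt X (r * pt θ) - g θ) 2
      haarS1) (𝓝[<] 1) (𝓝 0) := by
  refine tendsto_congr fun r => eLpNorm_congr_ae ?_
  filter_upwards [h] with θ hθ
  rw [hθ]

/-- Fourier coefficients on the circles of radius `r` converge to those of the boundary value. -/
lemma HasL2Extension.tendsto_fourierCoeff {X : 𝔻 → ℂ} {Y : L2S1} (hX : IsSmooth X)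
    (h : HasL2Extension X Y) (n : ℤ) :
    Tendsto (fun r : ℝ => fourierCoeff (fun θ : S1 => zeroExt X (r * pt θ)) n) (𝓝[<] 1)
      (𝓝 (fourierCoeff Y n)) := by
  rw [tendsto_iff_norm_sub_tendsto_zero]
  have h' : Tendsto (fun r : ℝ => (eLpNorm (fun θ : S1 => zeroExt X (r * pt θ) - Y θ) 2
    haarS1).toReal) (𝓝[<] 1) (𝓝 0) := by
    exact (ENNReal.tendsto_toReal ENNReal.zero_ne_top).comp h
  refine squeeze_zero' (Eventually.of_forall fun _ => norm_nonneg _) ?_ h'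
  filter_upwards [eventually_radius] with r hr
  have hc := continuous_slice (ContDiffOn.continuousOn hX) hr.1.le hr.2
  have hm : MemLp (fun θ : S1 => zeroExt X (r * pt θ) - Y θ) 2 haarS1 :=
    (memLp_of_continuous hc).sub (Lp.memLp Y)
  rw [← fourierCoeff_sub (integrable_of_continuous hc) (integrable_L2 Y), fourierCoeff_eq]
  refine (norm_integral_le_integral_norm _).trans ?_
  simp only [norm_mul, norm_pt_zpow, one_mul]
  change ∫ θ, ‖zeroExt X (r * pt θ) - Y θ‖ ∂haarS1 ≤ _
  rw [integral_norm_eq_lintegral_enorm hm.1, ← eLpNorm_one_eq_lintegral_enorm]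
  exact ENNReal.toReal_mono hm.2.ne (eLpNorm_le_eLpNorm_of_exponent_le (by norm_num) hm.1)

lemma HasL2Extension.unique {X : 𝔻 → ℂ} {Y Z : L2S1} (hX : IsSmooth X)
    (hY : HasL2Extension X Y) (hZ : HasL2Extension X Z) : Y = Z :=
  L2_ext fun n => tendsto_nhds_unique (hY.tendsto_fourierCoeff hX n) (hZ.tendsto_fourierCoeff hX n)

lemma HasL2Extension.add {X X' : 𝔻 → ℂ} {Y Y' : L2S1} (hX : IsSmooth X) (hX' : IsSmooth X')
    (hY : HasL2Extension X Y) (hY' : HasL2Extension X' Y') : HasL2Extension (X + X') (Y + Y') := by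
  rw [HasL2Extension.congr_ae (Lp.coeFn_add Y Y')]
  have h := Tendsto.add (show Tendsto _ _ _ from hY) (show Tendsto _ _ _ from hY')
  rw [add_zero] at h
  refine tendsto_of_tendsto_of_tendsto_of_le_of_le' tendsto_const_nhds h
    (Eventually.of_forall fun _ => zero_le) ?_
  filter_upwards [eventually_radius] with r hr
  have hc := continuous_slice (ContDiffOn.continuousOn hX) hr.1.le hr.2
  have hc' := continuous_slice (ContDiffOn.continuousOn hX') hr.1.le hr.2
  refine le_trans (le_of_eq ?_) (eLpNorm_add_le
    (hc.aestronglyMeasurable.sub (Lp.aestronglyMeasurable Y))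
    (hc'.aestronglyMeasurable.sub (Lp.aestronglyMeasurable Y')) one_le_two)
  congr 1
  ext θ
  simp only [zeroExt_add, Pi.add_apply]; ring

lemma HasL2Extension.smul {X : 𝔻 → ℂ} {Y : L2S1} (a : ℝ) (hY : HasL2Extension X Y) :
    HasL2Extension (a • X) (a • Y) := by
  rw [HasL2Extension.congr_ae (Lp.coeFn_smul a Y)]
  have h : Tendsto _ _ (𝓝 ((‖a‖₊ : ℝ≥0∞) * 0)) :=
    ENNReal.Tendsto.const_mul hY (Or.inr ENNReal.coe_ne_top)
  rw [mul_zero] at h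
  refine h.congr fun r => ?_
  rw [← enorm_eq_nnnorm, ← eLpNorm_const_smul]
  congr 1
  ext θ
  simp only [zeroExt_smul, Pi.smul_apply, smul_sub]

lemma HasL2Extension.sub {X X' : 𝔻 → ℂ} {Y Y' : L2S1} (hX : IsSmooth X) (hX' : IsSmooth X')
    (hY : HasL2Extension X Y) (hY' : HasL2Extension X' Y') : HasL2Extension (X - X') (Y - Y') := by
  have h := hY.add hX (hX'.smul (-1)) (hY'.smul (-1))
  simpa [sub_eq_add_neg] using h

/-- An `L²` field on the circle extends a continuous field on the disc if the Fourier coefficients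
on the circles of radius `r` are obtained from those of the field by bounded multipliers that tend
to `1`. -/
lemma hasL2Extension_of_multiplier {X : 𝔻 → ℂ} {Y : L2S1} (hX : IsSmooth X) (μ : ℤ → ℝ → ℂ)
    (C : ℝ) (hC : ∀ n r, 0 < r → r < 1 → ‖μ n r‖ ≤ C)
    (hμ : ∀ n, Tendsto (μ n) (𝓝[<] 1) (𝓝 1))
    (hc : ∀ n (r : ℝ), 0 < r → r < 1 →
      fourierCoeff (fun θ : S1 => zeroExt X (r * pt θ)) n = μ n r * fourierCoeff Y n) :
    HasL2Extension X Y := by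
  have key : ∀ r : ℝ, 0 < r → r < 1 →
      eLpNorm (fun θ : S1 => zeroExt X (r * pt θ) - Y θ) 2 haarS1 =
        ENNReal.ofReal √(∑' n : ℤ, ‖(μ n r - 1) * fourierCoeff Y n‖ ^ 2) := by
    intro r h0 h1
    have hcont := continuous_slice (ContDiffOn.continuousOn hX) h0.le h1
    have hm := (memLp_of_continuous hcont)
    have hd : MemLp (fun θ : S1 => zeroExt X (r * pt θ) - Y θ) 2 haarS1 := hm.sub (Lp.memLp Y)
    have hn := norm_sq_eq_tsum (hd.toLp _)
    have hco : ∀ n, fourierCoeff (hd.toLp _) n = (μ n r - 1) * fourierCoeff Y n := by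
      intro n
      rw [fourierCoeff_congr_ae hd.coeFn_toLp, sub_mul, one_mul, ← hc n r h0 h1]
      exact fourierCoeff_sub (integrable_of_continuous hcont) (integrable_L2 Y) n
    simp only [hco] at hn
    rw [← hn, Real.sqrt_sq (norm_nonneg _), Lp.norm_toLp, ENNReal.ofReal_toReal hd.2.ne]
  have h2 : Tendsto (fun r : ℝ => ENNReal.ofReal √(∑' n : ℤ, ‖(μ n r - 1) * fourierCoeff Y n‖ ^ 2))
      (𝓝[<] 1) (𝓝 0) := by
    have h3 : Tendsto (fun r : ℝ => ∑' n : ℤ, ‖(μ n r - 1) * fourierCoeff Y n‖ ^ 2)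
        (𝓝[<] 1) (𝓝 (∑' n : ℤ, 0)) := by
      refine tendsto_tsum_of_dominated_convergence
        (bound := fun n : ℤ => (C + 1) ^ 2 * ‖fourierCoeff Y n‖ ^ 2)
        ((summable_sq_fourierCoeff Y).mul_left _) (fun n => ?_) ?_
      · have : Tendsto (fun r => ‖(μ n r - 1) * fourierCoeff Y n‖ ^ 2) (𝓝[<] 1)
            (𝓝 (‖((1 : ℂ) - 1) * fourierCoeff Y n‖ ^ 2)) :=
          ((((hμ n).sub_const 1).mul_const _).norm).pow 2
        simpa using this
      · filter_upwards [eventually_radius] with r hr n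
        rw [Real.norm_of_nonneg (by positivity), norm_mul, mul_pow]
        gcongr
        calc ‖μ n r - 1‖ ≤ ‖μ n r‖ + ‖(1 : ℂ)‖ := norm_sub_le _ _
          _ ≤ C + 1 := by rw [norm_one]; gcongr; exact hC n r hr.1 hr.2
    rw [tsum_zero] at h3
    have := ENNReal.tendsto_ofReal (h3.sqrt)
    simpa using this
  refine h2.congr' ?_
  filter_upwards [eventually_radius] with r hr
  exact (key r hr.1 hr.2).symm

/-! ### Tangential fields on the circle -/

lemma tangential_iff {w y : ℂ} (hw : ‖w‖ = 1) :
    (∃ s : ℝ, y = s * (I * w)) ↔ conj y = -(w ^ (-2 : ℤ) * y) := by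
  have h0 : w ≠ 0 := norm_ne_zero_iff.1 (by rw [hw]; exact one_ne_zero)
  have hc : conj w = w⁻¹ := by rw [inv_def, normSq_eq_norm_sq, hw]; simp
  constructor
  · rintro ⟨s, rfl⟩
    simp only [map_mul, conj_ofReal, conj_I, hc]
    rw [show (-2 : ℤ) = -((2 : ℕ) : ℤ) by rfl, zpow_neg, zpow_natCast]
    field_simp
  · intro h
    have h1 : conj (y / (I * w)) = y / (I * w) := by
      rw [map_div₀, map_mul, conj_I, hc, h, show (-2 : ℤ) = -((2 : ℕ) : ℤ) by rfl, zpow_neg,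
        zpow_natCast]
      field_simp
    obtain ⟨s, hs⟩ := conj_eq_iff_real.1 h1
    refine ⟨s, ?_⟩
    rw [← hs, div_mul_cancel₀ _ (mul_ne_zero I_ne_zero h0)]

lemma memLp_conj {g : S1 → ℂ} (h : MemLp g 2 haarS1) : MemLp (fun θ => conj (g θ)) 2 haarS1 :=
  ⟨continuous_conj.comp_aestronglyMeasurable h.1, by
    have : eLpNorm (fun θ => conj (g θ)) 2 haarS1 = eLpNorm g 2 haarS1 :=
      eLpNorm_congr_norm_ae (ae_of_all _ fun θ => norm_conj _)
    rw [this]; exact h.2⟩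

lemma memLp_mul_continuous {g b : S1 → ℂ} (h : MemLp g 2 haarS1) (hb : Continuous b) :
    MemLp (fun θ => b θ * g θ) 2 haarS1 := by
  obtain ⟨C, hC⟩ := isCompact_univ.exists_bound_of_continuousOn hb.continuousOn
  refine MemLp.of_le_mul (c := C) h (hb.aestronglyMeasurable.mul h.1) (ae_of_all _ fun θ => ?_)
  rw [norm_mul]
  gcongr
  exact hC θ (mem_univ θ)

/-- Tangential fields are characterised by a symmetry of the Fourier coefficients. -/
lemma isTangential_iff_fourierCoeff (Y : L2S1) :
    IsTangential Y ↔ ∀ n : ℤ, conj (fourierCoeff Y (-n)) = -fourierCoeff Y (n + 2) := by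
  have h1 : ∀ n, fourierCoeff (fun θ => -(pt θ ^ (-2 : ℤ) * Y θ)) n = -fourierCoeff Y (n + 2) := by
    intro n
    have h := fourierCoeff.const_mul (fun θ => pt θ ^ (-2 : ℤ) * Y θ) (-1) n
    simp only [neg_mul, one_mul] at h
    rw [h, fourierCoeff_zpow_mul, sub_neg_eq_add]
  have h2 : IsTangential Y ↔ (fun θ => conj (Y θ)) =ᵐ[haarS1] fun θ => -(pt θ ^ (-2 : ℤ) * Y θ) := by
    refine eventually_congr (ae_of_all _ fun θ => ?_)
    exact tangential_iff (norm_pt θ)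
  rw [h2]
  constructor
  · intro h n
    rw [← fourierCoeff_conj, fourierCoeff_congr_ae h, h1]
  · intro h
    refine ae_eq_of_fourierCoeff (memLp_conj (Lp.memLp Y))
      (memLp_mul_continuous (Lp.memLp Y) (continuous_pt_zpow (-2))).neg fun n => ?_
    rw [fourierCoeff_conj, h n]
    exact (h1 n).symm

lemma IsTangential.add {Y Z : L2S1} (hY : IsTangential Y) (hZ : IsTangential Z) :
    IsTangential (Y + Z) := by
  filter_upwards [hY, hZ, Lp.coeFn_add Y Z] with θ ⟨s, hs⟩ ⟨t, ht⟩ h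
  exact ⟨s + t, by rw [h, Pi.add_apply, hs, ht]; push_cast; ring⟩

lemma IsTangential.smul {Y : L2S1} (a : ℝ) (hY : IsTangential Y) : IsTangential (a • Y) := by
  filter_upwards [hY, Lp.coeFn_smul a Y] with θ ⟨s, hs⟩ h
  exact ⟨a * s, by rw [h, Pi.smul_apply, hs, real_smul]; push_cast; ring⟩

lemma IsTangential.sub {Y Z : L2S1} (hY : IsTangential Y) (hZ : IsTangential Z) :
    IsTangential (Y - Z) := by
  have h := hY.add (hZ.smul (-1))
  simpa [sub_eq_add_neg] using h

/-! ### The tension field in complex notation -/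

lemma gCoef_eq (i j : Fin 2) :
    gCoef i j = fun z : ℂ => if i = j then 4 / (1 - ‖z‖ ^ 2) ^ 2 else 0 := by
  ext z
  fin_cases i <;> fin_cases j <;> simp [gCoef, hypMetric, frame]

lemma hasFDerivAt_normSq (z : ℂ) :
    HasFDerivAt (fun w : ℂ => ‖w‖ ^ 2) (2 • (innerSL ℝ z)) z :=
  (hasStrictFDerivAt_norm_sq z).hasFDerivAt

lemma inner_frame (z : ℂ) (k : Fin 2) : inner ℝ z (frame k) = coord k z := by
  fin_cases k <;> simp [frame, coord, inner]

lemma partialD_gCoef (i j k : Fin 2) {z : ℂ} (hz : z ∈ disc) :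
    partialD k (gCoef i j) z = if i = j then 16 * coord k z / (1 - ‖z‖ ^ 2) ^ 3 else 0 := by
  have h0 : 1 - ‖z‖ ^ 2 ≠ 0 := (one_sub_normSq_pos ⟨z, hz⟩).ne'
  rw [partialD, gCoef_eq]
  split_ifs with h
  · have h1 : HasFDerivAt (fun w : ℂ => 1 - ‖w‖ ^ 2) (-(2 • (innerSL ℝ z))) z :=
      (hasFDerivAt_normSq z).const_sub 1
    have h2 : HasDerivAt (fun x : ℝ => 4 / x ^ 2) (-8 / (1 - ‖z‖ ^ 2) ^ 3) (1 - ‖z‖ ^ 2) := by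
      have h4 : HasDerivAt (fun x : ℝ => x ^ 2) _ (1 - ‖z‖ ^ 2) := hasDerivAt_pow 2 _
      refine ((h4.fun_inv (pow_ne_zero 2 h0)).const_mul 4).congr_deriv ?_
      field_simp
      ring
    have h3 := h2.comp_hasFDerivAt z h1
    rw [show (fun w : ℂ => 4 / (1 - ‖w‖ ^ 2) ^ 2) =
      (fun x : ℝ => 4 / x ^ 2) ∘ fun w : ℂ => 1 - ‖w‖ ^ 2 from rfl, h3.fderiv]
    simp only [_root_.smul_apply, _root_.neg_apply, innerSL_apply_apply, inner_frame, nsmul_eq_mul,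
      smul_eq_mul]
    push_cast
    ring
  · simp

/-- The Christoffel symbols of the conformal metric `e^{2u} (dx^2 + dy^2)` with
`∂_k u = 2 x_k / (1 - |z|^2)`. -/
lemma christoffel_eq (k i j : Fin 2) {z : ℂ} (hz : z ∈ disc) :
    christoffel k i j z = 2 / (1 - ‖z‖ ^ 2) *
      ((if k = i then coord j z else 0) + (if k = j then coord i z else 0)
        - if i = j then coord k z else 0) := by
  have h0 : 1 - ‖z‖ ^ 2 ≠ 0 := (one_sub_normSq_pos ⟨z, hz⟩).ne'
  simp only [christoffel, partialD_gCoef _ _ _ hz, gInv, Fin.sum_univ_two]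
  fin_cases k <;> fin_cases i <;> fin_cases j <;> simp <;> field_simp <;> ring

lemma exists_coord_eq_clm (α : Fin 2) : ∃ L : ℂ →L[ℝ] ℝ, ∀ z, coord α z = L z := by
  fin_cases α
  · exact ⟨reCLM, fun z => rfl⟩
  · exact ⟨imCLM, fun z => rfl⟩

lemma partialD_coord {φ : ℂ → ℂ} {z : ℂ} (h : DifferentiableAt ℝ φ z) (i α : Fin 2) :
    partialD i (fun w => coord α (φ w)) z = coord α (fderiv ℝ φ z (frame i)) := by
  obtain ⟨L, hL⟩ := exists_coord_eq_clm α
  simp only [hL, partialD]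
  rw [show (fun w => L (φ w)) = L ∘ φ from rfl, (L.hasFDerivAt.comp z h.hasFDerivAt).fderiv]
  rfl

/-- The Laplacian in the coordinates `x, y`. -/
def lap (F : ℂ → ℂ) (z : ℂ) : ℂ :=
  fderiv ℝ (fun w => fderiv ℝ F w 1) z 1 + fderiv ℝ (fun w => fderiv ℝ F w I) z I

/-- The tension field as a complex number: `(1-|z|^2)^2 / 4` times
`Δφ + 2 conj φ / (1-|φ|^2) * ((∂_x φ)^2 + (∂_y φ)^2)`. -/
def complexTension (φ : ℂ → ℂ) (z : ℂ) : ℂ :=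
  (((1 - ‖z‖ ^ 2) ^ 2 / 4 : ℝ) : ℂ) * (lap φ z + ((2 / (1 - ‖φ z‖ ^ 2) : ℝ) : ℂ) * conj (φ z) *
    (fderiv ℝ φ z 1 ^ 2 + fderiv ℝ φ z I ^ 2))

lemma tension_eq {φ : ℂ → ℂ} {z : ℂ} (hφ : ContDiffOn ℝ ∞ φ disc) (hz : z ∈ disc) (hφz : φ z ∈ disc)
    (α : Fin 2) : tension φ α z = coord α (complexTension φ z) := by
  have hd : ∀ w ∈ disc, DifferentiableAt ℝ φ w := fun w hw =>
    (hφ.contDiffAt (isOpen_disc.mem_nhds hw)).differentiableAt (by simp)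
  have hd2 : ∀ v : ℂ, DifferentiableAt ℝ (fun w => fderiv ℝ φ w v) z := by
    intro v
    have h1 : ContDiffAt ℝ 1 (fderiv ℝ φ) z :=
      (hφ.contDiffAt (isOpen_disc.mem_nhds hz)).fderiv_right (m := 1) (by norm_num; exact ENat.LEInfty.out)
    exact (h1.differentiableAt (by simp)).clm_apply (differentiableAt_const v)
  have h2 : ∀ i j : Fin 2, partialD i (partialD j fun w => coord α (φ w)) z =
      coord α (fderiv ℝ (fun w => fderiv ℝ φ w (frame j)) z (frame i)) := by
    intro i j
    rw [← partialD_coord (hd2 (frame j)) i α, partialD, partialD]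
    congr 1
    refine Filter.EventuallyEq.fderiv_eq ?_
    filter_upwards [isOpen_disc.mem_nhds hz] with w hw using partialD_coord (hd w hw) j α
  simp only [tension, h2, partialD_coord (hd z hz), christoffel_eq _ _ _ hz,
    christoffel_eq _ _ _ hφz, gInv, Fin.sum_univ_two, complexTension, lap]
  rw [show frame 0 = 1 from rfl, show frame 1 = I from rfl]
  generalize 2 / (1 - ‖φ z‖ ^ 2) = ρ
  fin_cases α <;> simp [coord, pow_two] <;> ring

/-! ### The linearised tension field -/

section Family

variable {ε : ℝ} {G : ℝ × ℂ → ℂ}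

lemma uniqueDiffOn_cylinder (ε : ℝ) : UniqueDiffOn ℝ (Ico 0 ε ×ˢ disc) :=
  (uniqueDiffOn_Ico 0 ε).prod isOpen_disc.uniqueDiffOn

lemma contDiffOn_dirDeriv (hG : ContDiffOn ℝ ∞ G (Ico 0 ε ×ˢ disc)) (v : ℝ × ℂ) :
    ContDiffOn ℝ ∞ (fun p => fderivWithin ℝ G (Ico 0 ε ×ˢ disc) p v) (Ico 0 ε ×ˢ disc) :=
  (hG.fderivWithin (uniqueDiffOn_cylinder ε) (by simp)).clm_apply contDiffOn_const

lemma fderiv_slice (hG : ContDiffOn ℝ ∞ G (Ico 0 ε ×ˢ disc)) {t : ℝ} {z : ℂ} (ht : t ∈ Ico 0 ε)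
    (hz : z ∈ disc) (v : ℂ) :
    fderiv ℝ (fun w => G (t, w)) z v = fderivWithin ℝ G (Ico 0 ε ×ˢ disc) (t, z) (0, v) := by
  have h1 : HasFDerivWithinAt G _ (Ico 0 ε ×ˢ disc) (t, z) :=
    (hG.differentiableOn (by simp) (t, z) ⟨ht, hz⟩).hasFDerivWithinAt
  have h2 : HasFDerivWithinAt (fun w : ℂ => (t, w)) (ContinuousLinearMap.inr ℝ ℝ ℂ) disc z :=
    (hasFDerivAt_prodMk_right t z).hasFDerivWithinAt
  have h3 := (h1.comp z h2 (fun w hw => ⟨ht, hw⟩)).hasFDerivAt (isOpen_disc.mem_nhds hz)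
  rw [show (fun w => G (t, w)) = G ∘ fun w => (t, w) from rfl, h3.fderiv]
  rfl

lemma hasDerivWithinAt_time (hε : 0 < ε) (hG : ContDiffOn ℝ ∞ G (Ico 0 ε ×ˢ disc)) {z : ℂ}
    (hz : z ∈ disc) :
    HasDerivWithinAt (fun t => G (t, z)) (fderivWithin ℝ G (Ico 0 ε ×ˢ disc) (0, z) (1, 0))
      (Ici 0) 0 := by
  have h1 : HasFDerivWithinAt G _ (Ico 0 ε ×ˢ disc) (0, z) :=
    (hG.differentiableOn (by simp) (0, z) ⟨⟨le_rfl, hε⟩, hz⟩).hasFDerivWithinAt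
  have h2 : HasDerivWithinAt (fun t : ℝ => (t, z)) ((1 : ℝ), (0 : ℂ)) (Ico 0 ε) 0 :=
    (hasDerivWithinAt_id _ _).prodMk (hasDerivWithinAt_const _ _ _)
  exact (h1.comp_hasDerivWithinAt (0 : ℝ) h2
    (show MapsTo _ _ (Ico 0 ε ×ˢ disc) from fun t ht => ⟨ht, hz⟩)).mono_of_mem_nhdsWithin
    (Ico_mem_nhdsGE hε)

/-- Interchange of the derivative in `t` at the end point `t = 0` and a derivative in `z`. -/
lemma hasDerivWithinAt_dirDeriv (hε : 0 < ε) (hG : ContDiffOn ℝ ∞ G (Ico 0 ε ×ˢ disc)) {z : ℂ}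
    (hz : z ∈ disc) (v : ℂ) :
    HasDerivWithinAt (fun t => fderivWithin ℝ G (Ico 0 ε ×ˢ disc) (t, z) (0, v))
      (fderiv ℝ (fun w => fderivWithin ℝ G (Ico 0 ε ×ˢ disc) (0, w) (1, 0)) z v) (Ici 0) 0 := by
  have hs := uniqueDiffOn_cylinder ε
  have h0 : (0 : ℝ) ∈ Ico 0 ε := ⟨le_rfl, hε⟩
  have hmem : ((0 : ℝ), z) ∈ Ico 0 ε ×ˢ disc := ⟨h0, hz⟩
  have hsymm : IsSymmSndFDerivWithinAt ℝ G (Ico 0 ε ×ˢ disc) (0, z) := by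
    refine (hG (0, z) hmem).isSymmSndFDerivWithinAt
      (by rw [minSmoothness_of_isRCLikeNormedField]; exact ENat.LEInfty.out) hs ?_ hmem
    rw [interior_prod_eq, interior_Ico, isOpen_disc.interior_eq, closure_prod_eq,
      closure_Ioo hε.ne]
    exact ⟨⟨le_rfl, hε.le⟩, subset_closure hz⟩
  have hd : DifferentiableWithinAt ℝ (fderivWithin ℝ G (Ico 0 ε ×ˢ disc)) (Ico 0 ε ×ˢ disc) (0, z) :=
    ((hG.fderivWithin (m := ∞) hs (by simp)).differentiableOn (by simp)) _ hmem
  have hv : ∀ a b : ℝ × ℂ, fderivWithin ℝ (fun p => fderivWithin ℝ G (Ico 0 ε ×ˢ disc) p a)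
      (Ico 0 ε ×ˢ disc) (0, z) b =
      fderivWithin ℝ (fderivWithin ℝ G (Ico 0 ε ×ˢ disc)) (Ico 0 ε ×ˢ disc) (0, z) b a := by
    intro a b
    have := (hd.hasFDerivWithinAt.clm_apply (hasFDerivWithinAt_const a (0, z) _)).fderivWithin
      (hs _ hmem)
    rw [this]
    simp
  have h := hasDerivWithinAt_time hε (contDiffOn_dirDeriv hG (0, v)) hz
  rw [hv] at h
  rw [fderiv_slice (contDiffOn_dirDeriv hG (1, 0)) h0 hz, hv, hsymm.eq]
  exact h

end Family

/-- The derivative at `t = 0` of the tension field of a family with `φ_0 = id` and initial velocity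
`ξ`. -/
lemma hasDerivWithinAt_complexTension {ε : ℝ} (hε : 0 < ε) {φ : ℝ → ℂ → ℂ} {ξ : 𝔻 → ℂ}
    (hφ : ContDiffOn ℝ ∞ (fun p : ℝ × ℂ => φ p.1 p.2) (Ico 0 ε ×ˢ disc))
    (h0 : ∀ z : 𝔻, φ 0 z = z)
    (h1 : ∀ z : 𝔻, HasDerivWithinAt (fun t => φ t z) (ξ z) (Ici 0) 0) (z : 𝔻) :
    HasDerivWithinAt (fun t => complexTension (φ t) z)
      ((((1 - ‖(z : ℂ)‖ ^ 2) ^ 2 / 4 : ℝ) : ℂ) * (lap (zeroExt ξ) z +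
        ((4 / (1 - ‖(z : ℂ)‖ ^ 2) : ℝ) : ℂ) * conj (z : ℂ) * dbar (zeroExt ξ) z)) (Ici 0) 0 := by
  set G : ℝ × ℂ → ℂ := fun p => φ p.1 p.2 with hG
  set s : Set (ℝ × ℂ) := Ico 0 ε ×ˢ disc with hs
  have hz := coe_mem_disc z
  have hz0 := one_sub_normSq_pos z
  have m0 : (0 : ℝ) ∈ Ico 0 ε := ⟨le_rfl, hε⟩
  have hξ : ∀ w ∈ disc, fderivWithin ℝ G s (0, w) (1, 0) = zeroExt ξ w := by
    intro w hw
    rw [show zeroExt ξ w = ξ ⟨w, hw⟩ from zeroExt_coe ξ ⟨w, hw⟩]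
    exact (uniqueDiffWithinAt_Ici (0 : ℝ)).eq_deriv _ (hasDerivWithinAt_time hε hφ hw) (h1 ⟨w, hw⟩)
  have hD : ∀ v : ℂ, ∀ w ∈ disc, HasDerivWithinAt (fun t => fderivWithin ℝ G s (t, w) (0, v))
      (fderiv ℝ (zeroExt ξ) w v) (Ici 0) 0 := by
    intro v w hw
    have := hasDerivWithinAt_dirDeriv hε hφ hw v
    rwa [Filter.EventuallyEq.fderiv_eq (f := zeroExt ξ)] at this
    filter_upwards [isOpen_disc.mem_nhds hw] with w' hw' using hξ w' hw'
  have hDD : ∀ v : ℂ, HasDerivWithinAt (fun t => fderivWithin ℝ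
      (fun p => fderivWithin ℝ G s p (0, v)) s (t, z) (0, v))
      (fderiv ℝ (fun w => fderiv ℝ (zeroExt ξ) w v) z v) (Ici 0) 0 := by
    intro v
    have := hasDerivWithinAt_dirDeriv hε (contDiffOn_dirDeriv hφ (0, v)) hz v
    rwa [Filter.EventuallyEq.fderiv_eq (f := fun w => fderiv ℝ (zeroExt ξ) w v)] at this
    filter_upwards [isOpen_disc.mem_nhds hz] with w hw
    exact (uniqueDiffWithinAt_Ici (0 : ℝ)).eq_deriv _
      (hasDerivWithinAt_time hε (contDiffOn_dirDeriv hφ (0, v)) hw) (hD v w hw)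
  have hD0 : ∀ v : ℂ, fderivWithin ℝ G s (0, z) (0, v) = v := by
    intro v
    rw [← fderiv_slice hφ m0 hz, Filter.EventuallyEq.fderiv_eq (f := fun w => w)]
    · simp
    · filter_upwards [disc_mem_nhds z] with w hw using h0 ⟨w, hw⟩
  have hT : ∀ t ∈ Ico 0 ε, complexTension (φ t) z = (((1 - ‖(z : ℂ)‖ ^ 2) ^ 2 / 4 : ℝ) : ℂ) *
      (fderivWithin ℝ (fun p => fderivWithin ℝ G s p (0, 1)) s (t, z) (0, 1) +
        fderivWithin ℝ (fun p => fderivWithin ℝ G s p (0, I)) s (t, z) (0, I) +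
        ((2 / (1 - ‖φ t z‖ ^ 2) : ℝ) : ℂ) * conj (φ t z) *
        (fderivWithin ℝ G s (t, z) (0, 1) ^ 2 + fderivWithin ℝ G s (t, z) (0, I) ^ 2)) := by
    intro t ht
    have h2 : ∀ v, fderiv ℝ (fun w => fderiv ℝ (φ t) w v) z v =
        fderivWithin ℝ (fun p => fderivWithin ℝ G s p (0, v)) s (t, z) (0, v) := by
      intro v
      rw [← fderiv_slice (contDiffOn_dirDeriv hφ (0, v)) ht hz]
      congr 1
      refine Filter.EventuallyEq.fderiv_eq ?_
      filter_upwards [disc_mem_nhds z] with w hw using fderiv_slice hφ ht hw v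
    rw [complexTension, lap, h2, h2, ← fderiv_slice hφ ht hz, ← fderiv_slice hφ ht hz]
  have hC : HasDerivWithinAt (fun t => ((2 / (1 - ‖φ t z‖ ^ 2) : ℝ) : ℂ) * conj (φ t z))
      (derivWithin (fun t => ((2 / (1 - ‖φ t z‖ ^ 2) : ℝ) : ℂ) * conj (φ t z)) (Ici 0) 0)
      (Ici 0) 0 := by
    have hd := (h1 z).differentiableWithinAt
    have hn : DifferentiableWithinAt ℝ (fun t => 1 - ‖φ t z‖ ^ 2) (Ici 0) 0 :=
      (hd.norm_sq ℝ).const_sub 1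
    have hq : DifferentiableWithinAt ℝ (fun t => 2 / (1 - ‖φ t z‖ ^ 2)) (Ici 0) 0 :=
      (differentiableWithinAt_const 2).div hn (by rw [h0]; exact hz0.ne')
    refine DifferentiableWithinAt.hasDerivWithinAt (DifferentiableWithinAt.mul ?_ ?_)
    · exact (ofRealCLM.differentiableAt).comp_differentiableWithinAt 0 hq
    · exact (conjCLE.differentiableAt).comp_differentiableWithinAt 0 hd
  have hmain := (((hDD 1).add (hDD I)).add (hC.mul (((hD 1 z hz).pow 2).add
    ((hD I z hz).pow 2)))).const_mul (((1 - ‖(z : ℂ)‖ ^ 2) ^ 2 / 4 : ℝ) : ℂ)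
  refine (hmain.congr_of_eventuallyEq ?_ ?_).congr_deriv ?_
  · filter_upwards [Ico_mem_nhdsGE hε] with t ht using hT t ht
  · exact hT 0 m0
  · simp only [hD0, h0, lap, dbar, Pi.add_apply, Pi.pow_apply, one_pow, I_sq, pow_one,
      Nat.add_one_sub_one]
    push_cast
    ring

/-! ### Harmonic vector fields and holomorphic quadratic differentials -/

/-- Up to the factor `(1-|z|^2)^2 / 4`, the tension field linearised at the identity. -/
def jacobi (ξ : 𝔻 → ℂ) (z : 𝔻) : ℂ :=
  lap (zeroExt ξ) z + ((4 / (1 - ‖(z : ℂ)‖ ^ 2) : ℝ) : ℂ) * conj (z : ℂ) * dbar (zeroExt ξ) z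

lemma coord_ext {u v : ℂ} (h : ∀ α, coord α u = coord α v) : u = v :=
  Complex.ext (h 0) (h 1)

lemma hasDerivWithinAt_coord {f : ℝ → ℂ} {f' : ℂ} {s : Set ℝ} {t : ℝ} (α : Fin 2)
    (h : HasDerivWithinAt f f' s t) : HasDerivWithinAt (fun t => coord α (f t)) (coord α f') s t := by
  obtain ⟨L, hL⟩ := exists_coord_eq_clm α
  simp only [hL]
  exact L.hasFDerivAt.comp_hasDerivWithinAt t h

lemma hasDerivWithinAt_tension {ε : ℝ} (hε : 0 < ε) {φ : ℝ → ℂ → ℂ} {ξ : 𝔻 → ℂ}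
    (hφ : ContDiffOn ℝ ∞ (fun p : ℝ × ℂ => φ p.1 p.2) (Ico 0 ε ×ˢ disc))
    (hm : ∀ t ∈ Ico 0 ε, MapsTo (φ t) disc disc)
    (h0 : ∀ z : 𝔻, φ 0 z = z)
    (h1 : ∀ z : 𝔻, HasDerivWithinAt (fun t => φ t z) (ξ z) (Ici 0) 0) (z : 𝔻) (α : Fin 2) :
    HasDerivWithinAt (fun t => tension (φ t) α z)
      (coord α ((((1 - ‖(z : ℂ)‖ ^ 2) ^ 2 / 4 : ℝ) : ℂ) * jacobi ξ z)) (Ici 0) 0 := by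
  have hT : ∀ t ∈ Ico 0 ε, tension (φ t) α z = coord α (complexTension (φ t) z) := by
    intro t ht
    refine tension_eq ?_ (coe_mem_disc z) (hm t ht (coe_mem_disc z)) α
    exact hφ.comp (contDiff_prodMk_right t).contDiffOn fun w hw => ⟨ht, hw⟩
  refine (hasDerivWithinAt_coord α
    (hasDerivWithinAt_complexTension hε hφ h0 h1 z)).congr_of_eventuallyEq ?_
    (hT 0 ⟨le_rfl, hε⟩)
  filter_upwards [Ico_mem_nhdsGE hε] with t ht using hT t ht

lemma IsHarmonic.jacobi_eq_zero {ξ : 𝔻 → ℂ} (h : IsHarmonic ξ) (z : 𝔻) : jacobi ξ z = 0 := by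
  obtain ⟨_, ε, φ, hε, hφ, hm, h0, h1, h2⟩ := h
  have h3 : (((1 - ‖(z : ℂ)‖ ^ 2) ^ 2 / 4 : ℝ) : ℂ) * jacobi ξ z = 0 := by
    refine coord_ext fun α => ?_
    have := (uniqueDiffWithinAt_Ici (0 : ℝ)).eq_deriv _
      (hasDerivWithinAt_tension hε hφ hm h0 h1 z α) (h2 z α)
    rw [this]
    fin_cases α <;> simp [coord]
  refine (mul_eq_zero.1 h3).resolve_left (ofReal_ne_zero.2 ?_)
  have := one_sub_normSq_pos z
  positivity

lemma norm_moebius_translation_lt_one {u z : ℂ} (hu : ‖u‖ < 1) (hz : ‖z‖ < 1) :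
    1 + conj z * u ≠ 0 ∧ ‖(u + z) / (1 + conj z * u)‖ < 1 := by
  have hd : 1 + conj z * u ≠ 0 := by
    intro h
    have h1 : ‖conj z * u‖ = 1 := by
      rw [eq_neg_of_add_eq_zero_right h, norm_neg, norm_one]
    rw [norm_mul, norm_conj] at h1
    nlinarith [norm_nonneg u, norm_nonneg z]
  refine ⟨hd, ?_⟩
  rw [norm_div, div_lt_one (norm_pos_iff.2 hd)]
  refine lt_of_pow_lt_pow_left₀ 2 (norm_nonneg _) ?_
  have hu2 : normSq u < 1 := by rw [normSq_eq_norm_sq]; nlinarith [norm_nonneg u]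
  have hz2 : normSq z < 1 := by rw [normSq_eq_norm_sq]; nlinarith [norm_nonneg z]
  rw [← normSq_eq_norm_sq, ← normSq_eq_norm_sq]
  have h2 := mul_pos (sub_pos.2 hu2) (sub_pos.2 hz2)
  simp only [normSq_apply, add_re, add_im, mul_re, mul_im, conj_re, conj_im, one_re, one_im] at h2 ⊢
  nlinarith

/-- A family of maps of the disc with a prescribed initial velocity: `z` is moved by a Möbius
translation, through a hyperbolic displacement that stays bounded. -/
def flowFamily (ξ : 𝔻 → ℂ) (t : ℝ) (z : ℂ) : ℂ :=
  (t * zeroExt ξ z / ((1 - ‖z‖ ^ 2 : ℝ) : ℂ) /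
      ((1 + ‖t * zeroExt ξ z / ((1 - ‖z‖ ^ 2 : ℝ) : ℂ)‖ ^ 2 : ℝ) : ℂ) + z) /
    (1 + conj z * (t * zeroExt ξ z / ((1 - ‖z‖ ^ 2 : ℝ) : ℂ) /
      ((1 + ‖t * zeroExt ξ z / ((1 - ‖z‖ ^ 2 : ℝ) : ℂ)‖ ^ 2 : ℝ) : ℂ)))

lemma norm_div_one_add_normSq_lt_one (V : ℂ) : ‖V / ((1 + ‖V‖ ^ 2 : ℝ) : ℂ)‖ < 1 := by
  have h : 0 < 1 + ‖V‖ ^ 2 := by positivity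
  rw [norm_div, norm_real, Real.norm_of_nonneg h.le, div_lt_one h]
  nlinarith [sq_nonneg (‖V‖ - 1)]

lemma contDiffOn_flowFamily {ξ : 𝔻 → ℂ} (hξ : IsSmooth ξ) :
    ContDiffOn ℝ ∞ (fun p : ℝ × ℂ => flowFamily ξ p.1 p.2) (univ ×ˢ disc) := by
  have hsnd : ContDiffOn ℝ ∞ (fun p : ℝ × ℂ => p.2) (univ ×ˢ disc) := contDiff_snd.contDiffOn
  have hfst : ContDiffOn ℝ ∞ (fun p : ℝ × ℂ => (p.1 : ℂ)) (univ ×ˢ disc) :=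
    (ofRealCLM.contDiff.comp contDiff_fst).contDiffOn
  have h1 : ContDiffOn ℝ ∞ (fun p : ℝ × ℂ => zeroExt ξ p.2) (univ ×ˢ disc) :=
    ContDiffOn.comp hξ hsnd fun p hp => hp.2
  have h2 : ContDiffOn ℝ ∞ (fun p : ℝ × ℂ => ((1 - ‖p.2‖ ^ 2 : ℝ) : ℂ)) (univ ×ˢ disc) :=
    ofRealCLM.contDiff.comp_contDiffOn (contDiffOn_const.sub (hsnd.norm_sq ℝ))
  have h2' : ∀ p ∈ (univ ×ˢ disc : Set (ℝ × ℂ)), ((1 - ‖p.2‖ ^ 2 : ℝ) : ℂ) ≠ 0 := fun p hp =>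
    ofReal_ne_zero.2 (one_sub_normSq_pos ⟨p.2, hp.2⟩).ne'
  have h3 : ContDiffOn ℝ ∞ (fun p : ℝ × ℂ => p.1 * zeroExt ξ p.2 / ((1 - ‖p.2‖ ^ 2 : ℝ) : ℂ))
      (univ ×ˢ disc) := by
    simp only [div_eq_mul_inv]
    exact (hfst.mul h1).mul (h2.inv h2')
  have h4 : ContDiffOn ℝ ∞ (fun p : ℝ × ℂ => p.1 * zeroExt ξ p.2 / ((1 - ‖p.2‖ ^ 2 : ℝ) : ℂ) /
      ((1 + ‖p.1 * zeroExt ξ p.2 / ((1 - ‖p.2‖ ^ 2 : ℝ) : ℂ)‖ ^ 2 : ℝ) : ℂ)) (univ ×ˢ disc) := by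
    simp only [div_eq_mul_inv _ ((1 + _ : ℝ) : ℂ)]
    refine h3.mul ((ofRealCLM.contDiff.comp_contDiffOn
      (contDiffOn_const.add (h3.norm_sq ℝ))).inv fun p hp => ?_)
    refine ofReal_ne_zero.2 ?_
    positivity
  have h5 : ContDiffOn ℝ ∞ (fun p : ℝ × ℂ => conj p.2) (univ ×ˢ disc) :=
    conjCLE.contDiff.comp_contDiffOn hsnd
  refine ((h4.add hsnd).mul ((contDiffOn_const.add (h5.mul h4)).inv fun p hp => ?_)).congr
    fun p hp => div_eq_mul_inv _ _
  exact (norm_moebius_translation_lt_one (norm_div_one_add_normSq_lt_one _) (mem_disc.1 hp.2)).1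

lemma hasDerivAt_flowFamily (ξ : 𝔻 → ℂ) (z : 𝔻) :
    HasDerivAt (fun t => flowFamily ξ t z) (ξ z) 0 := by
  have hz := one_sub_normSq_pos z
  have hz' : ((1 - ‖(z : ℂ)‖ ^ 2 : ℝ) : ℂ) ≠ 0 := ofReal_ne_zero.2 hz.ne'
  set v : ℂ := zeroExt ξ z / ((1 - ‖(z : ℂ)‖ ^ 2 : ℝ) : ℂ) with hv
  have e : ∀ t : ℝ, flowFamily ξ t z = (t * v / ((1 + ‖t * v‖ ^ 2 : ℝ) : ℂ) + z) /
      (1 + conj (z : ℂ) * (t * v / ((1 + ‖t * v‖ ^ 2 : ℝ) : ℂ))) := by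
    intro t
    simp only [flowFamily, hv, mul_div_assoc]
  simp only [e]
  have h1 : HasDerivAt (fun t : ℝ => (t : ℂ) * v) v 0 := by
    simpa using (ofRealCLM.hasDerivAt (x := (0 : ℝ))).mul_const v
  have h2 : HasDerivAt (fun t : ℝ => 1 + ‖(t : ℂ) * v‖ ^ 2) 0 0 := by
    simpa using (h1.norm_sq).const_add 1
  have h3 : HasDerivAt (fun t : ℝ => ((1 + ‖(t : ℂ) * v‖ ^ 2 : ℝ) : ℂ)) 0 0 := by
    simpa using h2.ofReal_comp
  have h4 : HasDerivAt (fun t : ℝ => t * v / ((1 + ‖t * v‖ ^ 2 : ℝ) : ℂ)) v 0 := by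
    have := h1.fun_div h3 (by simp)
    simpa using this
  have h5 := (h4.add_const (z : ℂ)).fun_div ((h4.const_mul (conj (z : ℂ))).const_add 1) (by simp)
  refine h5.congr_deriv ?_
  simp only [ofReal_zero, zero_mul, norm_zero, zero_div, mul_zero, add_zero, zero_add, mul_one,
    one_pow, div_one]
  rw [show (z : ℂ) * (conj (z : ℂ) * v) = ((‖(z : ℂ)‖ ^ 2 : ℝ) : ℂ) * v by
    rw [← mul_assoc, mul_conj, normSq_eq_norm_sq], hv]
  rw [← zeroExt_coe ξ z]
  field_simp
  push_cast
  ring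

lemma isHarmonic_of_jacobi {ξ : 𝔻 → ℂ} (hξ : IsSmooth ξ) (h : ∀ z, jacobi ξ z = 0) :
    IsHarmonic ξ := by
  have hs : ContDiffOn ℝ ∞ (fun p : ℝ × ℂ => flowFamily ξ p.1 p.2) (Ico 0 1 ×ˢ disc) :=
    (contDiffOn_flowFamily hξ).mono (prod_mono (subset_univ _) le_rfl)
  have hm : ∀ t ∈ Ico (0 : ℝ) 1, MapsTo (flowFamily ξ t) disc disc := fun t _ z hz => mem_disc.2
    (norm_moebius_translation_lt_one (norm_div_one_add_normSq_lt_one _) (mem_disc.1 hz)).2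
  have h0 : ∀ z : 𝔻, flowFamily ξ 0 z = z := fun z => by simp [flowFamily]
  have h1 : ∀ z : 𝔻, HasDerivWithinAt (fun t => flowFamily ξ t z) (ξ z) (Ici 0) 0 :=
    fun z => (hasDerivAt_flowFamily ξ z).hasDerivWithinAt
  refine ⟨hξ, 1, flowFamily ξ, one_pos, hs, hm, h0, h1, fun z α => ?_⟩
  have := hasDerivWithinAt_tension one_pos hs hm h0 h1 z α
  rw [h z, mul_zero] at this
  refine this.congr_deriv ?_
  fin_cases α <;> simp [coord]

lemma dbar_conformal_factor (z : 𝔻) :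
    DifferentiableAt ℝ (fun w : ℂ => 4 / ((1 - ‖w‖ ^ 2 : ℝ) : ℂ) ^ 2) z ∧
    dbar (fun w : ℂ => 4 / ((1 - ‖w‖ ^ 2 : ℝ) : ℂ) ^ 2) z =
      16 * z / ((1 - ‖(z : ℂ)‖ ^ 2 : ℝ) : ℂ) ^ 3 := by
  have hz := (one_sub_normSq_pos z).ne'
  have h1 : HasFDerivAt (fun w : ℂ => 1 - ‖w‖ ^ 2) (-(2 • (innerSL ℝ (z : ℂ)))) z :=
    (hasFDerivAt_normSq z).const_sub 1
  have h2 : HasDerivAt (fun x : ℝ => 4 / x ^ 2) (-8 / (1 - ‖(z : ℂ)‖ ^ 2) ^ 3)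
      (1 - ‖(z : ℂ)‖ ^ 2) := by
    have h4 : HasDerivAt (fun x : ℝ => x ^ 2) _ (1 - ‖(z : ℂ)‖ ^ 2) := hasDerivAt_pow 2 _
    refine ((h4.fun_inv (pow_ne_zero 2 hz)).const_mul 4).congr_deriv ?_
    field_simp
    ring
  have h3 := ofRealCLM.hasFDerivAt.comp (z : ℂ) (h2.comp_hasFDerivAt (z : ℂ) h1)
  have e : (fun w : ℂ => 4 / ((1 - ‖w‖ ^ 2 : ℝ) : ℂ) ^ 2) =
      ofRealCLM ∘ (fun x : ℝ => 4 / x ^ 2) ∘ fun w : ℂ => 1 - ‖w‖ ^ 2 := by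
    ext w; simp
  rw [e]
  refine ⟨h3.differentiableAt, ?_⟩
  rw [dbar, h3.fderiv]
  simp only [ContinuousLinearMap.comp_apply, _root_.smul_apply, _root_.neg_apply,
    innerSL_apply_apply, smul_eq_mul, ofRealCLM_apply, nsmul_eq_mul]
  rw [show inner ℝ (z : ℂ) 1 = (z : ℂ).re from inner_frame z 0,
    show inner ℝ (z : ℂ) I = (z : ℂ).im from inner_frame z 1]
  push_cast
  linear_combination (16 / (1 - (‖(z : ℂ)‖ : ℂ) ^ 2) ^ 3) * re_add_im (z : ℂ)

lemma differentiableAt_dirDeriv {F : ℂ → ℂ} {z : ℂ} (hF : ContDiffAt ℝ ∞ F z) (v : ℂ) :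
    DifferentiableAt ℝ (fun w => fderiv ℝ F w v) z := by
  have h1 : ContDiffAt ℝ 1 (fderiv ℝ F) z :=
    hF.fderiv_right (m := 1) (by norm_num; exact ENat.LEInfty.out)
  exact (h1.differentiableAt (by simp)).clm_apply (differentiableAt_const v)

lemma dbar_conj_dbar {F : ℂ → ℂ} {z : ℂ} (hF : ContDiffAt ℝ ∞ F z) :
    DifferentiableAt ℝ (fun w => conj (dbar F w)) z ∧
      dbar (fun w => conj (dbar F w)) z = conj (lap F z) := by
  have hd := differentiableAt_dirDeriv hF
  have h1 : HasFDerivAt (fun w => conj (dbar F w)) _ z :=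
    conjCLE.toContinuousLinearMap.hasFDerivAt.comp z
      ((hd 1).hasFDerivAt.add ((hd I).hasFDerivAt.const_mul I))
  refine ⟨h1.differentiableAt, ?_⟩
  have hsymm : IsSymmSndFDerivAt ℝ F z := hF.isSymmSndFDerivAt
    (by rw [minSmoothness_of_isRCLikeNormedField]; exact ENat.LEInfty.out)
  have h2 : DifferentiableAt ℝ (fderiv ℝ F) z :=
    (hF.fderiv_right (m := 1) (by norm_num; exact ENat.LEInfty.out)).differentiableAt (by simp)
  have hv : ∀ a b : ℂ, fderiv ℝ (fun w => fderiv ℝ F w a) z b = fderiv ℝ (fderiv ℝ F) z b a := by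
    intro a b
    rw [(h2.hasFDerivAt.clm_apply (hasFDerivAt_const a z)).fderiv]
    simp
  have h3 : fderiv ℝ (fun w => fderiv ℝ F w 1) z I = fderiv ℝ (fun w => fderiv ℝ F w I) z 1 := by
    rw [hv, hv, hsymm.eq]
  rw [dbar, h1.fderiv, lap]
  simp [h3]
  ring_nf
  simp

/-- The failure of `(L_ξ g)^{(2,0)}` to be holomorphic is the linearised tension field. -/
lemma dbar_quadDiff {ξ : 𝔻 → ℂ} (hξ : IsSmooth ξ) (z : 𝔻) :
    DifferentiableAt ℝ (zeroExt (quadDiff ξ)) z ∧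
      dbar (zeroExt (quadDiff ξ)) z =
        4 / ((1 - ‖(z : ℂ)‖ ^ 2 : ℝ) : ℂ) ^ 2 * conj (jacobi ξ z) := by
  obtain ⟨h1, h2⟩ := dbar_conformal_factor z
  obtain ⟨h3, h4⟩ := dbar_conj_dbar (hξ.contDiffAt z)
  have e := zeroExt_eventuallyEq (F := (fun w : ℂ => 4 / ((1 - ‖w‖ ^ 2 : ℝ) : ℂ) ^ 2) *
    fun w => conj (dbar (zeroExt ξ) w)) (quadDiff_eq ξ) z
  refine ⟨(h1.mul h3).congr_of_eventuallyEq e, ?_⟩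
  rw [dbar_congr e, dbar_mul h1 h3, h2, h4, jacobi]
  have hz : ((1 - ‖(z : ℂ)‖ ^ 2 : ℝ) : ℂ) ≠ 0 := ofReal_ne_zero.2 (one_sub_normSq_pos z).ne'
  simp only [map_add, map_mul, conj_ofReal, conj_conj]
  push_cast at hz ⊢
  field_simp
  ring

/-- A smooth vector field is harmonic exactly when `(L_ξ g)^{(2,0)}` is holomorphic. -/
theorem isHarmonic_iff {ξ : 𝔻 → ℂ} :
    IsHarmonic ξ ↔ IsSmooth ξ ∧ DifferentiableOn ℂ (zeroExt (quadDiff ξ)) disc := by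
  constructor
  · intro h
    refine ⟨h.1, fun z hz => ?_⟩
    obtain ⟨h1, h2⟩ := dbar_quadDiff h.1 (UnitDisc.mk z (mem_disc.1 hz))
    rw [h.jacobi_eq_zero, map_zero, mul_zero] at h2
    exact (differentiableAt_complex_of_dbar h1 h2).differentiableWithinAt
  · rintro ⟨h, hd⟩
    refine isHarmonic_of_jacobi h fun z => ?_
    have h2 := (dbar_quadDiff h z).2
    rw [dbar_eq_zero_of_differentiableAt (hd.differentiableAt (disc_mem_nhds z))] at h2
    have hz : ((1 - ‖(z : ℂ)‖ ^ 2 : ℝ) : ℂ) ≠ 0 := ofReal_ne_zero.2 (one_sub_normSq_pos z).ne'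
    rcases mul_eq_zero.1 h2.symm with h | h
    · exact absurd h (div_ne_zero (by norm_num) (pow_ne_zero 2 hz))
    · simpa using h

/-! ### The general harmonic vector field -/

/-- The vector field `A + conj (N² p'' + 2 conj z N p' + 2 (conj z)² p)` with `N = 1 - |z|²`; for
holomorphic `A` and `p` it is harmonic, with `(L_X g)^{(2,0)} = 8 p''' dz²`. -/
def harmForm (A p : ℂ → ℂ) (z : ℂ) : ℂ :=
  A z + conj (((1 - ‖z‖ ^ 2 : ℝ) : ℂ) ^ 2 * deriv (deriv p) z +
    2 * conj z * ((1 - ‖z‖ ^ 2 : ℝ) : ℂ) * deriv p z + 2 * conj z ^ 2 * p z)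

lemma contDiffOn_of_holomorphic {f : ℂ → ℂ} (hf : DifferentiableOn ℂ f disc) :
    ContDiffOn ℝ ∞ f disc :=
  (hf.contDiffOn isOpen_disc).restrict_scalars ℝ

lemma contDiff_one_sub_normSq : ContDiff ℝ ∞ fun z : ℂ => ((1 - ‖z‖ ^ 2 : ℝ) : ℂ) :=
  ofRealCLM.contDiff.comp (contDiff_const.sub (contDiff_id.norm_sq ℝ))

lemma contDiffOn_harmForm {A p : ℂ → ℂ} (hA : DifferentiableOn ℂ A disc)
    (hp : DifferentiableOn ℂ p disc) : ContDiffOn ℝ ∞ (harmForm A p) disc := by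
  have h0 := contDiffOn_of_holomorphic hp
  have h1 := contDiffOn_of_holomorphic (hp.deriv isOpen_disc)
  have h2 := contDiffOn_of_holomorphic ((hp.deriv isOpen_disc).deriv isOpen_disc)
  have hN := contDiff_one_sub_normSq.contDiffOn (s := disc)
  have hc : ContDiffOn ℝ ∞ (fun z : ℂ => conj z) disc := conjCLE.contDiff.contDiffOn
  refine (contDiffOn_of_holomorphic hA).add (conjCLE.contDiff.comp_contDiffOn ?_)
  exact (((hN.pow 2).mul h2).add (((contDiffOn_const.mul hc).mul hN).mul h1)).add
    ((contDiffOn_const.mul (hc.pow 2)).mul h0)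

lemma dbar_one_sub_normSq (z : ℂ) : dbar (fun w : ℂ => ((1 - ‖w‖ ^ 2 : ℝ) : ℂ)) z = -2 * z := by
  have h := ofRealCLM.hasFDerivAt.comp z ((hasFDerivAt_normSq z).const_sub 1)
  rw [dbar, show (fun w : ℂ => ((1 - ‖w‖ ^ 2 : ℝ) : ℂ)) = ofRealCLM ∘ fun w : ℂ => 1 - ‖w‖ ^ 2 from
    rfl, h.fderiv]
  simp only [ContinuousLinearMap.comp_apply, _root_.smul_apply, _root_.neg_apply,
    innerSL_apply_apply, ofRealCLM_apply, nsmul_eq_mul]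
  rw [show inner ℝ z 1 = z.re from inner_frame z 0, show inner ℝ z I = z.im from inner_frame z 1]
  push_cast
  linear_combination (-2) * re_add_im z

lemma dbar_harmForm {A p : ℂ → ℂ} (hA : DifferentiableOn ℂ A disc)
    (hp : DifferentiableOn ℂ p disc) {z : ℂ} (hz : z ∈ disc) :
    dbar (harmForm A p) z =
      2 * conj (((1 - ‖z‖ ^ 2 : ℝ) : ℂ) ^ 2 * deriv (deriv (deriv p)) z) := by
  have hn := isOpen_disc.mem_nhds hz
  have hp1 := hp.deriv isOpen_disc
  have hp2 := hp1.deriv isOpen_disc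
  have d0 := dbar_conj (hp.differentiableAt hn).hasDerivAt
  have d1 := dbar_conj (hp1.differentiableAt hn).hasDerivAt
  have d2 := dbar_conj (hp2.differentiableAt hn).hasDerivAt
  have e0 : ∀ {f : ℂ → ℂ}, DifferentiableOn ℂ f disc → DifferentiableAt ℝ (fun w => conj (f w)) z :=
    fun hf => conjCLE.differentiableAt.comp z ((hf.differentiableAt hn).restrictScalars ℝ)
  set N : ℂ → ℂ := fun w => ((1 - ‖w‖ ^ 2 : ℝ) : ℂ) with hN
  have eN : DifferentiableAt ℝ N z := (contDiff_one_sub_normSq.differentiable (by simp)) z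
  have dN : dbar N z = -2 * z := dbar_one_sub_normSq z
  have eA := (hA.differentiableAt hn)
  have ei : DifferentiableAt ℂ (fun w : ℂ => w) z := differentiableAt_id
  have e2 : DifferentiableAt ℂ (fun _ : ℂ => (2 : ℂ)) z := differentiableAt_const _
  have E : harmForm A p = A + (N * N * (fun w => conj (deriv (deriv p) w)) +
      (fun _ : ℂ => (2 : ℂ)) * (fun w : ℂ => w) * N * (fun w => conj (deriv p w)) +
      (fun _ : ℂ => (2 : ℂ)) * ((fun w : ℂ => w) * (fun w : ℂ => w)) * (fun w => conj (p w))) := by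
    ext w
    simp only [harmForm, hN, Pi.add_apply, Pi.mul_apply, map_add, map_mul, map_pow, conj_ofReal,
      conj_conj, map_ofNat]
    ring
  have fi := ei.restrictScalars ℝ
  have f2 := e2.restrictScalars ℝ
  have c0 := e0 hp
  have c1 := e0 hp1
  have c2 := e0 hp2
  have m1 := eN.mul eN
  have m2 := m1.mul c2
  have m3 := f2.mul fi
  have m4 := m3.mul eN
  have m5 := m4.mul c1
  have m6 := fi.mul fi
  have m7 := f2.mul m6
  have m8 := m7.mul c0
  rw [E, dbar_add (eA.restrictScalars ℝ) ((m2.add m5).add m8), dbar_add (m2.add m5) m8,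
    dbar_add m2 m5, dbar_mul m1 c2, dbar_mul m4 c1, dbar_mul m7 c0, dbar_mul eN eN, dbar_mul m3 eN,
    dbar_mul f2 m6, dbar_mul f2 fi, dbar_mul fi fi, d0, d1, d2, dN,
    dbar_eq_zero_of_differentiableAt eA, dbar_eq_zero_of_differentiableAt ei,
    dbar_eq_zero_of_differentiableAt e2]
  simp only [Pi.mul_apply, hN, map_mul, map_pow, conj_ofReal]
  ring

lemma quadDiff_harmForm {A p : ℂ → ℂ} (hA : DifferentiableOn ℂ A disc)
    (hp : DifferentiableOn ℂ p disc) {X : 𝔻 → ℂ} (hX : ∀ z : 𝔻, X z = harmForm A p z) (z : 𝔻) :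
    quadDiff X z = 8 * deriv (deriv (deriv p)) z := by
  have hz : ((1 - ‖(z : ℂ)‖ ^ 2 : ℝ) : ℂ) ≠ 0 := ofReal_ne_zero.2 (one_sub_normSq_pos z).ne'
  rw [quadDiff_eq, dbar_congr (zeroExt_eventuallyEq hX z), dbar_harmForm hA hp (coe_mem_disc z)]
  simp only [map_mul, conj_conj, map_ofNat]
  field_simp
  ring

lemma isHarmonic_of_harmForm {A p : ℂ → ℂ} (hA : DifferentiableOn ℂ A disc)
    (hp : DifferentiableOn ℂ p disc) {X : 𝔻 → ℂ} (hX : ∀ z : 𝔻, X z = harmForm A p z) :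
    IsHarmonic X := by
  refine isHarmonic_iff.2 ⟨isSmooth_of_eq hX (contDiffOn_harmForm hA hp), ?_⟩
  have h3 := ((hp.deriv isOpen_disc).deriv isOpen_disc).deriv isOpen_disc
  refine (h3.const_mul 8).congr fun z hz => ?_
  exact eqOn_zeroExt (F := fun z => 8 * deriv (deriv (deriv p)) z) (quadDiff_harmForm hA hp hX) hz

/-- Every harmonic vector field has the form `harmForm A p`, where `p` may be chosen to vanish to
third order at the origin. -/
lemma IsHarmonic.exists_harmForm {X : 𝔻 → ℂ} (hX : IsHarmonic X) :
    ∃ A p : ℂ → ℂ, DifferentiableOn ℂ A disc ∧ DifferentiableOn ℂ p disc ∧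
      (∀ n : ℤ, n ≤ 2 → taylorCoeffZ p n = 0) ∧ ∀ z : 𝔻, X z = harmForm A p z := by
  obtain ⟨hs, hq⟩ := isHarmonic_iff.1 hX
  have hprim : ∀ f : ℂ → ℂ, DifferentiableOn ℂ f disc →
      ∃ g : ℂ → ℂ, g 0 = 0 ∧ ∀ z ∈ disc, HasDerivAt g (f z) z := by
    intro f hf
    obtain ⟨g, hg⟩ := hf.isExactOn_ball
    exact ⟨fun z => g z - g 0, sub_self _, fun z hz => (hg z hz).sub_const _⟩
  have hdiff : ∀ {f g : ℂ → ℂ}, (∀ z ∈ disc, HasDerivAt g (f z) z) → DifferentiableOn ℂ g disc :=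
    fun h z hz => (h z hz).differentiableAt.differentiableWithinAt
  obtain ⟨p2, h20, h2⟩ := hprim _ (hq.const_mul (8⁻¹ : ℂ))
  obtain ⟨p1, h10, h1⟩ := hprim _ (hdiff h2)
  obtain ⟨p, h00, h0⟩ := hprim _ (hdiff h1)
  have hp := hdiff h0
  have k1 : ∀ z ∈ disc, deriv p z = p1 z := fun z hz => (h0 z hz).deriv
  have k2 : ∀ z ∈ disc, deriv (deriv p) z = p2 z := by
    intro z hz
    rw [(show deriv p =ᶠ[𝓝 z] p1 by
      filter_upwards [isOpen_disc.mem_nhds hz] with w hw using k1 w hw).deriv_eq, (h1 z hz).deriv]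
  have k3 : ∀ z ∈ disc, deriv (deriv (deriv p)) z = 8⁻¹ * zeroExt (quadDiff X) z := by
    intro z hz
    rw [(show deriv (deriv p) =ᶠ[𝓝 z] p2 by
      filter_upwards [isOpen_disc.mem_nhds hz] with w hw using k2 w hw).deriv_eq, (h2 z hz).deriv]
  have m0 : (0 : ℂ) ∈ disc := by simp
  have ht : ∀ n : ℤ, n ≤ 2 → taylorCoeffZ p n = 0 := by
    intro n hn
    rcases lt_or_ge n 0 with h | h
    · exact taylorCoeffZ_of_neg p h
    · lift n to ℕ using h
      rw [taylorCoeffZ_natCast, taylorCoeff]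
      have hn' : n ≤ 2 := by exact_mod_cast hn
      interval_cases n
      · simp [h00]
      · simp [k1 0 m0, h10]
      · rw [iteratedDeriv_succ', iteratedDeriv_succ', iteratedDeriv_zero, k2 0 m0, h20, mul_zero]
  set W : 𝔻 → ℂ := fun z => harmForm 0 p z with hW
  have hWs : IsSmooth W :=
    isSmooth_of_eq (fun _ => rfl) (contDiffOn_harmForm (differentiableOn_const 0) hp)
  have hA : DifferentiableOn ℂ (zeroExt (X - W)) disc := by
    rw [← quadDiff_eq_zero_iff (hs.sub hWs), quadDiff_sub hs hWs]
    ext z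
    rw [Pi.sub_apply, quadDiff_harmForm (X := W) (A := 0) (differentiableOn_const 0) hp
      (fun _ => rfl), k3 z (coe_mem_disc z), zeroExt_coe]
    simp
  refine ⟨zeroExt (X - W), p, hA, hp, ht, fun z => ?_⟩
  rw [harmForm, zeroExt_coe, Pi.sub_apply, hW]
  simp [harmForm]

/-- The factor by which the Fourier coefficient of index `-m` of `harmForm A p` varies with the
radius. -/
def radialFactor (m : ℤ) (r : ℝ) : ℂ :=
  (1 - r ^ 2) ^ 2 * (m + 1) * (m + 2) + 2 * (1 - r ^ 2) * r ^ 2 * (m + 2) + 2 * r ^ 4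

lemma fourierCoeff_harmForm {A p : ℂ → ℂ} (hA : DifferentiableOn ℂ A disc)
    (hp : DifferentiableOn ℂ p disc) {r : ℝ} (h0 : 0 < r) (h1 : r < 1) (n : ℤ) :
    fourierCoeff (fun θ : S1 => harmForm A p (r * pt θ)) n =
      taylorCoeffZ A n * r ^ n +
        conj (taylorCoeffZ p (2 - n) * r ^ (-n) * radialFactor (-n) r) := by
  have hr : (r : ℂ) ≠ 0 := ofReal_ne_zero.2 h0.ne'
  have hp1 := hp.deriv isOpen_disc
  have hp2 := hp1.deriv isOpen_disc
  have hcont : ∀ {f : ℂ → ℂ}, DifferentiableOn ℂ f disc → Continuous fun θ : S1 => f (r * pt θ) :=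
    fun hf => hf.continuousOn.comp_continuous (continuous_const.mul continuous_pt)
      (mul_pt_mem_disc h0.le h1)
  have E : (fun θ : S1 => harmForm A p (r * pt θ)) = (fun θ : S1 => A (r * pt θ)) + fun θ : S1 =>
      conj (((fun θ : S1 => (1 - r ^ 2 : ℂ) ^ 2 * deriv (deriv p) (r * pt θ)) +
        ((fun θ : S1 => (2 * r * (1 - r ^ 2) : ℂ) * (pt θ ^ (-1 : ℤ) * deriv p (r * pt θ))) +
        fun θ : S1 => (2 * r ^ 2 : ℂ) * (pt θ ^ (-2 : ℤ) * p (r * pt θ)))) θ) := by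
    ext θ
    have hn : ‖(r * pt θ : ℂ)‖ = r := by
      rw [norm_mul, norm_pt, mul_one, norm_real, Real.norm_of_nonneg h0.le]
    simp only [harmForm, hn, Pi.add_apply, map_mul conj (r : ℂ), conj_ofReal, ← inv_pt]
    rw [show (-2 : ℤ) = -((2 : ℕ) : ℤ) by rfl, zpow_neg_one, zpow_neg, zpow_natCast]
    push_cast
    congr 2
    ring
  have c1 : Continuous fun θ : S1 => (1 - r ^ 2 : ℂ) ^ 2 * deriv (deriv p) (r * pt θ) :=
    continuous_const.mul (hcont hp2)
  have c2 : Continuous fun θ : S1 =>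
      (2 * r * (1 - r ^ 2) : ℂ) * (pt θ ^ (-1 : ℤ) * deriv p (r * pt θ)) :=
    continuous_const.mul ((continuous_pt_zpow _).mul (hcont hp1))
  have c3 : Continuous fun θ : S1 => (2 * r ^ 2 : ℂ) * (pt θ ^ (-2 : ℤ) * p (r * pt θ)) :=
    continuous_const.mul ((continuous_pt_zpow _).mul (hcont hp))
  have cc : Continuous fun θ : S1 =>
      conj (((fun θ : S1 => (1 - r ^ 2 : ℂ) ^ 2 * deriv (deriv p) (r * pt θ)) +
        ((fun θ : S1 => (2 * r * (1 - r ^ 2) : ℂ) * (pt θ ^ (-1 : ℤ) * deriv p (r * pt θ))) +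
        fun θ : S1 => (2 * r ^ 2 : ℂ) * (pt θ ^ (-2 : ℤ) * p (r * pt θ)))) θ) :=
    continuous_conj.comp (c1.add (c2.add c3))
  rw [E, fourierCoeff.add (integrable_of_continuous (hcont hA)) (integrable_of_continuous cc),
    Pi.add_apply,
    fourierCoeff_of_holomorphic hA h0 h1, fourierCoeff_conj,
    fourierCoeff.add (integrable_of_continuous c1) (integrable_of_continuous (c2.add c3)),
    Pi.add_apply, fourierCoeff.add (integrable_of_continuous c2) (integrable_of_continuous c3),
    Pi.add_apply, fourierCoeff.const_mul, fourierCoeff.const_mul, fourierCoeff.const_mul,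
    fourierCoeff_zpow_mul, fourierCoeff_zpow_mul, fourierCoeff_of_holomorphic hp2 h0 h1,
    fourierCoeff_of_holomorphic hp1 h0 h1, fourierCoeff_of_holomorphic hp h0 h1,
    taylorCoeffZ_deriv, taylorCoeffZ_deriv, taylorCoeffZ_deriv, radialFactor,
    show -n + 1 + 1 = 2 - n by ring, show -n - -1 + 1 = 2 - n by ring, show -n - -2 = 2 - n by ring,
    show -n - -1 = -n + 1 by ring, show 2 - n = -n + 2 by ring, zpow_add₀ hr, zpow_add₀ hr,
    zpow_one, show (2 : ℤ) = ((2 : ℕ) : ℤ) by rfl, zpow_natCast]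
  congr 2
  push_cast
  ring

lemma radialFactor_one (m : ℤ) : radialFactor m 1 = 2 := by simp [radialFactor]

lemma tendsto_zpow_mul_radialFactor (m : ℤ) :
    Tendsto (fun r : ℝ => (r : ℂ) ^ m * radialFactor m r) (𝓝[<] 1) (𝓝 2) := by
  have h1 : ContinuousAt (fun r : ℝ => (r : ℂ) ^ m * radialFactor m r) 1 := by
    refine ContinuousAt.mul (ContinuousAt.zpow₀ continuous_ofReal.continuousAt m (by simp)) ?_
    unfold radialFactor
    fun_prop
  have h2 := h1.tendsto
  simp only [ofReal_one, one_zpow, radialFactor_one, one_mul] at h2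
  exact h2.mono_left nhdsWithin_le_nhds

lemma tendsto_ofReal_zpow (m : ℤ) : Tendsto (fun r : ℝ => (r : ℂ) ^ m) (𝓝[<] 1) (𝓝 1) := by
  have h1 : ContinuousAt (fun r : ℝ => (r : ℂ) ^ m) 1 :=
    ContinuousAt.zpow₀ continuous_ofReal.continuousAt m (by simp)
  have h2 := h1.tendsto
  simp only [ofReal_one, one_zpow] at h2
  exact h2.mono_left nhdsWithin_le_nhds

lemma zeroExt_slice_harmForm {A p : ℂ → ℂ} {X : 𝔻 → ℂ} (hX : ∀ z : 𝔻, X z = harmForm A p z) {r : ℝ}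
    (h0 : 0 ≤ r) (h1 : r < 1) : (fun θ : S1 => zeroExt X (r * pt θ)) =
      fun θ : S1 => harmForm A p (r * pt θ) :=
  funext fun θ => eqOn_zeroExt hX (mul_pt_mem_disc h0 h1 θ)

/-- The Fourier coefficients of an `L²` boundary value of `harmForm A p`. -/
lemma fourierCoeff_boundary_harmForm {A p : ℂ → ℂ} (hA : DifferentiableOn ℂ A disc)
    (hp : DifferentiableOn ℂ p disc) {X : 𝔻 → ℂ} (hX : ∀ z : 𝔻, X z = harmForm A p z) {Y : L2S1}
    (hY : HasL2Extension X Y) (n : ℤ) :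
    fourierCoeff Y n = taylorCoeffZ A n + 2 * conj (taylorCoeffZ p (2 - n)) := by
  have h1 := hY.tendsto_fourierCoeff (isSmooth_of_eq hX (contDiffOn_harmForm hA hp)) n
  refine tendsto_nhds_unique h1 ?_
  have h2 := ((tendsto_ofReal_zpow n).const_mul (taylorCoeffZ A n)).add
    ((continuous_conj.tendsto _).comp
      ((tendsto_zpow_mul_radialFactor (-n)).const_mul (taylorCoeffZ p (2 - n))))
  rw [mul_one, map_mul, map_ofNat, mul_comm (conj _)] at h2
  refine h2.congr' ?_
  filter_upwards [eventually_radius] with r hr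
  rw [zeroExt_slice_harmForm hX hr.1.le hr.2, fourierCoeff_harmForm hA hp hr.1 hr.2,
    Function.comp_apply, mul_assoc (taylorCoeffZ p _)]

/-- A harmonic vector field is determined by its `L²` boundary value. -/
theorem IsHarmonic.eq_of_hasL2Extension {X X' : 𝔻 → ℂ} (hX : IsHarmonic X) (hX' : IsHarmonic X')
    {Y : L2S1} (hY : HasL2Extension X Y) (hY' : HasL2Extension X' Y) : X = X' := by
  have hd : IsHarmonic (X - X') := by
    rw [isHarmonic_iff] at hX hX' ⊢
    refine ⟨hX.1.sub hX'.1, ?_⟩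
    rw [quadDiff_sub hX.1 hX'.1, zeroExt_sub]
    exact hX.2.sub hX'.2
  obtain ⟨A, p, hA, hp, ht, hXX⟩ := hd.exists_harmForm
  have h0 : HasL2Extension (X - X') (Y - Y) := hY.sub hX.1 hX'.1 hY'
  rw [sub_self] at h0
  have hz : ∀ n, fourierCoeff (0 : L2S1) n = 0 := by
    intro n
    rw [fourierCoeff_congr_ae (Lp.coeFn_zero ℂ 2 haarS1), fourierCoeff_eq]
    simp
  have hc := fourierCoeff_boundary_harmForm hA hp hXX h0
  simp only [hz] at hc
  have hAz : ∀ n : ℕ, taylorCoeff A n = 0 := by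
    intro n
    have := hc n
    rw [ht (2 - n) (by omega), taylorCoeffZ_natCast] at this
    simpa using this.symm
  have hpz : ∀ n : ℕ, taylorCoeff p n = 0 := by
    intro n
    rw [← taylorCoeffZ_natCast]
    rcases le_or_gt n 2 with h | h
    · exact ht n (by omega)
    · have := hc (2 - n)
      rw [taylorCoeffZ_of_neg A (by omega), show 2 - (2 - (n : ℤ)) = n by ring] at this
      simpa using this.symm
  have hvan : ∀ {f : ℂ → ℂ}, DifferentiableOn ℂ f disc → (∀ n, taylorCoeff f n = 0) →
      ∀ z ∈ disc, f z = 0 := by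
    intro f hf h z hz
    have := hasSum_taylorCoeff hf hz
    simp only [h, zero_mul] at this
    exact this.unique hasSum_zero
  have hd1 : ∀ n, taylorCoeff (deriv p) n = 0 := fun n => by rw [taylorCoeff_deriv, hpz, mul_zero]
  have hd2 : ∀ n, taylorCoeff (deriv (deriv p)) n = 0 := fun n => by
    rw [taylorCoeff_deriv, hd1, mul_zero]
  rw [← sub_eq_zero]
  ext z
  have hm := coe_mem_disc z
  rw [hXX z, harmForm, hvan hA hAz z hm, hvan hp hpz z hm, hvan (hp.deriv isOpen_disc) hd1 z hm,
    hvan ((hp.deriv isOpen_disc).deriv isOpen_disc) hd2 z hm]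
  simp

lemma IsHarmonic.add {X X' : 𝔻 → ℂ} (hX : IsHarmonic X) (hX' : IsHarmonic X') :
    IsHarmonic (X + X') := by
  rw [isHarmonic_iff] at hX hX' ⊢
  refine ⟨hX.1.add hX'.1, ?_⟩
  rw [quadDiff_add hX.1 hX'.1, zeroExt_add]
  exact hX.2.add hX'.2

lemma IsHarmonic.smul {X : 𝔻 → ℂ} (a : ℝ) (hX : IsHarmonic X) : IsHarmonic (a • X) := by
  rw [isHarmonic_iff] at hX ⊢
  refine ⟨hX.1.smul a, ?_⟩
  rw [quadDiff_smul a hX.1, zeroExt_smul]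
  exact hX.2.const_smul a

/-! ### Killing fields -/

/-- The vector field `β + i s z - conj β z²`. -/
def killingField (β : ℂ) (s : ℝ) (z : ℂ) : ℂ := β + I * s * z - conj β * z ^ 2

lemma differentiable_killingField (β : ℂ) (s : ℝ) : Differentiable ℂ (killingField β s) := by
  unfold killingField; fun_prop

lemma hasDerivAt_killingField (β : ℂ) (s : ℝ) (z : ℂ) :
    HasDerivAt (killingField β s) (I * s - conj β * (2 * z)) z := by
  have h : HasDerivAt (killingField β s) _ z := (((hasDerivAt_id z).const_mul (I * s)).const_add
    β).sub ((hasDerivAt_pow 2 z).const_mul (conj β))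
  refine h.congr_deriv ?_
  simp

lemma lieMetric_of_hasDerivAt {X : 𝔻 → ℂ} {z : 𝔻} {X' : ℂ} (h : HasDerivAt (zeroExt X) X' z)
    (u v : ℂ) : lieMetric X z u v = (u * conj v).re * (8 / (1 - ‖(z : ℂ)‖ ^ 2) ^ 3) *
      (2 * (conj (z : ℂ) * X z).re + (1 - ‖(z : ℂ)‖ ^ 2) * X'.re) := by
  have hz := (one_sub_normSq_pos z).ne'
  have h1 : HasFDerivAt (fun w : ℂ => 1 - ‖w‖ ^ 2) (-(2 • (innerSL ℝ (z : ℂ)))) z :=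
    (hasFDerivAt_normSq z).const_sub 1
  have h2 : HasDerivAt (fun x : ℝ => 4 / x ^ 2) (-8 / (1 - ‖(z : ℂ)‖ ^ 2) ^ 3)
      (1 - ‖(z : ℂ)‖ ^ 2) := by
    have h4 : HasDerivAt (fun x : ℝ => x ^ 2) _ (1 - ‖(z : ℂ)‖ ^ 2) := hasDerivAt_pow 2 _
    refine ((h4.fun_inv (pow_ne_zero 2 hz)).const_mul 4).congr_deriv ?_
    field_simp
    ring
  have h3 : HasFDerivAt (fun w : ℂ => hypMetric w u v) _ z :=
    (h2.comp_hasFDerivAt (z : ℂ) h1).mul_const (u * conj v).re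
  rw [lieMetric, h3.fderiv, fderiv_real_of_hasDerivAt h, fderiv_real_of_hasDerivAt h]
  simp only [_root_.smul_apply, _root_.neg_apply, innerSL_apply_apply, smul_eq_mul, nsmul_eq_mul,
    hypMetric]
  rw [show inner ℝ (z : ℂ) (X z) = (conj (z : ℂ) * X z).re by rw [mul_comm]; rfl]
  rw [show u * X' * conj v = u * conj v * X' by ring,
    show u * conj (v * X') = u * conj v * conj X' by rw [map_mul]; ring]
  generalize u * conj v = c
  simp only [mul_re, conj_re, conj_im]
  field_simp
  push_cast
  ring

lemma killingField_mem (β : ℂ) (s : ℝ) {X : 𝔻 → ℂ} (hX : ∀ z : 𝔻, X z = killingField β s z) :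
    X ∈ killing := by
  refine ⟨isSmooth_of_eq hX (contDiffOn_of_holomorphic
    (differentiable_killingField β s).differentiableOn), fun z u v => ?_⟩
  have h := (hasDerivAt_killingField β s z).congr_of_eventuallyEq (zeroExt_eventuallyEq hX z)
  rw [lieMetric_of_hasDerivAt h, hX z, killingField]
  refine mul_eq_zero_of_right _ ?_
  rw [← normSq_eq_norm_sq, normSq_apply]
  simp [pow_two]
  ring

/-- A holomorphic function whose Taylor coefficients vanish from index `3` on, with `a₁` imaginary
and `a₂ = -conj a₀`, is a Killing field. -/
lemma exists_killingField_of_taylorCoeffZ {f : ℂ → ℂ} (hf : DifferentiableOn ℂ f disc)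
    (h3 : ∀ n : ℤ, 3 ≤ n → taylorCoeffZ f n = 0) (h1 : (taylorCoeffZ f 1).re = 0)
    (h2 : taylorCoeffZ f 2 = -conj (taylorCoeffZ f 0)) :
    ∃ β s, ∀ z ∈ disc, f z = killingField β s z := by
  refine ⟨taylorCoeffZ f 0, (taylorCoeffZ f 1).im, fun z hz => ?_⟩
  have hs := hasSum_taylorCoeff hf hz
  have hs' : HasSum (fun n => taylorCoeff f n * z ^ n)
      (∑ n ∈ Finset.range 3, taylorCoeff f n * z ^ n) :=
    hasSum_sum_of_ne_finset_zero fun n hn => by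
      rw [← taylorCoeffZ_natCast, h3 n (by have := Finset.mem_range.not.1 hn; omega), zero_mul]
  rw [hs.unique hs', Finset.sum_range_succ, Finset.sum_range_succ, Finset.sum_range_one,
    ← taylorCoeffZ_natCast, ← taylorCoeffZ_natCast, ← taylorCoeffZ_natCast]
  have e1 : taylorCoeffZ f 1 = I * (taylorCoeffZ f 1).im := by
    apply Complex.ext <;> simp [h1]
  simp only [Nat.cast_zero, Nat.cast_one, Nat.cast_ofNat, h2, killingField, pow_zero, pow_one]
  conv_lhs => rw [e1]
  ring

lemma mem_killing_iff {X : 𝔻 → ℂ} :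
    X ∈ killing ↔ ∃ β s, ∀ z : 𝔻, X z = killingField β s z := by
  refine ⟨fun hX => ?_, fun ⟨β, s, h⟩ => killingField_mem β s h⟩
  obtain ⟨hs, hl⟩ := hX
  have hd : DifferentiableOn ℂ (zeroExt X) disc := by
    rw [← quadDiff_eq_zero_iff hs]
    ext z
    simp [quadDiff, hl]
  set f := zeroExt X with hf
  have hd1 := hd.deriv isOpen_disc
  set g : S1 → ℂ := (fun θ : S1 => (2 * (1 / 2 : ℝ) : ℂ) * (pt θ ^ (-1 : ℤ) * f ((1 / 2 : ℝ) * pt θ)))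
    + (fun θ : S1 => (3 / 4 : ℂ) * deriv f ((1 / 2 : ℝ) * pt θ)) with hg
  have hcont : ∀ {f : ℂ → ℂ}, DifferentiableOn ℂ f disc →
      Continuous fun θ : S1 => f ((1 / 2 : ℝ) * pt θ) :=
    fun hf => hf.continuousOn.comp_continuous (continuous_const.mul continuous_pt)
      (mul_pt_mem_disc (by norm_num) (by norm_num))
  have c1 : Continuous (fun θ : S1 =>
      (2 * (1 / 2 : ℝ) : ℂ) * (pt θ ^ (-1 : ℤ) * f ((1 / 2 : ℝ) * pt θ))) :=
    continuous_const.mul ((continuous_pt_zpow _).mul (hcont hd))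
  have c2 : Continuous (fun θ : S1 => (3 / 4 : ℂ) * deriv f ((1 / 2 : ℝ) * pt θ)) :=
    continuous_const.mul (hcont hd1)
  have hre : ∀ θ, conj (g θ) = -1 * g θ := by
    intro θ
    have hm := mul_pt_mem_disc (r := 1 / 2) (by norm_num) (by norm_num) θ
    set z : 𝔻 := UnitDisc.mk _ (mem_disc.1 hm) with hz
    have hn : ‖(z : ℂ)‖ = 1 / 2 := by
      rw [hz, UnitDisc.coe_mk, norm_mul, norm_pt, mul_one, norm_real]; norm_num
    have h1 := lieMetric_of_hasDerivAt (hd.differentiableAt (disc_mem_nhds z)).hasDerivAt 1 1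
    rw [hl z 1 1, hn, ← zeroExt_coe X z, ← hf, show (z : ℂ) = (1 / 2 : ℝ) * pt θ from rfl] at h1
    have h2 : (g θ).re = 0 := by
      simp only [hg, Pi.add_apply, add_re, zpow_neg_one, inv_pt]
      simp only [map_mul, conj_ofReal, map_one, mul_one, one_re, one_mul] at h1
      rw [show (3 / 4 : ℂ) = ((3 / 4 : ℝ) : ℂ) by push_cast; rfl, re_ofReal_mul,
        show (2 * (1 / 2 : ℝ) : ℂ) = ((1 : ℝ) : ℂ) by push_cast; norm_num, re_ofReal_mul]
      rw [mul_assoc, re_ofReal_mul] at h1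
      norm_num at h1 ⊢
      linarith
    apply Complex.ext <;> simp [h2]
  have hgc : ∀ n : ℤ, fourierCoeff g n =
      taylorCoeffZ f (n + 1) * ((1 / 2 : ℝ) : ℂ) ^ n * (1 / 2 + 3 / 4 * (n + 1)) := by
    intro n
    rw [hg, fourierCoeff.add (integrable_of_continuous c1) (integrable_of_continuous c2),
      Pi.add_apply, fourierCoeff.const_mul, fourierCoeff.const_mul, fourierCoeff_zpow_mul,
      fourierCoeff_of_holomorphic hd (by norm_num) (by norm_num),
      fourierCoeff_of_holomorphic hd1 (by norm_num) (by norm_num), taylorCoeffZ_deriv, sub_neg_eq_add,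
      zpow_add₀ (ofReal_ne_zero.2 (by norm_num)), zpow_one]
    push_cast
    ring
  have hsym : ∀ n : ℤ, conj (fourierCoeff g (-n)) = -fourierCoeff g n := by
    intro n
    rw [← fourierCoeff_conj]
    simp only [hre]
    rw [fourierCoeff.const_mul, neg_one_mul]
  have hpos : ∀ n : ℤ, 0 ≤ n → ((1 / 2 : ℝ) : ℂ) ^ n * (1 / 2 + 3 / 4 * (n + 1)) ≠ 0 := by
    intro n hn
    refine mul_ne_zero (zpow_ne_zero _ (ofReal_ne_zero.2 (by norm_num))) ?_
    have : (0 : ℝ) ≤ n := by exact_mod_cast hn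
    have h : ((1 / 2 + 3 / 4 * ((n : ℝ) + 1) : ℝ) : ℂ) ≠ 0 := ofReal_ne_zero.2 (by positivity)
    push_cast at h
    exact h
  have hk : ∃ β s, ∀ z ∈ disc, f z = killingField β s z := by
    refine exists_killingField_of_taylorCoeffZ hd (fun n hn => ?_) ?_ ?_
    · have h1 := hsym (n - 1)
      rw [hgc, hgc, taylorCoeffZ_of_neg f (by omega), zero_mul, zero_mul, map_zero, sub_add_cancel,
        mul_assoc] at h1
      exact (mul_eq_zero.1 (neg_eq_zero.1 h1.symm)).resolve_right (hpos (n - 1) (by omega))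
    · have h1 := hsym 0
      have e : fourierCoeff g 0 = ((5 / 4 : ℝ) : ℂ) * taylorCoeffZ f 1 := by
        rw [hgc, zero_add, zpow_zero]; push_cast; ring
      rw [neg_zero, e, map_mul, conj_ofReal] at h1
      have h2 := congrArg re h1
      rw [neg_re, re_ofReal_mul, re_ofReal_mul, conj_re] at h2
      linarith
    · have h1 := hsym 1
      rw [hgc, hgc] at h1
      simp at h1
      have h2 : conj (taylorCoeffZ f 0) = -taylorCoeffZ f 2 := by
        norm_num at h1
        linear_combination h1
      rw [h2, neg_neg]
  obtain ⟨β, s, h⟩ := hk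
  exact ⟨β, s, fun z => by rw [← h z (coe_mem_disc z), hf, zeroExt_coe]⟩

/-- A conformal vector field with tangential `L²` boundary value is a Killing field. -/
lemma mem_killing_of_tangential {X : 𝔻 → ℂ} (hX : IsSmooth X) (hq : quadDiff X = 0) {Y : L2S1}
    (hY : HasL2Extension X Y) (ht : IsTangential Y) : X ∈ killing := by
  have hd := (quadDiff_eq_zero_iff hX).1 hq
  have hc : ∀ n, fourierCoeff Y n = taylorCoeffZ (zeroExt X) n := by
    intro n
    refine tendsto_nhds_unique (hY.tendsto_fourierCoeff hX n) ?_
    have h2 := (tendsto_ofReal_zpow n).const_mul (taylorCoeffZ (zeroExt X) n)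
    rw [mul_one] at h2
    refine h2.congr' ?_
    filter_upwards [eventually_radius] with r hr
    rw [fourierCoeff_of_holomorphic hd hr.1 hr.2]
  have hs := (isTangential_iff_fourierCoeff Y).1 ht
  simp only [hc] at hs
  have hk : ∃ β s, ∀ z ∈ disc, zeroExt X z = killingField β s z := by
    refine exists_killingField_of_taylorCoeffZ hd (fun n hn => ?_) ?_ ?_
    · have h1 := hs (n - 2)
      rw [taylorCoeffZ_of_neg _ (by omega), map_zero, sub_add_cancel] at h1
      exact neg_eq_zero.1 h1.symm
    · have h1 := congrArg re (hs (-1))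
      simp at h1
      linarith
    · have h1 := hs 0
      simp at h1
      rw [h1, neg_neg]
  obtain ⟨β, s, h⟩ := hk
  exact killingField_mem β s fun z => by rw [← h z (coe_mem_disc z), zeroExt_coe]

/-! ### Cauchy integrals -/

/-- The integral of `g(w) (1 - z conj w)^{-k}` over the circle. -/
def cauchyInt (g : S1 → ℂ) (k : ℕ) (z : ℂ) : ℂ :=
  ∫ θ, g θ * ((1 - z * conj (pt θ))⁻¹) ^ k ∂haarS1

lemma norm_one_sub_mul_conj_ge (z : ℂ) (θ : S1) : 1 - ‖z‖ ≤ ‖1 - z * conj (pt θ)‖ := by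
  have h := norm_sub_norm_le (1 : ℂ) (z * conj (pt θ))
  rwa [norm_one, norm_mul, norm_conj, norm_pt, mul_one] at h

lemma one_sub_mul_conj_ne_zero {z : ℂ} (hz : z ∈ disc) (θ : S1) : 1 - z * conj (pt θ) ≠ 0 := by
  have h := norm_one_sub_mul_conj_ge z θ
  have h2 := mem_disc.1 hz
  exact norm_pos_iff.1 (by linarith)

lemma continuous_cauchy_kernel {z : ℂ} (hz : z ∈ disc) (k : ℕ) :
    Continuous fun θ : S1 => ((1 - z * conj (pt θ))⁻¹) ^ k :=
  ((continuous_const.sub (continuous_const.mul (continuous_conj.comp continuous_pt))).inv₀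
    (one_sub_mul_conj_ne_zero hz)).pow k

lemma integrable_mul_continuous {g b : S1 → ℂ} (hg : Integrable g haarS1) (hb : Continuous b) :
    Integrable (fun θ => g θ * b θ) haarS1 := by
  obtain ⟨C, hC⟩ := isCompact_univ.exists_bound_of_continuousOn hb.continuousOn
  exact hg.mul_bdd hb.aestronglyMeasurable (ae_of_all _ fun θ => hC θ (mem_univ θ))

lemma hasDerivAt_cauchyInt {g : S1 → ℂ} (hg : Integrable g haarS1) (k : ℕ) {z : ℂ}
    (hz : z ∈ disc) :
    HasDerivAt (cauchyInt g k) (k * cauchyInt (fun θ => g θ * conj (pt θ)) (k + 1) z) z := by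
  set ρ : ℝ := (1 + ‖z‖) / 2 with hρ
  have hz1 := mem_disc.1 hz
  have hρ1 : ρ < 1 := by rw [hρ]; linarith
  have hmem : Metric.ball z ((1 - ‖z‖) / 2) ∈ 𝓝 z := Metric.ball_mem_nhds z (by linarith)
  have hball : ∀ x ∈ Metric.ball z ((1 - ‖z‖) / 2), ‖x‖ ≤ ρ := by
    intro x hx
    have h1 : ‖x - z‖ < (1 - ‖z‖) / 2 := mem_ball_iff_norm.1 hx
    have h2 : ‖x‖ ≤ ‖x - z‖ + ‖z‖ := by simpa using norm_add_le (x - z) z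
    rw [hρ]; linarith
  have hdisc : ∀ x ∈ Metric.ball z ((1 - ‖z‖) / 2), x ∈ disc := fun x hx =>
    mem_disc.2 ((hball x hx).trans_lt hρ1)
  have hgc : Integrable (fun θ => g θ * conj (pt θ)) haarS1 :=
    integrable_mul_continuous hg (continuous_conj.comp continuous_pt)
  have key := hasDerivAt_integral_of_dominated_loc_of_deriv_le (μ := haarS1) (𝕜 := ℂ)
    (F := fun x θ => g θ * ((1 - x * conj (pt θ))⁻¹) ^ k)
    (F' := fun x θ => k * (g θ * conj (pt θ) * ((1 - x * conj (pt θ))⁻¹) ^ (k + 1)))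
    (bound := fun θ => k * (‖g θ‖ * ((1 - ρ)⁻¹) ^ (k + 1))) hmem ?_ ?_ ?_ ?_ ?_ ?_
  · have h2 := key.2
    rw [integral_const_mul] at h2
    exact h2
  · filter_upwards [hmem] with x hx
    exact (integrable_mul_continuous hg (continuous_cauchy_kernel (hdisc x hx) k)).1
  · exact integrable_mul_continuous hg (continuous_cauchy_kernel hz k)
  · exact ((integrable_mul_continuous hgc (continuous_cauchy_kernel hz (k + 1))).const_mul _).1
  · refine ae_of_all _ fun θ x hx => ?_
    rw [norm_mul, norm_mul, norm_mul, norm_conj, norm_pt, mul_one, norm_pow, norm_inv,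
      Complex.norm_natCast]
    have h1 := norm_one_sub_mul_conj_ge x θ
    have h2 := hball x hx
    gcongr
    linarith
  · exact (hg.norm.mul_const _).const_mul _
  · refine ae_of_all _ fun θ x hx => ?_
    have h0 := one_sub_mul_conj_ne_zero (hdisc x hx) θ
    have h1 : HasDerivAt (fun x : ℂ => 1 - x * conj (pt θ)) (-conj (pt θ)) x := by
      simpa using ((hasDerivAt_id x).mul_const (conj (pt θ))).const_sub 1
    have h2 : HasDerivAt (fun x : ℂ => ((1 - x * conj (pt θ))⁻¹) ^ k) _ x := (h1.fun_inv h0).pow k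
    refine (h2.const_mul (g θ)).congr_deriv ?_
    cases k with
    | zero => simp
    | succ k =>
      rw [Nat.add_one_sub_one, neg_neg, div_eq_mul_inv, ← inv_pow]
      push_cast
      ring

lemma differentiableOn_cauchyInt {g : S1 → ℂ} (hg : Integrable g haarS1) (k : ℕ) :
    DifferentiableOn ℂ (cauchyInt g k) disc := fun _ hz =>
  (hasDerivAt_cauchyInt hg k hz).differentiableAt.differentiableWithinAt

lemma iteratedDeriv_cauchyInt {g : S1 → ℂ} (hg : Integrable g haarS1) (n : ℕ) :
    ∀ z ∈ disc, iteratedDeriv n (cauchyInt g 1) z =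
      n.factorial * cauchyInt (fun θ => g θ * conj (pt θ) ^ n) (n + 1) z := by
  induction n with
  | zero => intro z _; simp
  | succ n ih =>
    intro z hz
    have hgn : Integrable (fun θ => g θ * conj (pt θ) ^ n) haarS1 :=
      integrable_mul_continuous hg ((continuous_conj.comp continuous_pt).pow n)
    have e : iteratedDeriv n (cauchyInt g 1) =ᶠ[𝓝 z] fun z =>
        n.factorial * cauchyInt (fun θ => g θ * conj (pt θ) ^ n) (n + 1) z := by
      filter_upwards [isOpen_disc.mem_nhds hz] with w hw using ih w hw
    rw [iteratedDeriv_succ, e.deriv_eq, ((hasDerivAt_cauchyInt hgn (n + 1) hz).const_mul _).deriv,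
      Nat.factorial_succ]
    simp only [mul_assoc, ← pow_succ]
    push_cast
    ring

/-- The Taylor coefficients of a Cauchy integral are Fourier coefficients. -/
lemma taylorCoeff_cauchyInt {g : S1 → ℂ} (hg : Integrable g haarS1) (n : ℕ) :
    taylorCoeff (cauchyInt g 1) n = fourierCoeff g n := by
  have hn : ((n.factorial : ℕ) : ℂ) ≠ 0 := Nat.cast_ne_zero.2 n.factorial_ne_zero
  rw [taylorCoeff, iteratedDeriv_cauchyInt hg n 0 (by simp), ← mul_assoc, inv_mul_cancel₀ hn,
    one_mul, cauchyInt, fourierCoeff_eq]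
  refine integral_congr_ae (ae_of_all _ fun θ => ?_)
  simp [← inv_pt, mul_comm]

lemma taylorCoeffZ_eq_of_fourierCoeff {f : ℂ → ℂ} (hf : DifferentiableOn ℂ f disc) (n : ℤ) :
    taylorCoeffZ f n = fourierCoeff (fun θ : S1 => f ((1 / 2 : ℝ) * pt θ)) n *
      ((1 / 2 : ℝ) : ℂ) ^ (-n) := by
  have h : ((1 / 2 : ℝ) : ℂ) ≠ 0 := ofReal_ne_zero.2 (by norm_num)
  rw [fourierCoeff_of_holomorphic hf (by norm_num) (by norm_num), mul_assoc, ← zpow_add₀ h,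
    add_neg_cancel, zpow_zero, mul_one]

lemma taylorCoeffZ_pow_mul {f : ℂ → ℂ} (hf : DifferentiableOn ℂ f disc) (k : ℕ) (n : ℤ) :
    taylorCoeffZ (fun z => z ^ k * f z) n = taylorCoeffZ f (n - k) := by
  have hd : DifferentiableOn ℂ (fun z => z ^ k * f z) disc :=
    (differentiableOn_id.pow k).mul hf
  have h : ((1 / 2 : ℝ) : ℂ) ≠ 0 := ofReal_ne_zero.2 (by norm_num)
  rw [taylorCoeffZ_eq_of_fourierCoeff hd, taylorCoeffZ_eq_of_fourierCoeff hf]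
  have e : (fun θ : S1 => ((1 / 2 : ℝ) * pt θ) ^ k * f ((1 / 2 : ℝ) * pt θ)) = fun θ : S1 =>
      ((1 / 2 : ℝ) : ℂ) ^ k * (pt θ ^ (k : ℤ) * f ((1 / 2 : ℝ) * pt θ)) := by
    ext θ; rw [zpow_natCast]; ring
  rw [e, fourierCoeff.const_mul, fourierCoeff_zpow_mul, neg_sub, sub_eq_add_neg (k : ℤ),
    zpow_add₀ h, zpow_natCast]
  ring

/-! ### The Poisson map -/

/-- The holomorphic part of the Poisson integral of `Y`. -/
def holPart (Y : L2S1) (z : ℂ) : ℂ := z ^ 3 * cauchyInt (fun θ => conj (pt θ) ^ 3 * Y θ) 1 z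

/-- The holomorphic function `p` for which the Poisson integral of `Y` is `harmForm A p`. -/
def potential (Y : L2S1) (z : ℂ) : ℂ := 1 / 2 * cauchyInt (fun θ => pt θ ^ 2 * conj (Y θ)) 1 z

lemma integrable_conj_mul (Y : L2S1) {b : S1 → ℂ} (hb : Continuous b) :
    Integrable (fun θ => b θ * conj (Y θ)) haarS1 :=
  (memLp_mul_continuous (memLp_conj (Lp.memLp Y)) hb).integrable (by norm_num)

lemma integrable_L2_mul (Y : L2S1) {b : S1 → ℂ} (hb : Continuous b) :
    Integrable (fun θ => b θ * Y θ) haarS1 :=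
  (memLp_mul_continuous (Lp.memLp Y) hb).integrable (by norm_num)

lemma continuous_conj_pt : Continuous fun θ : S1 => conj (pt θ) :=
  continuous_conj.comp continuous_pt

lemma conj_pt_mul_pt (θ : S1) : conj (pt θ) * pt θ = 1 := by
  rw [← inv_pt, inv_mul_cancel₀ (pt_ne_zero θ)]

lemma differentiableOn_holPart (Y : L2S1) : DifferentiableOn ℂ (holPart Y) disc :=
  (differentiableOn_id.pow 3).mul
    (differentiableOn_cauchyInt (integrable_L2_mul Y (b := fun θ => conj (pt θ) ^ 3) (continuous_conj_pt.pow 3)) 1)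

lemma differentiableOn_potential (Y : L2S1) : DifferentiableOn ℂ (potential Y) disc :=
  (differentiableOn_cauchyInt (integrable_conj_mul Y (b := fun θ => pt θ ^ 2) (continuous_pt.pow 2)) 1).const_mul _

lemma deriv_potential (Y : L2S1) {z : ℂ} (hz : z ∈ disc) :
    deriv (potential Y) z = 1 / 2 * cauchyInt (fun θ => pt θ * conj (Y θ)) 2 z := by
  have h := (hasDerivAt_cauchyInt (integrable_conj_mul Y (b := fun θ => pt θ ^ 2) (continuous_pt.pow 2)) 1 hz).const_mul
    (1 / 2 : ℂ)
  rw [Nat.cast_one, one_mul] at h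
  rw [show potential Y = fun z => 1 / 2 * cauchyInt (fun θ => pt θ ^ 2 * conj (Y θ)) 1 z from rfl,
    h.deriv]
  congr 2
  ext θ
  linear_combination (pt θ * conj (Y θ)) * conj_pt_mul_pt θ

lemma deriv_deriv_potential (Y : L2S1) {z : ℂ} (hz : z ∈ disc) :
    deriv (deriv (potential Y)) z = cauchyInt (fun θ => conj (Y θ)) 3 z := by
  have h := (hasDerivAt_cauchyInt (integrable_conj_mul Y continuous_pt) 2 hz).const_mul (1 / 2 : ℂ)
  have e : deriv (potential Y) =ᶠ[𝓝 z] fun z =>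
      1 / 2 * cauchyInt (fun θ => pt θ * conj (Y θ)) 2 z := by
    filter_upwards [isOpen_disc.mem_nhds hz] with w hw using deriv_potential Y hw
  rw [e.deriv_eq, h.deriv, Nat.cast_ofNat, ← mul_assoc, one_div_mul_cancel two_ne_zero, one_mul]
  congr 1
  ext θ
  linear_combination conj (Y θ) * conj_pt_mul_pt θ

/-- The decomposition of the Poisson kernel behind `poissonMap_eq`; `u = z conj w`. -/
lemma kernel_decomposition {u v N : ℂ} (hu : 1 - u ≠ 0) (hv : 1 - v ≠ 0) (hN : N = 1 - u * v) :
    N ^ 3 / ((1 - u) * (1 - v) ^ 3) = u ^ 3 * (1 - u)⁻¹ + (N ^ 2 * (1 - v)⁻¹ ^ 3 +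
      u * N * (1 - v)⁻¹ ^ 2 + u ^ 2 * (1 - v)⁻¹) := by
  subst hN
  field_simp
  ring

/-- The integrand of the Poisson map in closed form. -/
lemma poissonMap_integrand (y : ℂ) {z : ℂ} (hz : z ∈ disc) (θ : S1) :
    (y / (I * pt θ)) * (pt θ * poissonKernel (z * (pt θ)⁻¹)) =
      y * (((1 - ‖z‖ ^ 2 : ℝ) : ℂ) ^ 3 /
        ((1 - z * conj (pt θ)) * (1 - conj z * pt θ) ^ 3)) := by
  have hw := pt_ne_zero θ
  have hu := one_sub_mul_conj_ne_zero hz θ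
  have hv : 1 - conj z * pt θ ≠ 0 := by
    have := (map_ne_zero conj).2 hu
    simpa using this
  have hn : ‖z * (pt θ)⁻¹‖ = ‖z‖ := by rw [norm_mul, norm_inv, norm_pt, inv_one, mul_one]
  rw [poissonKernel, hn]
  have h1 : conj (z * (pt θ)⁻¹) = conj z * pt θ := by rw [inv_pt, map_mul, conj_conj]
  have h2 : ((‖1 - conj z * pt θ‖ ^ 2 : ℝ) : ℂ) = (1 - z * conj (pt θ)) * (1 - conj z * pt θ) := by
    rw [← normSq_eq_norm_sq, ← mul_conj, mul_comm]; simp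
  rw [h1, h2]
  field_simp

lemma poissonMap_eq (Y : L2S1) (z : 𝔻) : poissonMap Y z = harmForm (holPart Y) (potential Y) z := by
  have hz := coe_mem_disc z
  set N : ℂ := ((1 - ‖(z : ℂ)‖ ^ 2 : ℝ) : ℂ) with hN
  have hNc : conj N = N := conj_ofReal _
  have hNe : ∀ θ, N = 1 - z * conj (pt θ) * (conj (z : ℂ) * pt θ) := by
    intro θ
    rw [show (z : ℂ) * conj (pt θ) * (conj (z : ℂ) * pt θ) =
      (z : ℂ) * conj (z : ℂ) * (conj (pt θ) * pt θ) by ring, conj_pt_mul_pt, mul_conj,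
      normSq_eq_norm_sq, hN]
    push_cast; ring
  have hv : ∀ θ, 1 - conj (z : ℂ) * pt θ ≠ 0 := by
    intro θ
    have := (map_ne_zero conj).2 (one_sub_mul_conj_ne_zero hz θ)
    simpa using this
  have hkc : ∀ k : ℕ, Continuous fun θ : S1 => ((1 - conj (z : ℂ) * pt θ)⁻¹) ^ k := fun k =>
    ((continuous_const.sub (continuous_const.mul continuous_pt)).inv₀ hv).pow k
  have hconj : ∀ (j k : ℕ), conj (cauchyInt (fun θ => pt θ ^ j * conj (Y θ)) k z) =
      ∫ θ, (conj (pt θ) ^ j * ((1 - conj (z : ℂ) * pt θ)⁻¹) ^ k) * Y θ ∂haarS1 := by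
    intro j k
    rw [cauchyInt, ← integral_conj]
    refine integral_congr_ae (ae_of_all _ fun θ => ?_)
    simp only [map_mul, map_pow, map_inv₀, map_sub, map_one, conj_conj]
    ring
  have h0 := hconj 2 1
  have h1 := hconj 1 2
  have h2 := hconj 0 3
  simp only [pow_one, pow_zero, one_mul] at h0 h1 h2
  have i0 := integrable_L2_mul Y
    (b := fun θ => conj (pt θ) ^ 2 * (1 - conj (z : ℂ) * pt θ)⁻¹ ^ 1)
    ((continuous_conj_pt.pow 2).mul (hkc 1))
  have i1 := integrable_L2_mul Y (b := fun θ => conj (pt θ) * (1 - conj (z : ℂ) * pt θ)⁻¹ ^ 2)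
    (continuous_conj_pt.mul (hkc 2))
  have i2 := integrable_L2_mul Y (hkc 3)
  have i3 := integrable_L2_mul Y
    (b := fun θ => conj (pt θ) ^ 3 * (1 - (z : ℂ) * conj (pt θ))⁻¹ ^ 1)
    ((continuous_conj_pt.pow 3).mul (continuous_cauchy_kernel hz 1))
  simp only [pow_one] at i0 i3
  rw [harmForm, deriv_potential Y hz, deriv_deriv_potential Y hz, holPart, potential]
  simp only [map_add, map_mul, map_pow, conj_conj, map_ofNat, map_div₀, map_one, h0, h1, h2]
  rw [← hN, hNc, cauchyInt, poissonMap]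
  rw [show (∫ θ, conj (pt θ) ^ 3 * Y θ * (1 - (z : ℂ) * conj (pt θ))⁻¹ ^ 1 ∂haarS1) =
    ∫ θ, conj (pt θ) ^ 3 * (1 - (z : ℂ) * conj (pt θ))⁻¹ * Y θ ∂haarS1 by
      refine integral_congr_ae (ae_of_all _ fun θ => ?_)
      simp only [pow_one]; ring]
  have e : ∀ θ, (Y θ / (I * pt θ)) * (pt θ * poissonKernel (z * (pt θ)⁻¹)) =
      (z : ℂ) ^ 3 * (conj (pt θ) ^ 3 * (1 - (z : ℂ) * conj (pt θ))⁻¹ * Y θ) +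
      (N ^ 2 * ((1 - conj (z : ℂ) * pt θ)⁻¹ ^ 3 * Y θ) +
      (z * N * (conj (pt θ) * (1 - conj (z : ℂ) * pt θ)⁻¹ ^ 2 * Y θ) +
      (z : ℂ) ^ 2 * (conj (pt θ) ^ 2 * (1 - conj (z : ℂ) * pt θ)⁻¹ * Y θ))) := by
    intro θ
    rw [poissonMap_integrand _ hz, ← hN,
      kernel_decomposition (one_sub_mul_conj_ne_zero hz θ) (hv θ) (hNe θ)]
    ring
  have j0 := i0.const_mul ((z : ℂ) ^ 2)
  have j1 := i1.const_mul (z * N)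
  have j2 := i2.const_mul (N ^ 2)
  have j3 := i3.const_mul ((z : ℂ) ^ 3)
  simp only [e]
  rw [integral_add j3 (j2.fun_add (j1.fun_add j0)), integral_add j2 (j1.fun_add j0),
    integral_add j1 j0,
    integral_const_mul, integral_const_mul, integral_const_mul, integral_const_mul]
  ring

theorem isHarmonic_poissonMap (Y : L2S1) : IsHarmonic (poissonMap Y) :=
  isHarmonic_of_harmForm (differentiableOn_holPart Y) (differentiableOn_potential Y)
    (poissonMap_eq Y)

lemma taylorCoeffZ_holPart (Y : L2S1) (n : ℤ) :
    taylorCoeffZ (holPart Y) n = if 3 ≤ n then fourierCoeff Y n else 0 := by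
  have hi := integrable_L2_mul Y (b := fun θ => conj (pt θ) ^ 3) (continuous_conj_pt.pow 3)
  rw [show holPart Y = fun z => z ^ 3 * cauchyInt (fun θ => conj (pt θ) ^ 3 * Y θ) 1 z from rfl,
    taylorCoeffZ_pow_mul (differentiableOn_cauchyInt hi 1)]
  split_ifs with h
  · obtain ⟨m, hm⟩ := Int.eq_ofNat_of_zero_le (sub_nonneg.2 h)
    obtain rfl : n = m + 3 := by omega
    rw [show (m : ℤ) + 3 - ((3 : ℕ) : ℤ) = m by push_cast; ring, taylorCoeffZ_natCast,
      taylorCoeff_cauchyInt hi, fourierCoeff_eq, fourierCoeff_eq]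
    refine integral_congr_ae (ae_of_all _ fun θ => ?_)
    simp only [← mul_assoc, ← inv_pt]
    rw [← zpow_natCast (pt θ)⁻¹ 3, inv_zpow', ← zpow_add₀ (pt_ne_zero θ)]
    congr 2
    push_cast; ring
  · exact taylorCoeffZ_of_neg _ (by push_cast; omega)

lemma taylorCoeffZ_const_mul (c : ℂ) (f : ℂ → ℂ) (n : ℤ) :
    taylorCoeffZ (fun z => c * f z) n = c * taylorCoeffZ f n := by
  rw [taylorCoeffZ, taylorCoeffZ]
  split_ifs
  · rw [taylorCoeff, taylorCoeff, iteratedDeriv_const_mul_field]; ring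
  · rw [mul_zero]

lemma taylorCoeffZ_potential (Y : L2S1) (n : ℤ) :
    taylorCoeffZ (potential Y) n = if 0 ≤ n then 1 / 2 * conj (fourierCoeff Y (2 - n)) else 0 := by
  split_ifs with h
  · lift n to ℕ using h
    rw [show potential Y = fun z => 1 / 2 * cauchyInt (fun θ => pt θ ^ 2 * conj (Y θ)) 1 z from rfl,
      taylorCoeffZ_const_mul, taylorCoeffZ_natCast,
      taylorCoeff_cauchyInt (integrable_conj_mul Y (b := fun θ => pt θ ^ 2) (continuous_pt.pow 2))]
    have := fourierCoeff_zpow_mul (fun θ => conj (Y θ)) 2 n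
    rw [fourierCoeff_conj] at this
    rw [show (2 : ℤ) - n = -(n - 2) by ring, ← this]
    rfl
  · exact taylorCoeffZ_of_neg _ (by omega)

lemma mul_pow_one_sub_le {r : ℝ} (h0 : 0 ≤ r) (h1 : r ≤ 1) (m : ℕ) :
    (1 - r) * (m + 1) * r ^ m ≤ 1 := by
  have h2 : ((m : ℝ) + 1) * r ^ m ≤ ∑ k ∈ Finset.range (m + 1), r ^ k := by
    have : ∑ k ∈ Finset.range (m + 1), r ^ m ≤ ∑ k ∈ Finset.range (m + 1), r ^ k :=
      Finset.sum_le_sum fun k hk =>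
        pow_le_pow_of_le_one h0 h1 (Nat.lt_succ_iff.1 (Finset.mem_range.1 hk))
    simpa using this
  have h3 := mul_neg_geom_sum r (m + 1)
  have h4 : 0 ≤ r ^ (m + 1) := by positivity
  calc (1 - r) * (m + 1) * r ^ m = (1 - r) * ((m + 1) * r ^ m) := by ring
    _ ≤ (1 - r) * ∑ k ∈ Finset.range (m + 1), r ^ k := by gcongr
    _ ≤ 1 := by linarith

lemma sq_mul_pow_one_sub_le {r : ℝ} (h0 : 0 ≤ r) (h1 : r ≤ 1) (m : ℕ) :
    ((1 - r) * (m + 1)) ^ 2 * r ^ m ≤ 4 := by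
  have hq0 : 0 ≤ √r := Real.sqrt_nonneg r
  have hq1 : √r ≤ 1 := Real.sqrt_le_one.2 h1
  have hq := Real.sq_sqrt h0
  have h2 := mul_pow_one_sub_le hq0 hq1 m
  have h3 : 0 ≤ (1 - √r) * (m + 1) * √r ^ m := by
    have : 0 ≤ 1 - √r := by linarith
    positivity
  have e : ((1 - r) * (m + 1)) ^ 2 * r ^ m =
      (1 + √r) ^ 2 * ((1 - √r) * (m + 1) * √r ^ m) ^ 2 := by
    conv_lhs => rw [← hq]
    rw [← pow_mul, mul_comm 2 m, pow_mul]
    ring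
  rw [e]
  calc (1 + √r) ^ 2 * ((1 - √r) * (m + 1) * √r ^ m) ^ 2 ≤ (1 + 1) ^ 2 * 1 ^ 2 := by gcongr
    _ = 4 := by norm_num

/-- The radial factors are bounded uniformly in the frequency. -/
lemma norm_zpow_mul_radialFactor_le {r : ℝ} (h0 : 0 < r) (h1 : r < 1) {m : ℤ} (hm : -2 ≤ m) :
    ‖(r : ℂ) ^ m * radialFactor m r‖ ≤ 42 := by
  have hr : r ≠ 0 := h0.ne'
  have e : (r : ℂ) ^ m * radialFactor m r = ((r ^ m * ((1 - r ^ 2) ^ 2 * (m + 1) * (m + 2) +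
      2 * (1 - r ^ 2) * r ^ 2 * (m + 2) + 2 * r ^ 4) : ℝ) : ℂ) := by
    rw [radialFactor]; push_cast; ring
  rw [e, norm_real, Real.norm_eq_abs]
  rcases lt_or_ge m 0 with hneg | hpos
  · have : m = -1 ∨ m = -2 := by omega
    rcases this with rfl | rfl
    · have : r ^ (-1 : ℤ) * ((1 - r ^ 2) ^ 2 * (((-1 : ℤ) : ℝ) + 1) * (((-1 : ℤ) : ℝ) + 2) +
          2 * (1 - r ^ 2) * r ^ 2 * (((-1 : ℤ) : ℝ) + 2) + 2 * r ^ 4) = 2 * r := by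
        rw [zpow_neg_one]; push_cast; field_simp; ring
      rw [this, abs_of_pos (by positivity)]; linarith
    · have : r ^ (-2 : ℤ) * ((1 - r ^ 2) ^ 2 * (((-2 : ℤ) : ℝ) + 1) * (((-2 : ℤ) : ℝ) + 2) +
          2 * (1 - r ^ 2) * r ^ 2 * (((-2 : ℤ) : ℝ) + 2) + 2 * r ^ 4) = 2 * r ^ 2 := by
        rw [show (-2 : ℤ) = -((2 : ℕ) : ℤ) by rfl, zpow_neg, zpow_natCast]
        push_cast; field_simp; ring
      rw [this, abs_of_pos (by positivity)]; nlinarith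
  · lift m to ℕ using hpos
    have ha := mul_pow_one_sub_le h0.le h1.le m
    have hb := sq_mul_pow_one_sub_le h0.le h1.le m
    have hx0 : 0 ≤ 1 - r ^ 2 := by nlinarith
    have hx : 1 - r ^ 2 ≤ 2 * (1 - r) := by nlinarith [sq_nonneg (1 - r)]
    have hrm : r ^ m ≤ 1 := pow_le_one₀ h0.le h1.le
    have hrm0 : 0 ≤ r ^ m := by positivity
    have hm2 : (m : ℝ) + 2 ≤ 2 * (m + 1) := by linarith [(Nat.cast_nonneg m : (0 : ℝ) ≤ m)]
    rw [zpow_natCast, Int.cast_natCast, abs_of_nonneg (by positivity), mul_add, mul_add]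
    have t1 : r ^ m * ((1 - r ^ 2) ^ 2 * (m + 1) * (m + 2)) ≤ 32 := by
      calc r ^ m * ((1 - r ^ 2) ^ 2 * (m + 1) * (m + 2))
          ≤ r ^ m * ((2 * (1 - r)) ^ 2 * (m + 1) * (2 * (m + 1))) := by gcongr
        _ = 8 * (((1 - r) * (m + 1)) ^ 2 * r ^ m) := by ring
        _ ≤ 32 := by linarith
    have t2 : r ^ m * (2 * (1 - r ^ 2) * r ^ 2 * (m + 2)) ≤ 8 := by
      have hr2 : r ^ 2 ≤ 1 := by nlinarith
      calc r ^ m * (2 * (1 - r ^ 2) * r ^ 2 * (m + 2))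
          ≤ r ^ m * (2 * (2 * (1 - r)) * 1 * (2 * (m + 1))) := by gcongr
        _ = 8 * ((1 - r) * (m + 1) * r ^ m) := by ring
        _ ≤ 8 := by linarith
    have t3 : r ^ m * (2 * r ^ 4) ≤ 2 := by
      have hr4 : r ^ 4 ≤ 1 := pow_le_one₀ h0.le h1.le
      calc r ^ m * (2 * r ^ 4) ≤ 1 * (2 * 1) := by gcongr
        _ = 2 := by norm_num
    linarith

/-- The Poisson integral of an `L²` field has that field as its `L²` boundary value. -/
theorem hasL2Extension_poissonMap (Y : L2S1) : HasL2Extension (poissonMap Y) Y := by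
  refine hasL2Extension_of_multiplier (isHarmonic_poissonMap Y).1
    (fun n r => if 3 ≤ n then (r : ℂ) ^ n else 1 / 2 * ((r : ℂ) ^ (-n) * radialFactor (-n) r)) 42
    (fun n r h0 h1 => ?_) (fun n => ?_) (fun n r h0 h1 => ?_)
  · split_ifs with h
    · rw [norm_zpow, norm_real, Real.norm_of_nonneg h0.le]
      lift n to ℕ using (by omega)
      rw [zpow_natCast]
      linarith [pow_le_one₀ h0.le h1.le (n := n)]
    · rw [norm_mul]
      have := norm_zpow_mul_radialFactor_le h0 h1 (m := -n) (by omega)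
      norm_num at this ⊢
      linarith
  · split_ifs with h
    · exact tendsto_ofReal_zpow n
    · have := (tendsto_zpow_mul_radialFactor (-n)).const_mul (1 / 2 : ℂ)
      rwa [one_div_mul_cancel two_ne_zero] at this
  · rw [zeroExt_slice_harmForm (poissonMap_eq Y) h0.le h1, fourierCoeff_harmForm
      (differentiableOn_holPart Y) (differentiableOn_potential Y) h0 h1, taylorCoeffZ_holPart,
      taylorCoeffZ_potential]
    have hc : conj ((r : ℂ) ^ (-n) * radialFactor (-n) r) =
        (r : ℂ) ^ (-n) * radialFactor (-n) r := by
      simp [radialFactor, map_ofNat]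
    split_ifs with h h' h'
    · omega
    · simp; ring
    · rw [mul_assoc, map_mul, hc, sub_sub_cancel]
      simp [map_ofNat]
      ring
    · omega

lemma quadDiff_poissonMap (Y : L2S1) (z : 𝔻) :
    quadDiff (poissonMap Y) z = 8 * deriv (deriv (deriv (potential Y))) z :=
  quadDiff_harmForm (differentiableOn_holPart Y) (differentiableOn_potential Y) (poissonMap_eq Y) z

/-- A harmonic vector field with an `L²` boundary value is the Poisson integral of the latter. -/
theorem IsHarmonic.eq_poissonMap {X : 𝔻 → ℂ} (hX : IsHarmonic X) {Y : L2S1}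
    (hY : HasL2Extension X Y) : X = poissonMap Y :=
  hX.eq_of_hasL2Extension (isHarmonic_poissonMap Y) hY (hasL2Extension_poissonMap Y)

/-! ### Harmonic fields with a prescribed quadratic differential -/

lemma norm_fourierCoeff_le {g : S1 → ℂ} {C : ℝ} (h : ∀ θ, ‖g θ‖ ≤ C) (n : ℤ) :
    ‖fourierCoeff g n‖ ≤ C := by
  rw [fourierCoeff_eq]
  refine (norm_integral_le_of_norm_le_const (C := C) (ae_of_all _ fun θ => ?_)).trans ?_
  · rw [norm_mul, norm_pt_zpow, one_mul]; exact h θ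
  · simp

/-- Cauchy estimates for a holomorphic quadratic differential of bounded hyperbolic norm. -/
lemma norm_taylorCoeff_le {f : ℂ → ℂ} (hf : DifferentiableOn ℂ f disc) {M : ℝ}
    (hM : ∀ z ∈ disc, (1 - ‖z‖ ^ 2) ^ 2 * ‖f z‖ ≤ M) (n : ℕ) :
    ‖taylorCoeff f n‖ ≤ 8 * M * (n + 1) ^ 2 := by
  have hn : (0 : ℝ) ≤ n := n.cast_nonneg
  -- On the circle of radius `r = 1 - y`, the factor `r ^ n` stays above `1 / 2`.
  set y : ℝ := 1 / (2 * (n + 1)) with hy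
  have hy0 : 0 < y := by positivity
  have hy1 : y ≤ 1 / 2 := by
    rw [hy]; apply one_div_le_one_div_of_le <;> linarith
  set r : ℝ := 1 - y with hr
  have hr0 : 0 < r := by linarith
  have hr1 : r < 1 := by linarith
  have hM0 : 0 ≤ M := le_trans (by positivity) (hM 0 (by simp))
  have hpow : 1 / 2 ≤ r ^ n := by
    have h1 := one_add_mul_le_pow (a := -y) (by linarith) n
    rw [← sub_eq_add_neg, ← hr] at h1
    have h2 : n * y ≤ 1 / 2 := by
      rw [hy, mul_one_div, div_le_div_iff₀ (by positivity) (by norm_num)]; linarith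
    linarith
  have hN : y ≤ 1 - r ^ 2 := by nlinarith
  have hb : ∀ θ : S1, ‖f (r * pt θ)‖ ≤ M / y ^ 2 := by
    intro θ
    have h1 := hM _ (mul_pt_mem_disc hr0.le hr1 θ)
    rw [norm_mul, norm_pt, mul_one, norm_real, Real.norm_of_nonneg hr0.le] at h1
    rw [le_div_iff₀ (by positivity), mul_comm]
    refine le_trans ?_ h1
    gcongr
  have h1 := norm_fourierCoeff_le hb n
  rw [fourierCoeff_of_holomorphic hf hr0 hr1, taylorCoeffZ_natCast, norm_mul, zpow_natCast, norm_pow,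
    norm_real, Real.norm_of_nonneg hr0.le] at h1
  have h2 : ‖taylorCoeff f n‖ * (1 / 2) ≤ M / y ^ 2 := le_trans (by gcongr) h1
  have h3 : M / y ^ 2 = 4 * M * (n + 1) ^ 2 := by
    rw [hy]; field_simp; norm_num
  rw [h3] at h2
  linarith

lemma eqOn_of_taylorCoeff {f g : ℂ → ℂ} (hf : DifferentiableOn ℂ f disc)
    (hg : DifferentiableOn ℂ g disc) (h : ∀ n, taylorCoeff f n = taylorCoeff g n) :
    EqOn f g disc := by
  intro z hz
  have h1 := hasSum_taylorCoeff hf hz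
  simp only [h] at h1
  exact h1.unique (hasSum_taylorCoeff hg hz)

/-- A holomorphic quadratic differential of bounded hyperbolic norm is `(L_X g)^{(2,0)}` for the
Poisson integral `X` of a tangential `L²` field. The Fourier coefficients of negative index of the
latter are forced, and the condition to be tangential gives those of index at least `3`. -/
theorem exists_tangential_quadDiff_eq {q : 𝔻 → ℂ} (hq : DifferentiableOn ℂ (zeroExt q) disc) {M : ℝ}
    (hM : ∀ z : 𝔻, (1 - ‖(z : ℂ)‖ ^ 2) ^ 2 * ‖q z‖ ≤ M) :
    ∃ Y : L2S1, IsTangential Y ∧ quadDiff (poissonMap Y) = q := by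
  set f := zeroExt q with hf
  have hM' : ∀ z ∈ disc, (1 - ‖z‖ ^ 2) ^ 2 * ‖f z‖ ≤ M := by
    intro z hz
    have := hM (UnitDisc.mk z (mem_disc.1 hz))
    rwa [← zeroExt_coe q] at this
  -- `b n` is the Fourier coefficient of index `-1 - n` of the field to be found.
  set b : ℕ → ℂ := fun n => conj (taylorCoeff f n / (4 * (n + 1) * (n + 2) * (n + 3))) with hb
  have hbn : ∀ n, ‖b n‖ ≤ 2 * M * (1 / (n + 1 : ℝ)) := by
    intro n
    have hn : (0 : ℝ) ≤ n := n.cast_nonneg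
    have hM0 : 0 ≤ M := le_trans (by positivity) (hM' 0 (by simp))
    have e : ‖(4 * (n + 1) * (n + 2) * (n + 3) : ℂ)‖ = 4 * (n + 1) * (n + 2) * (n + 3) := by
      rw [show (4 * (n + 1) * (n + 2) * (n + 3) : ℂ) =
        ((4 * (n + 1) * (n + 2) * (n + 3) : ℝ) : ℂ) by push_cast; rfl, norm_real,
        Real.norm_of_nonneg (by positivity)]
    rw [hb, norm_conj, norm_div, e, div_le_iff₀ (by positivity)]
    refine (norm_taylorCoeff_le hq hM' n).trans ?_
    rw [mul_one_div, div_mul_eq_mul_div, le_div_iff₀ (by positivity)]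
    have : ((n : ℝ) + 1) ^ 2 ≤ (n + 2) * (n + 3) := by nlinarith
    calc 8 * M * (n + 1) ^ 2 * (n + 1) ≤ 8 * M * ((n + 2) * (n + 3)) * (n + 1) := by gcongr
      _ = 2 * M * (4 * (n + 1) * (n + 2) * (n + 3)) := by ring
  have hbs : Summable fun n => ‖b n‖ ^ 2 := by
    have h1 : Summable fun n : ℕ => (2 * M) ^ 2 * (1 / (n + 1 : ℝ)) ^ 2 := by
      refine Summable.mul_left _ ?_
      have := (summable_nat_add_iff 1).2 (Real.summable_one_div_nat_pow.2 one_lt_two)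
      simpa using this
    refine Summable.of_nonneg_of_le (fun n => by positivity) (fun n => ?_) h1
    rw [← mul_pow]
    gcongr
    exact hbn n
  set a : ℤ → ℂ := fun k => if k < 0 then b (-1 - k).toNat else
    if 3 ≤ k then -conj (b (k - 3).toNat) else 0 with ha
  have has : Summable fun k : ℤ => ‖a k‖ ^ 2 := by
    refine Summable.of_nat_of_neg_add_one ?_ ?_
    · rw [← summable_nat_add_iff 3]
      refine hbs.congr fun n => ?_
      simp only [ha]
      rw [if_neg (by omega), if_pos (by omega), norm_neg,
        show (((n + 3 : ℕ) : ℤ) - 3).toNat = n by push_cast; omega, norm_conj (b n)]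
    · refine hbs.congr fun n => ?_
      simp only [ha]
      rw [if_pos (by omega), show (-1 - -((n : ℤ) + 1)).toNat = n by omega]
  obtain ⟨Y, hY⟩ := exists_L2_of_fourierCoeff has
  refine ⟨Y, ?_, ?_⟩
  · rw [isTangential_iff_fourierCoeff]
    intro n
    rw [hY, hY]
    simp only [ha]
    rcases lt_trichotomy n 0 with h | h | h
    · by_cases h' : n + 2 < 0
      · rw [if_neg (by omega), if_pos (by omega), if_pos h', map_neg, conj_conj]
        congr 3
        omega
      · rw [if_neg (by omega), if_neg (by omega), if_neg h', if_neg (by omega), map_zero, neg_zero]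
    · subst h
      simp
    · rw [if_pos (by omega), if_neg (by omega), if_pos (by omega), neg_neg]
      congr 3
      omega
  · have hp := differentiableOn_potential Y
    have h3 := ((hp.deriv isOpen_disc).deriv isOpen_disc).deriv isOpen_disc
    have key : EqOn (fun z => 8 * deriv (deriv (deriv (potential Y))) z) f disc := by
      refine eqOn_of_taylorCoeff (h3.const_mul 8) hq fun n => ?_
      rw [← taylorCoeffZ_natCast, taylorCoeffZ_const_mul, taylorCoeffZ_natCast, taylorCoeff_deriv,
        taylorCoeff_deriv, taylorCoeff_deriv, ← taylorCoeffZ_natCast, taylorCoeffZ_potential,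
        if_pos (by positivity), hY]
      simp only [ha]
      rw [if_pos (by push_cast; omega), show (-1 - (2 - ((n + 1 + 1 + 1 : ℕ) : ℤ))).toNat = n by
        push_cast; omega, hb]
      dsimp only
      rw [conj_conj]
      have e1 : (n + 1 : ℂ) ≠ 0 := by exact_mod_cast n.succ_ne_zero
      have e2 : (n + 2 : ℂ) ≠ 0 := by exact_mod_cast (n + 1).succ_ne_zero
      have e3 : (n + 3 : ℂ) ≠ 0 := by exact_mod_cast (n + 2).succ_ne_zero
      push_cast
      field_simp
      ring
    ext z
    rw [quadDiff_poissonMap]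
    exact (key (coe_mem_disc z)).trans (by rw [hf, zeroExt_coe])

/-! ### The action on the circle and the equivariance of the Poisson map -/

/-- The mean value property for functions holomorphic in a neighbourhood of the closed disc. -/
lemma integral_pt_of_holomorphic {f : ℂ → ℂ} {R : ℝ} (hR : 1 < R)
    (hf : DifferentiableOn ℂ f (Metric.ball 0 R)) : ∫ θ, f (pt θ) ∂haarS1 = f 0 := by
  have hR0 : 0 < R := one_pos.trans hR
  have hg : DifferentiableOn ℂ (fun z => f (R * z)) disc := by
    refine hf.comp (by fun_prop) fun z hz => ?_
    rw [mem_ball_zero_iff, norm_mul, norm_real, Real.norm_of_nonneg hR0.le]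
    have := mem_disc.1 hz
    nlinarith
  have h := fourierCoeff_of_holomorphic hg (inv_pos.2 hR0) (inv_lt_one_of_one_lt₀ hR) 0
  have e : ∀ θ : S1, (R : ℂ) * (((R⁻¹ : ℝ) : ℂ) * pt θ) = pt θ := by
    intro θ
    rw [ofReal_inv, mul_inv_cancel_left₀ (ofReal_ne_zero.2 hR0.ne')]
  rw [fourierCoeff_eq] at h
  simp only [e, neg_zero, zpow_zero, one_mul, mul_one] at h
  rw [h]
  simp [taylorCoeffZ, taylorCoeff]

lemma exists_ball_autFactor_ne_zero (A : SU11) :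
    ∃ R : ℝ, 1 < R ∧ ∀ z ∈ Metric.ball (0 : ℂ) R, autFactor A z ≠ 0 := by
  have h : IsOpen {z : ℂ | autFactor A z ≠ 0} :=
    isOpen_ne_fun (contDiff_autFactor A).continuous continuous_const
  obtain ⟨ε, hε, hs⟩ := (isCompact_closedBall (0 : ℂ) 1).exists_thickening_subset_open h
    fun z hz => autFactor_ne_zero_of_norm_le_one A (mem_closedBall_zero_iff.1 hz)
  refine ⟨1 + ε, by linarith, fun z hz => hs ?_⟩
  rw [thickening_closedBall hε zero_le_one, add_comm]
  exact hz

lemma autFactor_pt_ne_zero (A : SU11) (θ : S1) : autFactor A (pt θ) ≠ 0 :=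
  autFactor_ne_zero_of_norm_le_one A (norm_pt θ).le

lemma conj_autFactor_pt_ne_zero (A : SU11) (θ : S1) : conj (autFactor A (pt θ)) ≠ 0 :=
  (map_ne_zero _).2 (autFactor_pt_ne_zero A θ)

lemma moebius_pt (A : SU11) (θ : S1) :
    moebius A (pt θ) = pt θ * conj (autFactor A (pt θ)) / autFactor A (pt θ) := by
  rw [moebius, ← autFactor]
  congr 1
  rw [autFactor, map_add, map_mul, conj_conj, conj_conj, ← inv_pt]
  field_simp [pt_ne_zero θ]
  ring

lemma norm_moebius_pt (A : SU11) (θ : S1) : ‖moebius A (pt θ)‖ = 1 := by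
  rw [moebius_pt, norm_div, norm_mul, norm_pt, norm_conj, one_mul,
    div_self (norm_ne_zero_iff.2 (autFactor_pt_ne_zero A θ))]

lemma continuous_autFactor_pt (A : SU11) : Continuous fun θ => autFactor A (pt θ) :=
  (contDiff_autFactor A).continuous.comp continuous_pt

lemma continuous_moebius_pt (A : SU11) : Continuous fun θ => moebius A (pt θ) := by
  unfold moebius
  exact (by have := continuous_pt; fun_prop : Continuous fun θ => A.1 0 0 * pt θ + A.1 0 1).div
    (continuous_autFactor_pt A) (autFactor_pt_ne_zero A)

/-- The action of `SU(1,1)` on the circle `ℝ / 2πℤ`. -/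
def bdryMap (A : SU11) (θ : S1) : S1 :=
  (AddCircle.homeomorphCircle Real.two_pi_pos.ne').symm
    ⟨moebius A (pt θ), mem_sphere_zero_iff_norm.2 (norm_moebius_pt A θ)⟩

lemma pt_bdryMap (A : SU11) (θ : S1) : pt (bdryMap A θ) = moebius A (pt θ) := by
  have h := (AddCircle.homeomorphCircle Real.two_pi_pos.ne').apply_symm_apply
    (⟨moebius A (pt θ), mem_sphere_zero_iff_norm.2 (norm_moebius_pt A θ)⟩ : Circle)
  exact congrArg (fun c : Circle => (c : ℂ)) ((AddCircle.homeomorphCircle_apply _ _).symm.trans h)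

lemma continuous_bdryMap (A : SU11) : Continuous (bdryMap A) :=
  (AddCircle.homeomorphCircle Real.two_pi_pos.ne').symm.continuous.comp
    ((continuous_moebius_pt A).subtype_mk _)

/-- The derivative of `bdryMap A` with respect to the angle. -/
def bdryJac (A : SU11) (θ : S1) : ℝ := (‖autFactor A (pt θ)‖ ^ 2)⁻¹

lemma bdryJac_nonneg (A : SU11) (θ : S1) : 0 ≤ bdryJac A θ := by unfold bdryJac; positivity

lemma coe_bdryJac (A : SU11) (θ : S1) :
    (bdryJac A θ : ℂ) = (autFactor A (pt θ) * conj (autFactor A (pt θ)))⁻¹ := by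
  rw [bdryJac, mul_conj, normSq_eq_norm_sq, ofReal_inv]

lemma continuous_bdryJac (A : SU11) : Continuous (bdryJac A) :=
  ((continuous_autFactor_pt A).norm.pow 2).inv₀
    fun θ => pow_ne_zero 2 (norm_ne_zero_iff.2 (autFactor_pt_ne_zero A θ))

lemma differentiableOn_autFactor (A : SU11) (s : Set ℂ) : DifferentiableOn ℂ (autFactor A) s := by
  unfold autFactor; fun_prop

lemma differentiableOn_moebius (A : SU11) {s : Set ℂ} (hs : ∀ z ∈ s, autFactor A z ≠ 0) :
    DifferentiableOn ℂ (moebius A) s := fun z hz =>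
  (hasDerivAt_moebius A (hs z hz)).differentiableAt.differentiableWithinAt

lemma integral_bdryJac_mul_pow (A : SU11) (n : ℕ) :
    ∫ θ, bdryJac A θ * moebius A (pt θ) ^ (n + 1) ∂haarS1 = 0 := by
  obtain ⟨R, hR, hd⟩ := exists_ball_autFactor_ne_zero A
  -- On the circle, `γ w = w conj d / d` with `d` the automorphy factor, so that the integrand is the
  -- restriction of a holomorphic function which vanishes at `0`.
  have h := integral_pt_of_holomorphic (f := fun z => moebius A z ^ n * z * (autFactor A z ^ 2)⁻¹) hR
    ((((differentiableOn_moebius A hd).pow n).mul differentiableOn_id).mul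
      (((differentiableOn_autFactor A _).pow 2).inv fun z hz => pow_ne_zero 2 (hd z hz)))
  rw [mul_zero, zero_mul] at h
  rw [← h]
  refine integral_congr_ae (ae_of_all _ fun θ => ?_)
  have h1 := autFactor_pt_ne_zero A θ
  have h2 := conj_autFactor_pt_ne_zero A θ
  dsimp only
  rw [coe_bdryJac, pow_succ, moebius_pt]
  field_simp

/-- `|conj b w + conj a|^{-2}` is the real part of a holomorphic function with value `1` at `0`. -/
lemma integral_bdryJac (A : SU11) : ∫ θ, (bdryJac A θ : ℂ) ∂haarS1 = 1 := by
  obtain ⟨R, hR, hd⟩ := exists_ball_autFactor_ne_zero A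
  set H : ℂ → ℂ := fun z => (conj (A.1 0 0) - conj (A.1 0 1) * z) * (autFactor A z)⁻¹ with hH
  have h := integral_pt_of_holomorphic (f := H) hR
    (DifferentiableOn.mul (by fun_prop) ((differentiableOn_autFactor A _).inv hd))
  have h0 : autFactor A 0 ≠ 0 := autFactor_ne_zero_of_norm_le_one A (by simp)
  have hH0 : H 0 = 1 := by
    have e : autFactor A 0 = conj (A.1 0 0) := by simp [autFactor]
    simp only [hH]
    rw [mul_zero, sub_zero, e, mul_inv_cancel₀ (e ▸ h0)]
  have hc : Continuous fun θ => H (pt θ) := by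
    have := continuous_pt
    exact Continuous.mul (by fun_prop) ((continuous_autFactor_pt A).inv₀ (autFactor_pt_ne_zero A))
  have key : ∀ θ, (bdryJac A θ : ℂ) = (1 / 2) * (H (pt θ) + conj (H (pt θ))) := by
    intro θ
    have h1 := autFactor_pt_ne_zero A θ
    have h2 := conj_autFactor_pt_ne_zero A θ
    have h3 := normSq_sub A
    have h4 : A.1 0 0 * conj (A.1 0 0) - A.1 0 1 * conj (A.1 0 1) = 1 := by
      rw [mul_conj, mul_conj]; exact_mod_cast h3
    have h5 : pt θ * conj (pt θ) = 1 := by rw [← inv_pt, mul_inv_cancel₀ (pt_ne_zero θ)]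
    rw [coe_bdryJac]
    simp only [hH, map_mul, map_sub, map_inv₀, conj_conj]
    rw [mul_inv, ← div_eq_mul_inv, ← div_eq_mul_inv, ← div_eq_mul_inv, inv_eq_one_div]
    field_simp
    simp only [autFactor, map_add, map_mul, conj_conj]
    linear_combination (-2) * h4 + 2 * A.1 0 1 * conj (A.1 0 1) * (h5)
  simp only [key]
  rw [integral_const_mul, integral_add (integrable_of_continuous hc)
    (integrable_of_continuous (g := fun θ => conj (H (pt θ))) (continuous_conj.comp hc)), integral_conj, h, hH0]
  norm_num

lemma integral_bdryJac_mul_zpow (A : SU11) (n : ℤ) :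
    ∫ θ, bdryJac A θ * moebius A (pt θ) ^ n ∂haarS1 = if n = 0 then 1 else 0 := by
  rcases lt_trichotomy n 0 with h | h | h
  · obtain ⟨m, rfl⟩ : ∃ m : ℕ, n = -((m + 1 : ℕ) : ℤ) := ⟨(-n - 1).toNat, by omega⟩
    rw [if_neg h.ne]
    have h1 := congrArg conj (integral_bdryJac_mul_pow A m)
    rw [map_zero, ← integral_conj] at h1
    rw [← h1]
    refine integral_congr_ae (ae_of_all _ fun θ => ?_)
    dsimp only
    rw [map_mul, conj_ofReal, map_pow, ← pt_bdryMap, ← inv_pt, zpow_neg, zpow_natCast, inv_pow]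
  · subst h
    simpa using integral_bdryJac A
  · obtain ⟨m, rfl⟩ : ∃ m : ℕ, n = ((m + 1 : ℕ) : ℤ) := ⟨(n - 1).toNat, by omega⟩
    rw [if_neg h.ne']
    simpa only [zpow_natCast] using integral_bdryJac_mul_pow A m

/-- Finite measures on the circle are determined by their Fourier coefficients. -/
lemma measure_ext_of_fourier {μ ν : Measure S1} [IsFiniteMeasure μ] [IsFiniteMeasure ν]
    (h : ∀ n : ℤ, ∫ θ, pt θ ^ n ∂μ = ∫ θ, pt θ ^ n ∂ν) : μ = ν := by
  have hi : ∀ (ρ : Measure S1) [IsFiniteMeasure ρ] (f : C(S1, ℂ)), Integrable f ρ := fun ρ _ f =>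
    f.continuous.integrable_of_hasCompactSupport (HasCompactSupport.of_compactSpace f)
  have hcont : ∀ (ρ : Measure S1) [IsFiniteMeasure ρ],
      Continuous fun f : C(S1, ℂ) => ∫ θ, f θ ∂ρ := by
    intro ρ _
    refine (continuous_integral.comp (ContinuousMap.toLp 1 ρ ℂ).continuous).congr fun f => ?_
    exact integral_congr_ae (ContinuousMap.coeFn_toLp ρ f)
  have hspan : ∀ f ∈ Submodule.span ℂ (range (fourier (T := 2 * π))),
      ∫ θ, f θ ∂μ = ∫ θ, f θ ∂ν := by
    intro f hf
    induction hf using Submodule.span_induction with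
    | mem f hf =>
      obtain ⟨n, rfl⟩ := hf
      simp only [fourier_eq_zpow, h]
    | zero => simp
    | add f g _ _ hf hg =>
      simp only [ContinuousMap.add_apply]
      rw [integral_add (hi μ f) (hi μ g), integral_add (hi ν f) (hi ν g), hf, hg]
    | smul a f _ hf =>
      simp only [ContinuousMap.smul_apply, smul_eq_mul]
      rw [integral_const_mul, integral_const_mul, hf]
  have hall : ∀ f : C(S1, ℂ), ∫ θ, f θ ∂μ = ∫ θ, f θ ∂ν := fun f =>
    congrFun ((hcont μ).ext_on
      (Submodule.dense_iff_topologicalClosure_eq_top.2 span_fourier_closure_eq_top) (hcont ν) hspan) f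
  refine ext_of_forall_integral_eq_of_IsFiniteMeasure fun f => ?_
  have h1 : ∫ θ, ((f θ : ℝ) : ℂ) ∂μ = ∫ θ, ((f θ : ℝ) : ℂ) ∂ν :=
    hall ⟨fun θ => ((f θ : ℝ) : ℂ), by fun_prop⟩
  have h2 : ((∫ θ, f θ ∂μ : ℝ) : ℂ) = ((∫ θ, f θ ∂ν : ℝ) : ℂ) := by
    rw [← integral_complex_ofReal, ← integral_complex_ofReal, h1]
  exact_mod_cast h2

/-- The measure `|conj b w + conj a|^{-2} |dw|`. -/
def jacMeasure (A : SU11) : Measure S1 := haarS1.withDensity fun θ => ENNReal.ofReal (bdryJac A θ)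

instance (A : SU11) : IsFiniteMeasure (jacMeasure A) := by
  refine isFiniteMeasure_withDensity_ofReal ?_
  have : Integrable (bdryJac A) haarS1 :=
    (continuous_bdryJac A).integrable_of_hasCompactSupport (HasCompactSupport.of_compactSpace _)
  exact this.2

lemma integral_jacMeasure (A : SU11) (g : S1 → ℂ) :
    ∫ θ, g θ ∂jacMeasure A = ∫ θ, bdryJac A θ * g θ ∂haarS1 := by
  rw [jacMeasure, integral_withDensity_eq_integral_toReal_smul
    (continuous_bdryJac A).measurable.ennreal_ofReal (ae_of_all _ fun θ => ENNReal.ofReal_lt_top)]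
  refine integral_congr_ae (ae_of_all _ fun θ => ?_)
  simp only [ENNReal.toReal_ofReal (bdryJac_nonneg A θ), real_smul]

/-- The change of variables formula for the action of `SU(1,1)` on the circle. -/
lemma measurePreserving_bdryMap (A : SU11) : MeasurePreserving (bdryMap A) (jacMeasure A) haarS1 := by
  refine ⟨(continuous_bdryMap A).measurable, measure_ext_of_fourier fun n => ?_⟩
  rw [integral_map (continuous_bdryMap A).aemeasurable
    (continuous_pt_zpow n).aestronglyMeasurable, integral_jacMeasure, integral_pt_zpow]
  simp only [pt_bdryMap]
  exact integral_bdryJac_mul_zpow A n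

lemma exists_haarS1_le_smul_jacMeasure (A : SU11) :
    ∃ C : ℝ≥0∞, C ≠ ⊤ ∧ haarS1 ≤ C • jacMeasure A := by
  obtain ⟨C, hC⟩ := isCompact_univ.exists_bound_of_continuousOn
    (continuous_autFactor_pt A).continuousOn
  refine ⟨ENNReal.ofReal (C ^ 2), ENNReal.ofReal_ne_top, ?_⟩
  rw [jacMeasure, ← withDensity_smul _ (continuous_bdryJac A).measurable.ennreal_ofReal]
  conv_lhs => rw [← withDensity_one (μ := haarS1)]
  refine withDensity_mono (ae_of_all _ fun θ => ?_)
  have h1 : 0 < ‖autFactor A (pt θ)‖ := norm_pos_iff.2 (autFactor_pt_ne_zero A θ)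
  have h2 := hC θ (mem_univ θ)
  simp only [Pi.smul_apply, Pi.one_apply, smul_eq_mul]
  rw [← ENNReal.ofReal_mul (by positivity), ← ENNReal.ofReal_one]
  refine ENNReal.ofReal_le_ofReal ?_
  rw [bdryJac, ← div_eq_mul_inv, one_le_div (by positivity)]
  gcongr

lemma memLp_bdryPull (A : SU11) (Y : L2S1) :
    MemLp (fun θ => autFactor A (pt θ) ^ 2 * Y (bdryMap A θ)) 2 haarS1 := by
  obtain ⟨C, hC, hle⟩ := exists_haarS1_le_smul_jacMeasure A
  exact memLp_mul_continuous (((Lp.memLp Y).comp_measurePreserving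
    (measurePreserving_bdryMap A)).of_measure_le_smul hC hle) ((continuous_autFactor_pt A).pow 2)

/-- The action `Y ↦ Y(γ) γ'^{-1}` on `L²` vector fields on the circle. -/
def bdryPull (A : SU11) (Y : L2S1) : L2S1 := (memLp_bdryPull A Y).toLp

lemma coeFn_bdryPull (A : SU11) (Y : L2S1) :
    bdryPull A Y =ᵐ[haarS1] fun θ => autFactor A (pt θ) ^ 2 * Y (bdryMap A θ) :=
  MemLp.coeFn_toLp _

lemma ae_bdryMap (A : SU11) {p : S1 → Prop} (h : ∀ᵐ θ ∂haarS1, p θ) :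
    ∀ᵐ θ ∂haarS1, p (bdryMap A θ) := by
  obtain ⟨C, hC, hle⟩ := exists_haarS1_le_smul_jacMeasure A
  exact (Measure.absolutelyContinuous_of_le_smul hle).ae_le
    ((measurePreserving_bdryMap A).quasiMeasurePreserving.ae h)

/-- `γ'(w)^{-1} i γ(w)` is a real multiple of `i w`. -/
lemma IsTangential.bdryPull (A : SU11) {Y : L2S1} (hY : IsTangential Y) :
    IsTangential (bdryPull A Y) := by
  filter_upwards [coeFn_bdryPull A Y, ae_bdryMap A hY] with θ h ⟨s, hs⟩
  refine ⟨s * ‖autFactor A (pt θ)‖ ^ 2, ?_⟩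
  have h1 := autFactor_pt_ne_zero A θ
  have h2 : ((‖autFactor A (pt θ)‖ ^ 2 : ℝ) : ℂ) = autFactor A (pt θ) * conj (autFactor A (pt θ)) := by
    rw [mul_conj, normSq_eq_norm_sq]
  rw [h, hs, ofReal_mul, h2, pt_bdryMap, moebius_pt]
  field_simp

lemma one_sub_moebius_mul_conj (A : SU11) {z w : ℂ} (hz : autFactor A z ≠ 0)
    (hw : autFactor A w ≠ 0) : 1 - moebius A z * conj (moebius A w) =
      (1 - z * conj w) / (autFactor A z * conj (autFactor A w)) := by
  have hw' : conj (autFactor A w) ≠ 0 := (map_ne_zero _).2 hw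
  have h4 : A.1 0 0 * conj (A.1 0 0) - A.1 0 1 * conj (A.1 0 1) = 1 := by
    rw [mul_conj, mul_conj]; exact_mod_cast normSq_sub A
  rw [moebius, moebius, map_div₀, ← autFactor, ← autFactor]
  field_simp
  simp only [autFactor, map_add, map_mul, conj_conj]
  linear_combination (1 - z * conj w) * h4

/-- The Poisson map for vector fields is equivariant. -/
theorem pull_poissonMap (A : SU11) (Y : L2S1) :
    pull (A : PSU11) (poissonMap Y) = poissonMap (bdryPull A Y) := by
  ext z
  have hz := autFactor_ne_zero A z
  have hz' : conj (autFactor A z) ≠ 0 := (map_ne_zero _).2 hz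
  have hk : Continuous fun θ : S1 => ((1 - ‖moebius A z‖ ^ 2 : ℝ) : ℂ) ^ 3 *
      (((1 - moebius A z * conj (pt θ)))⁻¹ * ((1 - conj (moebius A z) * pt θ)⁻¹) ^ 3) := by
    have hm := mapsTo_moebius A (coe_mem_disc z)
    have h1 := continuous_cauchy_kernel hm 1
    have h3 := continuous_conj.comp (continuous_cauchy_kernel hm 3)
    simp only [pow_one] at h1
    refine continuous_const.mul (h1.mul (h3.congr fun θ => ?_))
    simp
  have hint : ∀ θ : S1, (Y θ / (I * pt θ)) * (pt θ * poissonKernel (moebius A z * (pt θ)⁻¹)) =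
      (((1 - ‖moebius A z‖ ^ 2 : ℝ) : ℂ) ^ 3 *
      (((1 - moebius A z * conj (pt θ)))⁻¹ * ((1 - conj (moebius A z) * pt θ)⁻¹) ^ 3)) * Y θ := by
    intro θ
    rw [poissonMap_integrand _ (mapsTo_moebius A (coe_mem_disc z)), div_eq_mul_inv, mul_inv, inv_pow]
    ring
  rw [pull, derivAct_mk, inv_inv, poissonMap, poissonMap, coe_mk_smul]
  simp only [hint]
  have hmap : ∀ g : S1 → ℂ, AEStronglyMeasurable g haarS1 →
      ∫ θ, g θ ∂haarS1 = ∫ θ, bdryJac A θ * g (bdryMap A θ) ∂haarS1 := by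
    intro g hg
    conv_lhs => rw [← (measurePreserving_bdryMap A).map_eq]
    rw [integral_map (continuous_bdryMap A).aemeasurable, integral_jacMeasure]
    rwa [(measurePreserving_bdryMap A).map_eq]
  rw [hmap, ← integral_mul_const]
  · refine integral_congr_ae ?_
    filter_upwards [coeFn_bdryPull A Y] with θ hθ
    have hw := autFactor_pt_ne_zero A θ
    have hw' := conj_autFactor_pt_ne_zero A θ
    have e1 := one_sub_moebius_mul_conj A hz hw
    have e2 := congrArg conj e1
    have e3 := one_sub_moebius_mul_conj A hz hz
    have hN : ∀ z : ℂ, ((1 - ‖z‖ ^ 2 : ℝ) : ℂ) = 1 - z * conj z := by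
      intro z; rw [mul_conj, normSq_eq_norm_sq]; push_cast; rfl
    simp only [map_sub, map_one, map_mul, conj_conj, map_div₀] at e2
    have n1 := one_sub_mul_conj_ne_zero (coe_mem_disc z) θ
    have n2 : 1 - conj (z : ℂ) * pt θ ≠ 0 := by
      have := (map_ne_zero conj).2 n1
      simpa using this
    rw [poissonMap_integrand _ (coe_mem_disc z), hθ, pt_bdryMap, hN, hN, e1, e2, e3, coe_bdryJac]
    field_simp
  · exact hk.aestronglyMeasurable.mul (Lp.memLp Y).1

/-! ### Discrete cocompact subgroups -/

lemma continuous_entry (i j : Fin 2) : Continuous fun A : SU11 => A.1 i j := by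
  have hc : Continuous fun A : SU11 => (A.1.1 : Matrix (Fin 2) (Fin 2) ℂ) :=
    continuous_subtype_val.comp continuous_subtype_val
  exact (continuous_apply_apply i j).comp hc

lemma norm_entry_le (A : SU11) : ‖A.1 0 1‖ ≤ ‖A.1 0 0‖ := by
  have := normSq_sub A
  rw [normSq_eq_norm_sq, normSq_eq_norm_sq] at this
  exact (pow_le_pow_iff_left₀ (norm_nonneg _) (norm_nonneg _) two_ne_zero).1 (by linarith)

/-- Used for the Hausdorff property of `PSU(1,1)`. -/
instance isClosed_pmOne : IsClosed (pmOne : Set SU11) := by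
  have hc : Continuous fun A : SU11 => (A.1.1 : Matrix (Fin 2) (Fin 2) ℂ) :=
    continuous_subtype_val.comp continuous_subtype_val
  have h : (pmOne : Set SU11) = (fun A : SU11 => (A.1.1 : Matrix (Fin 2) (Fin 2) ℂ)) ⁻¹' {1, -1} := by
    ext A; rfl
  rw [h]
  exact (Set.toFinite _).isClosed.preimage hc

lemma isCompact_norm_entry_le (R : ℝ) : IsCompact {A : SU11 | ‖A.1 0 0‖ ≤ R} := by
  set K : Set (Matrix (Fin 2) (Fin 2) ℂ) :=
    Set.pi univ fun _ => Set.pi univ fun _ => Metric.closedBall 0 R with hK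
  have hKc : IsCompact K :=
    isCompact_univ_pi fun _ => isCompact_univ_pi fun _ => isCompact_closedBall _ _
  have hcl : IsClosed (SU11 : Set (Matrix.SpecialLinearGroup (Fin 2) ℂ)) := by
    have hc : ∀ i j, Continuous fun A : Matrix.SpecialLinearGroup (Fin 2) ℂ => A i j := fun i j =>
      (continuous_apply_apply i j).comp continuous_subtype_val
    exact (isClosed_eq (hc 1 0) (continuous_conj.comp (hc 0 1))).inter
      (isClosed_eq (hc 1 1) (continuous_conj.comp (hc 0 0)))
  have he : IsClosedEmbedding fun A : SU11 => (A.1.1 : Matrix (Fin 2) (Fin 2) ℂ) :=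
    Matrix.SpecialLinearGroup.isClosedEmbedding_val.comp hcl.isClosedEmbedding_subtypeVal
  have h := he.isCompact_preimage hKc
  refine h.of_isClosed_subset (isClosed_le (continuous_entry 0 0).norm continuous_const) ?_
  intro A hA
  have h0 : ‖A.1 0 0‖ ≤ R := hA
  have h1 := (norm_entry_le A).trans h0
  have e1 : A.1.1 1 0 = conj (A.1.1 0 1) := A.2.1
  have e2 : A.1.1 1 1 = conj (A.1.1 0 0) := A.2.2
  have key : ∀ i j, ‖A.1.1 i j‖ ≤ R := by
    intro i j
    fin_cases i <;> fin_cases j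
    · exact h0
    · exact h1
    · change ‖A.1.1 1 0‖ ≤ R
      rw [e1, norm_conj]; exact h1
    · change ‖A.1.1 1 1‖ ≤ R
      rw [e2, norm_conj]; exact h0
  exact fun i _ j _ => mem_closedBall_zero_iff.2 (key i j)

/-- A discrete subgroup has finitely many elements in a bounded part of `PSU(1,1)`. -/
lemma finite_of_norm_entry_le (Γ : Subgroup PSU11) [DiscreteTopology Γ] (R : ℝ) :
    {γ : Γ | ∃ A : SU11, (A : PSU11) = γ ∧ ‖A.1 0 0‖ ≤ R}.Finite := by
  have hK : IsCompact ((QuotientGroup.mk : SU11 → PSU11) '' {A : SU11 | ‖A.1 0 0‖ ≤ R}) :=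
    (isCompact_norm_entry_le R).image continuous_quotient_mk'
  have hc : IsClosed (Γ : Set PSU11) := Subgroup.isClosed_of_discrete
  have h := hc.isClosedEmbedding_subtypeVal.isCompact_preimage hK
  refine (isCompact_iff_finite.1 h).subset ?_
  rintro γ ⟨A, hA, hR⟩
  exact ⟨A, hR, hA⟩

/-- If `Γ` is cocompact, then `Γ` times a bounded set is all of `PSU(1,1)`. -/
lemma exists_norm_entry_le (Γ : Subgroup PSU11) [CompactSpace (PSU11 ⧸ Γ)] :
    ∃ R : ℝ, ∀ g : PSU11, ∃ γ ∈ Γ, ∃ A : SU11, ‖A.1 0 0‖ ≤ R ∧ g = γ * A := by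
  have hopen : ∀ R : ℕ, IsOpen ((QuotientGroup.mk : PSU11 → PSU11 ⧸ Γ) ''
      ((QuotientGroup.mk : SU11 → PSU11) '' {A : SU11 | ‖A.1 0 0‖ < R})) := fun R =>
    QuotientGroup.isOpenMap_coe _ (QuotientGroup.isOpenMap_coe _
      (isOpen_lt (continuous_entry 0 0).norm continuous_const))
  obtain ⟨R, hR⟩ := isCompact_univ.elim_directed_cover _ hopen (by
    intro x _
    obtain ⟨g, rfl⟩ := QuotientGroup.mk_surjective x
    obtain ⟨A, rfl⟩ := QuotientGroup.mk_surjective g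
    obtain ⟨n, hn⟩ := exists_nat_gt ‖A.1 0 0‖
    exact mem_iUnion.2 ⟨n, _, ⟨A, hn, rfl⟩, rfl⟩) (by
    refine directed_of_isDirected_le fun m n hmn => image_mono (image_mono fun A hA => ?_)
    exact lt_of_lt_of_le (mem_ofPred.1 hA) (Nat.cast_le.2 hmn))
  refine ⟨R, fun g => ?_⟩
  obtain ⟨_, ⟨A, hA, rfl⟩, h⟩ := hR (mem_univ ((g⁻¹ : PSU11) : PSU11 ⧸ Γ))
  refine ⟨g * A, ?_, A⁻¹, ?_, ?_⟩
  · have h1 := QuotientGroup.eq.1 h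
    have h2 := Γ.inv_mem h1
    simpa [mul_inv_rev] using h2
  · have e : (A⁻¹).1 0 0 = A.1 1 1 := by
      simp [Matrix.SpecialLinearGroup.coe_inv, Matrix.adjugate_fin_two]
    have e2 : A.1.1 1 1 = conj (A.1.1 0 0) := A.2.2
    rw [e]
    change ‖A.1.1 1 1‖ ≤ R
    rw [e2, norm_conj]
    exact le_of_lt hA
  · rw [QuotientGroup.mk_inv, mul_inv_cancel_right]

lemma norm_autFactor_le (A : SU11) (z : 𝔻) : ‖autFactor A z‖ ≤ 2 * ‖A.1 0 0‖ := by
  have h1 := norm_entry_le A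
  have h2 := z.norm_lt_one
  calc ‖autFactor A z‖ ≤ ‖A.1 0 1‖ * ‖(z : ℂ)‖ + ‖A.1 0 0‖ := by
        refine (norm_add_le _ _).trans ?_
        rw [norm_mul, norm_conj, norm_conj]
    _ ≤ ‖A.1 0 1‖ * 1 + ‖A.1 0 0‖ := by gcongr
    _ ≤ _ := by linarith

lemma le_norm_autFactor (A : SU11) (z : 𝔻) : ‖A.1 0 0‖ * (1 - ‖(z : ℂ)‖) ≤ ‖autFactor A z‖ := by
  have h1 := norm_entry_le A
  have h3 : ‖conj (A.1 0 0)‖ - ‖conj (A.1 0 1) * z‖ ≤ ‖autFactor A z‖ := by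
    rw [autFactor, add_comm]; exact norm_sub_le_norm_add _ _
  rw [norm_mul, norm_conj, norm_conj] at h3
  nlinarith [norm_nonneg (z : ℂ)]

lemma exists_smul_zero (z : 𝔻) : ∃ A : SU11, A • (0 : 𝔻) = z := by
  have h := one_sub_normSq_pos z
  set s : ℝ := Real.sqrt (1 - ‖(z : ℂ)‖ ^ 2) with hs
  have hs0 : (s : ℂ) ≠ 0 := ofReal_ne_zero.2 (Real.sqrt_pos.2 h).ne'
  have hs2 : (s : ℂ) ^ 2 = 1 - z * conj (z : ℂ) := by
    rw [mul_conj, normSq_eq_norm_sq, ← ofReal_pow, hs, Real.sq_sqrt h.le]; push_cast; rfl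
  let M : Matrix.SpecialLinearGroup (Fin 2) ℂ :=
    ⟨!![(s : ℂ)⁻¹, (s : ℂ)⁻¹ * z; (s : ℂ)⁻¹ * conj (z : ℂ), (s : ℂ)⁻¹], by
      rw [Matrix.det_fin_two_of]
      field_simp
      linear_combination -hs2⟩
  refine ⟨⟨M, ?_, ?_⟩, ?_⟩
  · simp [M]
  · simp [M]
  · apply UnitDisc.coe_injective
    rw [coe_smul]
    simp [M]
    field_simp

/-- A discrete group of isometries acts properly discontinuously. -/
lemma finite_of_norm_smul_le (Γ : Subgroup PSU11) [DiscreteTopology Γ] {ρ : ℝ} (hρ : ρ < 1) :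
    {γ : Γ | ∃ z : 𝔻, ‖(z : ℂ)‖ ≤ ρ ∧ ‖(((γ : PSU11) • z : 𝔻) : ℂ)‖ ≤ ρ}.Finite := by
  rcases lt_or_ge ρ 0 with h0 | h0
  · convert Set.finite_empty
    refine Set.eq_empty_of_forall_notMem ?_
    rintro γ ⟨z, hz, -⟩
    linarith [norm_nonneg (z : ℂ)]
  have h1 : 0 < 1 - ρ ^ 2 := by nlinarith
  -- `(1 - ρ^2) ≤ 1 - |A z|^2 = (1 - |z|^2) |d|^{-2}` bounds the automorphy factor `d` at `z`, and
  -- `|d| ≥ |a| (1 - ρ)`.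
  refine (finite_of_norm_entry_le Γ (Real.sqrt (1 / (1 - ρ ^ 2)) / (1 - ρ))).subset ?_
  rintro γ ⟨z, hz, hγ⟩
  obtain ⟨A, hA⟩ := QuotientGroup.mk_surjective (γ : PSU11)
  refine ⟨A, hA, ?_⟩
  rw [← hA, coe_mk_smul] at hγ
  have h2 := one_sub_normSq_moebius A (autFactor_ne_zero A z)
  have hd := norm_pos_iff.2 (autFactor_ne_zero A z)
  rw [norm_inv, norm_pow, ← div_eq_mul_inv] at h2
  have h3 : 1 - ρ ^ 2 ≤ (1 - ‖(z : ℂ)‖ ^ 2) / ‖autFactor A z‖ ^ 2 := by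
    rw [← h2]; gcongr
  have h4 : ‖autFactor A z‖ ^ 2 ≤ 1 / (1 - ρ ^ 2) := by
    rw [le_div_iff₀ h1, mul_comm]
    rw [le_div_iff₀ (by positivity)] at h3
    nlinarith [sq_nonneg ‖(z : ℂ)‖]
  rw [le_div_iff₀ (by linarith)]
  refine le_trans ?_ (Real.le_sqrt_of_sq_le h4)
  refine le_trans ?_ (le_norm_autFactor A z)
  gcongr

/-- A compact disc meets all orbits of a cocompact group. -/
lemma exists_norm_smul_le (Γ : Subgroup PSU11) [CompactSpace (PSU11 ⧸ Γ)] :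
    ∃ ρ : ℝ, 0 ≤ ρ ∧ ρ < 1 ∧ ∀ z : 𝔻, ∃ γ ∈ Γ, ‖((γ • z : 𝔻) : ℂ)‖ ≤ ρ := by
  obtain ⟨R, hR⟩ := exists_norm_entry_le Γ
  set S : ℝ := max R 1 with hS
  have hS1 : 1 ≤ S := le_max_right _ _
  refine ⟨Real.sqrt (1 - (S ^ 2)⁻¹), Real.sqrt_nonneg _, ?_, fun z => ?_⟩
  · rw [Real.sqrt_lt' one_pos]
    have : 0 < (S ^ 2)⁻¹ := by positivity
    linarith
  · obtain ⟨B, rfl⟩ := exists_smul_zero z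
    obtain ⟨γ, hγ, A, hA, h⟩ := hR (B : PSU11)
    refine ⟨γ⁻¹, Γ.inv_mem hγ, ?_⟩
    rw [← mk_smul, ← mul_smul, h, inv_mul_cancel_left, coe_mk_smul]
    refine Real.le_sqrt_of_sq_le ?_
    have h2 := one_sub_normSq_moebius A (autFactor_ne_zero A 0)
    have e : autFactor A ((0 : 𝔻) : ℂ) = conj (A.1 0 0) := by simp [autFactor]
    have h5 : 0 < ‖A.1 0 0‖ := by
      have := norm_pos_iff.2 (autFactor_ne_zero A 0)
      rwa [e, norm_conj] at this
    rw [e, norm_inv, norm_pow, norm_conj] at h2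
    have h4 : (S ^ 2)⁻¹ ≤ (‖A.1 0 0‖ ^ 2)⁻¹ := by
      gcongr
      exact hA.trans (le_max_left _ _)
    simp only [UnitDisc.coe_zero, norm_zero] at h2 ⊢
    linarith

lemma isCompact_norm_le {ρ : ℝ} (hρ : ρ < 1) : IsCompact {z : 𝔻 | ‖(z : ℂ)‖ ≤ ρ} := by
  rw [Complex.UnitDisc.isEmbedding_coe.isCompact_iff]
  convert isCompact_closedBall (0 : ℂ) ρ
  ext z
  simp only [mem_image, mem_ofPred_eq, mem_closedBall_zero_iff]
  constructor
  · rintro ⟨w, hw, rfl⟩; exact hw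
  · intro h; exact ⟨UnitDisc.mk z (h.trans_lt hρ), h, rfl⟩

lemma exists_bound_of_invariant (Γ : Subgroup PSU11) [CompactSpace (PSU11 ⧸ Γ)] {F : 𝔻 → ℝ}
    (hF : Continuous F) (hinv : ∀ γ ∈ Γ, ∀ z, F (γ • z) = F z) : ∃ M, ∀ z, F z ≤ M := by
  obtain ⟨ρ, -, hρ, h⟩ := exists_norm_smul_le Γ
  obtain ⟨M, hM⟩ := (isCompact_norm_le hρ).exists_bound_of_continuousOn hF.continuousOn
  refine ⟨M, fun z => ?_⟩
  obtain ⟨γ, hγ, hz⟩ := h z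
  rw [← hinv γ hγ z]
  exact (le_abs_self _).trans (hM _ hz)

/-- Holomorphic quadratic differentials which are invariant under a cocompact group have bounded
hyperbolic norm. -/
lemma exists_bound_of_mem_HQD (Γ : Subgroup PSU11) [CompactSpace (PSU11 ⧸ Γ)] {q : 𝔻 → ℂ}
    (hq : q ∈ HQD Γ) : ∃ M, ∀ z : 𝔻, (1 - ‖(z : ℂ)‖ ^ 2) ^ 2 * ‖q z‖ ≤ M := by
  refine exists_bound_of_invariant Γ ?_ fun γ hγ z => ?_
  · have := continuous_of_contDiffOn hq.1.continuousOn
    have h2 : Continuous ((↑) : 𝔻 → ℂ) := UnitDisc.continuous_coe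
    fun_prop
  · rw [one_sub_normSq_smul, ← hq.2 γ hγ z, norm_mul, norm_pow]
    ring

/-- Vector fields which are invariant under a cocompact group have bounded hyperbolic norm. -/
lemma exists_bound_of_delta_eq_zero (Γ : Subgroup PSU11) [CompactSpace (PSU11 ⧸ Γ)] {X : 𝔻 → ℂ}
    (hX : Continuous X) (h : ∀ γ ∈ Γ, pull γ X = X) :
    ∃ M, ∀ z : 𝔻, ‖X z‖ ≤ M * (1 - ‖(z : ℂ)‖ ^ 2) := by
  obtain ⟨M, hM⟩ := exists_bound_of_invariant Γ (F := fun z => ‖X z‖ / (1 - ‖(z : ℂ)‖ ^ 2))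
    (by
      have h2 : Continuous ((↑) : 𝔻 → ℂ) := UnitDisc.continuous_coe
      exact hX.norm.div (by fun_prop) fun z => (one_sub_normSq_pos z).ne') (by
      intro γ hγ z
      have h1 := congrFun (h γ hγ) z
      have h3 := one_sub_normSq_pos z
      have h4 := norm_pos_iff.2 (derivAct_ne_zero γ z)
      rw [pull] at h1
      rw [one_sub_normSq_smul, ← h1, norm_mul, norm_inv]
      field_simp)
  exact ⟨M, fun z => (div_le_iff₀ (one_sub_normSq_pos z)).1 (hM z)⟩

/-! ### Smooth vector fields with a prescribed coboundary -/

lemma IsSmooth.mul {X Y : 𝔻 → ℂ} (hX : IsSmooth X) (hY : IsSmooth Y) :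
    IsSmooth fun z => X z * Y z := by
  have h : zeroExt (fun z => X z * Y z) = fun z => zeroExt X z * zeroExt Y z := by
    ext z; by_cases h : ‖z‖ < 1 <;> simp [zeroExt, h]
  rw [IsSmooth, h]
  exact ContDiffOn.mul hX hY

lemma IsSmooth.inv {X : 𝔻 → ℂ} (hX : IsSmooth X) (h0 : ∀ z, X z ≠ 0) :
    IsSmooth fun z => (X z)⁻¹ := by
  have h : zeroExt (fun z => (X z)⁻¹) = fun z => (zeroExt X z)⁻¹ := by
    ext z; by_cases h : ‖z‖ < 1 <;> simp [zeroExt, h]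
  rw [IsSmooth, h]
  refine ContDiffOn.inv hX fun z hz => ?_
  rw [← UnitDisc.coe_mk z (mem_disc.1 hz), zeroExt_coe]
  exact h0 _

/-- Locally finite sums of smooth functions are smooth. -/
lemma isSmooth_tsum {ι : Type*} {F : ι → 𝔻 → ℂ} (hF : ∀ i, IsSmooth (F i))
    (hfin : ∀ ρ : ℝ, ρ < 1 → {i | ∃ z : 𝔻, ‖(z : ℂ)‖ ≤ ρ ∧ F i z ≠ 0}.Finite) :
    IsSmooth fun z => ∑' i, F i z := by
  refine contDiffOn_of_locally_contDiffOn fun z hz => ?_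
  obtain ⟨ρ, hzρ, hρ⟩ := exists_between (mem_disc.1 hz)
  refine ⟨Metric.ball 0 ρ, Metric.isOpen_ball, mem_ball_zero_iff.2 hzρ, ?_⟩
  have h1 : ContDiffOn ℝ ∞ (fun w => ∑ i ∈ (hfin ρ hρ).toFinset, zeroExt (F i) w)
      (Metric.ball 0 1 ∩ Metric.ball 0 ρ) :=
    ContDiffOn.sum fun i _ => (ContDiffOn.mono (hF i) inter_subset_left)
  refine h1.congr fun w hw => ?_
  have hw1 : ‖w‖ < 1 := mem_ball_zero_iff.1 hw.1
  have hw2 : ‖w‖ < ρ := mem_ball_zero_iff.1 hw.2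
  simp only [zeroExt, hw1, dif_pos]
  refine tsum_eq_sum fun i hi => ?_
  by_contra h
  exact hi ((hfin ρ hρ).mem_toFinset.2 ⟨UnitDisc.mk w hw1, hw2.le, h⟩)

/-- Every cocycle is the coboundary of a smooth vector field. With a nonnegative cutoff `η` whose
translates have a positive sum, the field is the average of `-c_γ` with weights `η(γ z)`. -/
theorem exists_isSmooth_delta_eq (Γ : Subgroup PSU11) [DiscreteTopology Γ]
    [CompactSpace (PSU11 ⧸ Γ)] {c : Γ → 𝔻 → ℂ} (hc : c ∈ Z1 Γ) :
    ∃ ψ : 𝔻 → ℂ, IsSmooth ψ ∧ delta Γ ψ = c := by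
  obtain ⟨ρ₀, hρ₀, hρ₀', hcov⟩ := exists_norm_smul_le Γ
  obtain ⟨ρ, hρρ, hρ⟩ := exists_between hρ₀'
  set bump : ℂ → ℝ := fun z => Real.smoothTransition (ρ ^ 2 - ‖z‖ ^ 2) with hbump
  have hbs : ContDiff ℝ ∞ fun z => (bump z : ℂ) := by
    have h1 : ContDiff ℝ ∞ fun z : ℂ => ρ ^ 2 - ‖z‖ ^ 2 := contDiff_const.sub (contDiff_id.norm_sq ℝ)
    exact ofRealCLM.contDiff.comp (Real.smoothTransition.contDiff.comp h1)
  have hb0 : ∀ z, bump z ≠ 0 → ‖z‖ ≤ ρ := by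
    intro z hz
    by_contra! h
    exact hz (Real.smoothTransition.zero_of_nonpos (by nlinarith [norm_nonneg z]))
  set η : Γ → 𝔻 → ℝ := fun γ z => bump (((γ : PSU11) • z : 𝔻) : ℂ) with hη
  have hηs : ∀ γ, IsSmooth fun z => (η γ z : ℂ) := by
    intro γ
    obtain ⟨A, hA⟩ := QuotientGroup.mk_surjective (γ : PSU11)
    refine isSmooth_of_eq (F := fun z => (bump (moebius A z) : ℂ)) (fun z => ?_)
      (hbs.comp_contDiffOn (contDiffOn_moebius A))
    simp only [hη]
    rw [← hA, coe_mk_smul]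
  have hfin : ∀ r : ℝ, r < 1 → {γ : Γ | ∃ z : 𝔻, ‖(z : ℂ)‖ ≤ r ∧ η γ z ≠ 0}.Finite := by
    intro r hr
    refine (finite_of_norm_smul_le Γ (max_lt hr hρ)).subset ?_
    rintro γ ⟨z, hz, h⟩
    exact ⟨z, hz.trans (le_max_left _ _), (hb0 _ h).trans (le_max_right _ _)⟩
  have hfin' : ∀ f : Γ → 𝔻 → ℂ, ∀ r : ℝ, r < 1 →
      {γ : Γ | ∃ z : 𝔻, ‖(z : ℂ)‖ ≤ r ∧ (η γ z : ℂ) * f γ z ≠ 0}.Finite := by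
    intro f r hr
    refine (hfin r hr).subset ?_
    rintro γ ⟨z, hz, h⟩
    exact ⟨z, hz, ofReal_ne_zero.1 (left_ne_zero_of_mul h)⟩
  have hsupp : ∀ f : Γ → 𝔻 → ℂ, ∀ z, Summable fun γ => (η γ z : ℂ) * f γ z := by
    intro f z
    refine summable_of_hasFiniteSupport ((hfin' f _ z.norm_lt_one).subset fun γ h => ?_)
    exact ⟨z, le_rfl, h⟩
  have hsupp1 : ∀ z, Summable fun γ => (η γ z : ℂ) := by
    intro z; simpa using hsupp (fun _ _ => 1) z
  set S : 𝔻 → ℂ := fun z => ∑' γ, (η γ z : ℂ) with hS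
  set T : 𝔻 → ℂ := fun z => ∑' γ, (η γ z : ℂ) * c γ z with hT
  have hSs : IsSmooth S := isSmooth_tsum hηs fun r hr => by simpa using hfin r hr
  have hTs : IsSmooth T := isSmooth_tsum (fun γ => (hηs γ).mul (hc.1 γ).1) (hfin' c)
  have hS0 : ∀ z, S z ≠ 0 := by
    intro z
    obtain ⟨γ, hγ, hz⟩ := hcov z
    have h1 : Summable fun γ => η γ z := by
      have := hsupp1 z
      exact_mod_cast this
    have h2 : 0 < ∑' γ, η γ z := by
      refine h1.tsum_pos (fun γ => Real.smoothTransition.nonneg _) ⟨γ, hγ⟩ ?_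
      refine Real.smoothTransition.pos_of_pos ?_
      have := norm_nonneg ((γ • z : 𝔻) : ℂ)
      change 0 < ρ ^ 2 - ‖((γ • z : 𝔻) : ℂ)‖ ^ 2
      nlinarith
    simp only [hS]
    rw [← ofReal_tsum]
    exact ofReal_ne_zero.2 h2.ne'
  have hηmul : ∀ (γ h : Γ) z, η γ ((h : PSU11) • z) = η (γ * h) z := by
    intro γ h z
    simp only [hη, Subgroup.coe_mul, mul_smul]
  refine ⟨fun z => (-1 : ℝ) • T z * (S z)⁻¹, (hTs.smul (-1)).mul (hSs.inv hS0), ?_⟩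
  funext h
  ext z
  have hSh : S ((h : PSU11) • z) = S z := by
    simp only [hS, hηmul]
    exact (Equiv.mulRight h).tsum_eq fun γ => (η γ z : ℂ)
  have hTh : T ((h : PSU11) • z) * (derivAct h z)⁻¹ = T z - S z * c h z := by
    have h1 : ∀ γ, (η γ ((h : PSU11) • z) : ℂ) * c γ ((h : PSU11) • z) * (derivAct h z)⁻¹ =
        (η (γ * h) z : ℂ) * c (γ * h) z - (η (γ * h) z : ℂ) * c h z := by
      intro γ
      rw [hηmul, hc.2 γ h, Pi.add_apply, pull]
      ring
    simp only [hT]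
    rw [← tsum_mul_right]
    simp only [h1]
    have h2 := (Equiv.mulRight h).tsum_eq fun γ => (η γ z : ℂ) * c γ z - (η γ z : ℂ) * c h z
    refine Eq.trans h2 ?_
    rw [(hsupp c z).tsum_sub ((hsupp1 z).mul_right _), tsum_mul_right]
  simp only [delta, Pi.sub_apply, pull, hSh, real_smul]
  have := hS0 z
  rw [mul_right_comm, mul_assoc _ (T _), hTh]
  field_simp
  push_cast
  ring

/-! ### Vector fields which are uniformly close to Killing fields -/

/-- `PSU(1,1)` acts on the Killing fields (the adjoint representation). -/
lemma pull_mem_killing (g : PSU11) {X : 𝔻 → ℂ} (hX : X ∈ killing) : pull g X ∈ killing := by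
  obtain ⟨A, rfl⟩ := QuotientGroup.mk_surjective g
  obtain ⟨β, s, h⟩ := mem_killing_iff.1 hX
  set a := A.1 0 0 with ha
  set b := A.1 0 1 with hb
  refine mem_killing_iff.2 ⟨β * conj a ^ 2 + I * s * b * conj a - conj β * b ^ 2,
    s * (normSq a + normSq b) + 4 * (β * conj a * conj b).im, fun z => ?_⟩
  have hz := autFactor_ne_zero A z
  have him : (2 * I * (β * conj a * conj b).im : ℂ) = β * conj a * conj b - conj β * a * b := by
    have := sub_conj (β * conj a * conj b)
    simp only [map_mul, conj_conj] at this
    rw [this]; push_cast; ring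
  rw [pull_mk, ← coe_mk_smul, zeroExt_coe, h, coe_mk_smul, killingField, killingField, moebius,
    ← autFactor]
  have e : (β + I * s * ((a * z + b) / autFactor A z) - conj β * ((a * z + b) / autFactor A z) ^ 2) *
      autFactor A z ^ 2 = β * autFactor A z ^ 2 + I * s * (a * z + b) * autFactor A z -
        conj β * (a * z + b) ^ 2 := by field_simp
  rw [e, autFactor, ← ha, ← hb]
  simp only [ofReal_add, ofReal_mul, map_add, map_sub, map_mul, map_pow, conj_conj, conj_I,
    conj_ofReal, ofReal_ofNat, ← mul_conj]
  linear_combination (-2 * (z : ℂ)) * him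

/-- A smooth vector field with coboundary in `𝔤` for a cocompact group is, in all Möbius charts,
within a uniform distance of a Killing field. -/
lemma exists_killing_approx (Γ : Subgroup PSU11) [CompactSpace (PSU11 ⧸ Γ)] {ψ : 𝔻 → ℂ}
    (hψ : IsSmooth ψ) (h : ∀ γ : Γ, delta Γ ψ γ ∈ killing) :
    ∃ M : ℝ, 0 ≤ M ∧ ∀ g : PSU11, ∃ κ ∈ killing, ∀ z : 𝔻, ‖(z : ℂ)‖ ≤ 3 / 4 →
      ‖pull g ψ z - κ z‖ ≤ M := by
  obtain ⟨R, hR⟩ := exists_norm_entry_le Γ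
  set S := max R 1 with hS
  have hS1 : 1 ≤ S := le_max_right _ _
  have hρ : Real.sqrt (1 - 1 / (16 * S ^ 2)) < 1 := by
    rw [Real.sqrt_lt' one_pos]
    have : 0 < 1 / (16 * S ^ 2) := by positivity
    linarith
  obtain ⟨C, hC⟩ := (isCompact_norm_le hρ).exists_bound_of_continuousOn hψ.continuous.continuousOn
  refine ⟨max C 0 * (2 * S) ^ 2, by positivity, fun g => ?_⟩
  obtain ⟨γ, hγ, A, hA, rfl⟩ := hR g
  refine ⟨pull (A : PSU11) (delta Γ ψ ⟨γ, hγ⟩), pull_mem_killing _ (h _), fun z hz => ?_⟩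
  have e : pull (γ * (A : PSU11)) ψ z - pull (A : PSU11) (delta Γ ψ ⟨γ, hγ⟩) z =
      pull (A : PSU11) ψ z := by
    rw [pull_mul, delta, pull_sub, Pi.sub_apply]; ring
  have hAS : ‖A.1 0 0‖ ≤ S := hA.trans (le_max_left _ _)
  have hd : ‖autFactor A z‖ ≤ 2 * S := (norm_autFactor_le A z).trans (by linarith)
  have hd0 := norm_pos_iff.2 (autFactor_ne_zero A z)
  rw [e, pull, derivAct_mk, inv_inv, norm_mul, norm_pow]
  have h1 : ‖ψ ((A : PSU11) • z)‖ ≤ C := by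
    refine hC _ (Real.le_sqrt_of_sq_le ?_)
    have h2 := one_sub_normSq_moebius A (autFactor_ne_zero A z)
    rw [norm_inv, norm_pow, ← div_eq_mul_inv] at h2
    have h3 : 1 / (16 * S ^ 2) ≤ (1 - ‖(z : ℂ)‖ ^ 2) / ‖autFactor A z‖ ^ 2 := by
      rw [div_le_div_iff₀ (by positivity) (by positivity)]
      have h4 : ‖autFactor A z‖ ^ 2 ≤ (2 * S) ^ 2 := by gcongr
      have h5 : ‖(z : ℂ)‖ ^ 2 ≤ (3 / 4) ^ 2 := by gcongr
      nlinarith [sq_nonneg S]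
    rw [coe_mk_smul]
    linarith
  exact mul_le_mul (h1.trans (le_max_left _ _)) (by gcongr) (by positivity) (by positivity)

/-- The restriction of a Killing field to a radius, in the coordinates given by the eigenvectors of
the transvections along this radius. -/
def radialField (P U V y : ℝ) : ℂ :=
  (((1 - y ^ 2) * P : ℝ) : ℂ) + (((1 - y) ^ 2 * U + (1 + y) ^ 2 * V : ℝ) : ℂ) * I

lemma radialField_re (P U V y : ℝ) : (radialField P U V y).re = (1 - y ^ 2) * P := by
  simp only [radialField, add_re, re_ofReal_mul, ofReal_re, I_re, mul_zero, add_zero]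

lemma radialField_im (P U V y : ℝ) :
    (radialField P U V y).im = (1 - y) ^ 2 * U + (1 + y) ^ 2 * V := by
  simp only [radialField, add_im, im_ofReal_mul, ofReal_im, I_im, mul_one, zero_add]

lemma killingField_eq_radialField (β : ℂ) (s : ℝ) {t y : ℝ} (ht : 0 ≤ t) (ht1 : t < 1)
    (hty : t * y < 1) :
    killingField β s ((y - t) / (1 - t * y) : ℝ) * (((1 - t * y) ^ 2 / (1 - t ^ 2) : ℝ) : ℂ) =
      radialField β.re ((β.im / 2 - s / 4) * ((1 + t) / (1 - t)))
        ((β.im / 2 + s / 4) * ((1 - t) / (1 + t))) y := by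
  have h1 : 1 - t ≠ 0 := by linarith
  have h2 : 1 + t ≠ 0 := by linarith
  have h3 : 1 - t * y ≠ 0 := by linarith
  have h4 : 1 - t ^ 2 ≠ 0 := by
    rw [show 1 - t ^ 2 = (1 - t) * (1 + t) by ring]; exact mul_ne_zero h1 h2
  have key : ∀ w : ℝ, killingField β s w =
      ((β.re * (1 - w ^ 2) : ℝ) : ℂ) + ((β.im * (1 + w ^ 2) + s * w : ℝ) : ℂ) * I := by
    intro w
    rw [killingField]
    conv_lhs => rw [← re_add_im β]
    simp only [map_add, map_mul, conj_ofReal, conj_I]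
    push_cast
    ring
  rw [key]
  apply Complex.ext
  · rw [radialField_re, mul_comm, re_ofReal_mul]
    simp only [add_re, re_ofReal_mul, ofReal_re, I_re, mul_zero, add_zero]
    field_simp
    ring
  · rw [radialField_im, mul_comm, im_ofReal_mul]
    simp only [add_im, im_ofReal_mul, ofReal_im, I_im, mul_one, zero_add]
    field_simp
    ring

/-- The rotation `z ↦ η ^ 2 * z` after the transvection `z ↦ (z + t) / (1 + t * z)`. -/
def transvection {η : ℂ} (hη : ‖η‖ = 1) {t : ℝ} (ht : t ^ 2 < 1) : SU11 :=
  ⟨⟨!![η / Real.sqrt (1 - t ^ 2), η * t / Real.sqrt (1 - t ^ 2);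
      conj η * t / Real.sqrt (1 - t ^ 2), conj η / Real.sqrt (1 - t ^ 2)], by
    have h1 : ((Real.sqrt (1 - t ^ 2) : ℝ) : ℂ) ^ 2 = 1 - (t : ℂ) ^ 2 := by
      rw [← ofReal_pow, Real.sq_sqrt (by linarith)]; push_cast; rfl
    have h2 : ((Real.sqrt (1 - t ^ 2) : ℝ) : ℂ) ≠ 0 :=
      ofReal_ne_zero.2 (Real.sqrt_pos.2 (by linarith)).ne'
    have h3 : η * conj η = 1 := by rw [mul_conj, normSq_eq_norm_sq, hη]; simp
    rw [Matrix.det_fin_two_of]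
    field_simp
    linear_combination (1 - (t : ℂ) ^ 2) * h3 - h1⟩, by
    constructor <;> simp⟩

lemma autFactor_transvection {η : ℂ} (hη : ‖η‖ = 1) {t : ℝ} (ht : t ^ 2 < 1) (w : ℂ) :
    autFactor (transvection hη ht) w = conj η * (1 + t * w) / Real.sqrt (1 - t ^ 2) := by
  simp [autFactor, transvection]; ring

lemma moebius_transvection {η : ℂ} (hη : ‖η‖ = 1) {t : ℝ} (ht : t ^ 2 < 1) (w : ℂ) :
    moebius (transvection hη ht) w = η ^ 2 * ((w + t) / (1 + t * w)) := by
  have h2 : ((Real.sqrt (1 - t ^ 2) : ℝ) : ℂ) ≠ 0 :=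
    ofReal_ne_zero.2 (Real.sqrt_pos.2 (by linarith)).ne'
  have h3 : η * conj η = 1 := by rw [mul_conj, normSq_eq_norm_sq, hη]; simp
  have h4 : conj η ≠ 0 := right_ne_zero_of_mul (h3.trans_ne one_ne_zero)
  have e : (transvection hη ht).1 0 0 * w + (transvection hη ht).1 0 1 =
      η * (w + t) / Real.sqrt (1 - t ^ 2) := by
    simp [transvection]; ring
  rw [moebius, ← autFactor, autFactor_transvection, e, div_div_div_cancel_right₀ h2,
    mul_div_mul_comm]
  congr 1
  rw [div_eq_iff h4]
  linear_combination (-η) * h3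

/-- On each radius, such a vector field is approximated by Killing fields with an error bounded by
the distance to the boundary. -/
lemma exists_radialField_approx (Γ : Subgroup PSU11) [CompactSpace (PSU11 ⧸ Γ)] {ψ : 𝔻 → ℂ}
    (hψ : IsSmooth ψ) (h : ∀ γ : Γ, delta Γ ψ γ ∈ killing) :
    ∃ M : ℝ, 0 ≤ M ∧ ∀ (θ : S1) (t : ℝ), 0 ≤ t → t < 1 → ∃ P U V : ℝ,
      ∀ y, t ≤ y → y ≤ 1 - (1 - t) / 4 →
        ‖conj (pt θ) * zeroExt ψ (y * pt θ) - radialField P U V y‖ ≤ M * (1 - t) := by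
  obtain ⟨M, hM0, hM⟩ := exists_killing_approx Γ hψ h
  refine ⟨2 * M, by positivity, fun θ t ht ht1 => ?_⟩
  obtain ⟨η, hη⟩ := IsAlgClosed.exists_pow_nat_eq (pt θ) (n := 2) two_pos
  have hη1 : ‖η‖ = 1 := by
    have := congrArg norm hη
    rw [norm_pow, norm_pt] at this
    exact (pow_eq_one_iff_of_nonneg (norm_nonneg _) two_ne_zero).1 this
  have ht2 : t ^ 2 < 1 := by nlinarith
  obtain ⟨κ, hκ, hb⟩ := hM (transvection hη1 ht2 : SU11)
  obtain ⟨β, s, hκ⟩ := mem_killing_iff.1 hκ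
  refine ⟨β.re, (β.im / 2 - s / 4) * ((1 + t) / (1 - t)),
    (β.im / 2 + s / 4) * ((1 - t) / (1 + t)), fun y hty hy => ?_⟩
  have hy1 : y < 1 := by linarith
  have hty1 : t * y < 1 := by nlinarith
  rw [← killingField_eq_radialField β s ht ht1 hty1]
  -- The point of the chart centred at `t` which corresponds to `y`.
  set w : ℝ := (y - t) / (1 - t * y) with hw
  have h1ty : 0 < 1 - t * y := by linarith
  have hw0 : 0 ≤ w := div_nonneg (by linarith) h1ty.le
  have hw1 : w ≤ 3 / 4 := by
    rw [hw, div_le_iff₀ h1ty]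
    nlinarith
  have hwn : ‖(w : ℂ)‖ ≤ 3 / 4 := by rwa [norm_real, Real.norm_of_nonneg hw0]
  have hwd : ‖(w : ℂ)‖ < 1 := hwn.trans_lt (by norm_num)
  have hb' := hb (UnitDisc.mk w hwd) hwn
  rw [pull_mk, hκ, UnitDisc.coe_mk, moebius_transvection, autFactor_transvection, hη] at hb'
  have e0 : 1 + t * w = (1 - t ^ 2) / (1 - t * y) := by
    rw [hw]; field_simp; ring
  have hne : 1 - t * y ≠ 0 := h1ty.ne'
  have e1 : (((w : ℝ) : ℂ) + t) / (1 + t * w) = y := by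
    have : (w + t) / (1 + t * w) = y := by
      have hwm : w * (1 - t * y) = y - t := div_mul_cancel₀ _ hne
      rw [e0, div_eq_iff (by apply ne_of_gt; apply div_pos <;> linarith), eq_comm, mul_div_assoc',
        div_eq_iff hne]
      linear_combination -hwm
    exact_mod_cast this
  have e2 : (conj η * (1 + (t : ℂ) * w) / Real.sqrt (1 - t ^ 2)) ^ 2 =
      conj (pt θ) * (((1 - t ^ 2) / (1 - t * y) ^ 2 : ℝ) : ℂ) := by
    have h5 : (1 + (t : ℂ) * w) = (((1 - t ^ 2) / (1 - t * y) : ℝ) : ℂ) := by exact_mod_cast e0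
    rw [div_pow, mul_pow, ← map_pow, hη, h5, mul_div_assoc, ← ofReal_pow, ← ofReal_pow,
      ← ofReal_div, Real.sq_sqrt (by linarith)]
    congr 2
    have : 1 - t ^ 2 ≠ 0 := by linarith
    field_simp
  rw [e1, e2, mul_comm (pt θ)] at hb'
  set D : ℝ := (1 - t * y) ^ 2 / (1 - t ^ 2) with hD
  have h1t : 0 < 1 - t ^ 2 := by linarith
  have hD0 : 0 ≤ D := by positivity
  have hD1 : D ≤ 2 * (1 - t) := by
    rw [hD, div_le_iff₀ h1t]
    have h6 : 1 - t * y ≤ 1 - t ^ 2 := by nlinarith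
    have h7 : (1 - t * y) ^ 2 ≤ (1 - t ^ 2) ^ 2 := by gcongr
    nlinarith
  have e3 : conj (pt θ) * zeroExt ψ (y * pt θ) - killingField β s w * (D : ℂ) =
      (zeroExt ψ (y * pt θ) * (conj (pt θ) * (((1 - t ^ 2) / (1 - t * y) ^ 2 : ℝ) : ℂ)) -
        killingField β s w) * (D : ℂ) := by
    have : (((1 - t ^ 2) / (1 - t * y) ^ 2 : ℝ) : ℂ) * (D : ℂ) = 1 := by
      rw [← ofReal_mul, hD, div_mul_div_comm, mul_comm, div_self (by positivity), ofReal_one]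
    linear_combination (-(zeroExt ψ (y * pt θ) * conj (pt θ))) * this
  rw [e3, norm_mul, norm_real, Real.norm_of_nonneg hD0]
  calc _ ≤ M * (2 * (1 - t)) := mul_le_mul hb' hD1 hD0 hM0
    _ = _ := by ring

/-- If two radial fields are close at two points at distance of order `ε` from the boundary, then
their coordinates are close, each at its own scale. -/
lemma radialField_increment {P U V P' U' V' M ε : ℝ} (hM : 0 ≤ M) (hε0 : 0 < ε) (hε1 : ε ≤ 1 / 2)
    (hd : ∀ y, 1 - ε ≤ y → y ≤ 1 - ε / 2 →
      ‖radialField P' U' V' y - radialField P U V y‖ ≤ 3 * M * ε) :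
    |P' - P| ≤ 4 * M ∧ |U' - U| ≤ 12 * M / ε ∧ |V' - V| ≤ 3 / 2 * (M * ε) := by
  have hre := fun y hy hy' => (abs_re_le_norm _).trans (hd y hy hy')
  have him := fun y hy hy' => (abs_im_le_norm _).trans (hd y hy hy')
  simp only [sub_re, sub_im, radialField_re, radialField_im] at hre him
  have r1 := hre (1 - ε) le_rfl (by linarith)
  have i1 := him (1 - ε) le_rfl (by linarith)
  have i2 := abs_le.1 (him (1 - ε / 2) (by linarith) le_rfl)
  have hMε : 0 ≤ M * ε := by positivity
  have hV : |V' - V| ≤ 3 / 2 * (M * ε) := by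
    -- This combination of the conditions at the two points eliminates `U' - U`.
    have e : (12 - 4 * ε) * (V' - V) =
      4 * (((1 - (1 - ε / 2)) ^ 2 * U' + (1 + (1 - ε / 2)) ^ 2 * V') -
        ((1 - (1 - ε / 2)) ^ 2 * U + (1 + (1 - ε / 2)) ^ 2 * V)) -
      (((1 - (1 - ε)) ^ 2 * U' + (1 + (1 - ε)) ^ 2 * V') -
        ((1 - (1 - ε)) ^ 2 * U + (1 + (1 - ε)) ^ 2 * V)) := by ring
    have i1' := abs_le.1 i1
    have e2 : |(12 - 4 * ε) * (V' - V)| ≤ 15 * (M * ε) := by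
      rw [e]; exact abs_le.2 ⟨by linarith, by linarith⟩
    rw [abs_mul, abs_of_pos (by linarith)] at e2
    have e3 : 10 * |V' - V| ≤ (12 - 4 * ε) * |V' - V| := by gcongr; linarith
    linarith
  refine ⟨?_, ?_, hV⟩
  · rw [show (1 - (1 - ε) ^ 2) * P' - (1 - (1 - ε) ^ 2) * P = (2 - ε) * ε * (P' - P) by ring,
      abs_mul, abs_mul, abs_of_pos hε0, abs_of_pos (by linarith)] at r1
    have e3 : (2 - ε) * |P' - P| ≤ 3 * M := by
      refine le_of_mul_le_mul_right ?_ hε0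
      linarith
    have e4 : 3 / 2 * |P' - P| ≤ (2 - ε) * |P' - P| := by gcongr; linarith
    linarith
  · have e1 : ε ^ 2 * (U' - U) = (((1 - (1 - ε)) ^ 2 * U' + (1 + (1 - ε)) ^ 2 * V') -
        ((1 - (1 - ε)) ^ 2 * U + (1 + (1 - ε)) ^ 2 * V)) - (2 - ε) ^ 2 * (V' - V) := by ring
    have e4 : |(2 - ε) ^ 2 * (V' - V)| ≤ 6 * (M * ε) := by
      rw [abs_mul, abs_of_nonneg (sq_nonneg _)]
      calc (2 - ε) ^ 2 * |V' - V| ≤ 4 * (3 / 2 * (M * ε)) :=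
            mul_le_mul (by nlinarith) hV (abs_nonneg _) (by norm_num)
        _ = _ := by ring
    have e2 : |ε ^ 2 * (U' - U)| ≤ 9 * (M * ε) := by
      rw [e1]
      refine (abs_sub _ _).trans ?_
      linarith
    rw [abs_mul, abs_of_pos (by positivity)] at e2
    have e3 : ε * |U' - U| ≤ 9 * M := by
      refine le_of_mul_le_mul_right ?_ hε0
      linarith
    rw [le_div_iff₀ hε0]
    linarith

/-- A radial field is close to its value at the end point of the radius. -/
lemma norm_sub_end_le {z : ℂ} {P U W V M ε y N : ℝ} (_hM : 0 ≤ M) (_hN : 0 ≤ N) (hε0 : 0 < ε)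
    (hε1 : ε ≤ 1) (hy : 1 - ε ≤ y) (hy1 : y ≤ 1) (hz : ‖z - radialField P U W y‖ ≤ M * ε)
    (hP : |P| ≤ 4 * M * N) (hU : |U| ≤ 24 * M / ε) (hW : |W - V| ≤ 2 * M * ε) (hV : |V| ≤ 2 * M) :
    ‖z - 4 * V * I‖ ≤ (41 + 8 * N) * M * ε := by
  have hy0 : 0 ≤ y := by linarith
  have t1 : |(1 - y ^ 2) * P| ≤ 8 * N * M * ε := by
    rw [abs_mul, abs_of_nonneg (by nlinarith)]
    calc (1 - y ^ 2) * |P| ≤ 2 * ε * (4 * M * N) :=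
          mul_le_mul (by nlinarith) hP (abs_nonneg _) (by positivity)
      _ = _ := by ring
  have t2 : |(1 - y) ^ 2 * U| ≤ 24 * M * ε := by
    rw [abs_mul, abs_of_nonneg (sq_nonneg _)]
    calc (1 - y) ^ 2 * |U| ≤ ε ^ 2 * (24 * M / ε) :=
          mul_le_mul (by nlinarith) hU (abs_nonneg _) (by positivity)
      _ = _ := by field_simp
  have t3 : |(1 + y) ^ 2 * (W - V)| ≤ 8 * M * ε := by
    rw [abs_mul, abs_of_nonneg (sq_nonneg _)]
    calc (1 + y) ^ 2 * |W - V| ≤ 4 * (2 * M * ε) :=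
          mul_le_mul (by nlinarith) hW (abs_nonneg _) (by norm_num)
      _ = _ := by ring
  have t4 : |((1 + y) ^ 2 - 4) * V| ≤ 8 * M * ε := by
    rw [abs_mul, abs_of_nonpos (by nlinarith)]
    calc -((1 + y) ^ 2 - 4) * |V| ≤ 4 * ε * (2 * M) :=
          mul_le_mul (by nlinarith) hV (abs_nonneg _) (by positivity)
      _ = _ := by ring
  have e : z - 4 * V * I = (z - radialField P U W y) + (((1 - y ^ 2) * P : ℝ) : ℂ) +
      (((1 - y) ^ 2 * U + (1 + y) ^ 2 * (W - V) + ((1 + y) ^ 2 - 4) * V : ℝ) : ℂ) * I := by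
    rw [radialField]; push_cast; ring
  rw [e]
  refine (norm_add₃_le).trans ?_
  rw [norm_mul, norm_I, mul_one, norm_real, norm_real, Real.norm_eq_abs, Real.norm_eq_abs]
  have t5 := abs_add_three ((1 - y) ^ 2 * U) ((1 + y) ^ 2 * (W - V)) (((1 + y) ^ 2 - 4) * V)
  linarith

/-- The coordinate `V` of the approximating Killing fields converges, as the increments of `P`, `U`,
`V` over dyadic scales `2 ^ (-n)` are of order `1`, `2 ^ n`, `2 ^ (-n)`. -/
lemma exists_radial_limit {Ψ : ℝ → ℂ} {M : ℝ} (hM : 0 ≤ M)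
    (h : ∀ t, 0 ≤ t → t < 1 → ∃ P U V : ℝ, ∀ y, t ≤ y → y ≤ 1 - (1 - t) / 4 →
      ‖Ψ y - radialField P U V y‖ ≤ M * (1 - t))
    (h0 : ∀ y, 0 ≤ y → y ≤ 3 / 4 → ‖Ψ y‖ ≤ M) :
    ∃ V : ℝ, ∀ (n : ℕ) (y : ℝ), 1 - (1 / 2) ^ n ≤ y → y ≤ 1 - (1 / 2) ^ (n + 1) →
      ‖Ψ y - 4 * V * I‖ ≤ (41 + 8 * n) * M * (1 / 2) ^ n := by
  -- Near the centre of the disc `Ψ` is bounded, so the approximation at scale `1` may be taken to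
  -- vanish; this gives a bound for the coordinates at all scales.
  have hQ : ∀ n : ℕ, ∃ c : ℝ × ℝ × ℝ, ((n = 0) → c = 0) ∧ ∀ y, 1 - (1 / 2) ^ n ≤ y →
      y ≤ 1 - (1 / 2) ^ n / 4 → ‖Ψ y - radialField c.1 c.2.1 c.2.2 y‖ ≤ M * (1 / 2) ^ n := by
    intro n
    rcases Nat.eq_zero_or_pos n with rfl | hn
    · refine ⟨0, fun _ => rfl, fun y hy hy' => ?_⟩
      norm_num at hy hy'
      have : radialField 0 0 0 y = 0 := by simp [radialField]
      simpa [this] using h0 y hy hy'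
    · have h2 : (0 : ℝ) < (1 / 2) ^ n := by positivity
      have h3 : ((1 : ℝ) / 2) ^ n ≤ 1 := pow_le_one₀ (by norm_num) (by norm_num)
      obtain ⟨P, U, V, hc⟩ := h (1 - (1 / 2) ^ n) (by linarith) (by linarith)
      refine ⟨(P, U, V), fun h => absurd h hn.ne', fun y hy hy' => ?_⟩
      simpa using hc y hy (by simpa using hy')
  choose c hc0 hc using hQ
  -- The approximations at the scales `n` and `n + 1` are both valid where the distance to the
  -- boundary is between `2 ^ (-n-2)` and `2 ^ (-n-1)`.
  have hinc : ∀ n, |(c (n + 1)).1 - (c n).1| ≤ 4 * M ∧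
      |(c (n + 1)).2.1 - (c n).2.1| ≤ 24 * M * 2 ^ n ∧
      |(c (n + 1)).2.2 - (c n).2.2| ≤ M * (1 / 2) ^ n := by
    intro n
    rcases hcn : c n with ⟨P, U, V⟩
    rcases hcn' : c (n + 1) with ⟨P', U', V'⟩
    set ε : ℝ := (1 / 2) ^ (n + 1) with hε
    have hε0 : 0 < ε := by positivity
    have hεn : (1 / 2 : ℝ) ^ n = 2 * ε := by rw [hε, pow_succ]; ring
    have hε1 : ε ≤ 1 / 2 := by
      have : ((1 : ℝ) / 2) ^ n ≤ 1 := pow_le_one₀ (by norm_num) (by norm_num)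
      linarith
    have h2n : (2 : ℝ) ^ n * ε = 1 / 2 := by
      rw [hε, pow_succ, ← mul_assoc, ← mul_pow]; norm_num
    have hd : ∀ y, 1 - ε ≤ y → y ≤ 1 - ε / 2 →
        ‖radialField P' U' V' y - radialField P U V y‖ ≤ 3 * M * ε := by
      intro y hy hy'
      have h1 := hc n y (by linarith) (by linarith)
      have h2 := hc (n + 1) y hy (by rw [← hε]; linarith)
      rw [hcn] at h1
      rw [hcn', ← hε] at h2
      rw [hεn] at h1
      calc _ = ‖(Ψ y - radialField P U V y) - (Ψ y - radialField P' U' V' y)‖ := by congr 1; ring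
        _ ≤ _ := (norm_sub_le _ _).trans (by linarith)
    have key := radialField_increment hM hε0 hε1 hd
    refine ⟨key.1, key.2.1.trans (le_of_eq ?_), key.2.2.trans ?_⟩
    · rw [div_eq_iff hε0.ne']; linear_combination (-24 * M) * h2n
    · have : 0 ≤ M * ε := by positivity
      rw [hεn]; linarith
  have hP : ∀ n, |(c n).1| ≤ 4 * M * n := by
    intro n
    induction n with
    | zero => rw [hc0 0 rfl]; simp
    | succ n ih =>
      have h1 := (hinc n).1
      have h2 := abs_sub_abs_le_abs_sub (c (n + 1)).1 (c n).1
      push_cast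
      linarith
  have hU : ∀ n, |(c n).2.1| ≤ 24 * M * 2 ^ n := by
    intro n
    induction n with
    | zero => rw [hc0 0 rfl]; simp; exact hM
    | succ n ih =>
      have h1 := (hinc n).2.1
      have h2 := abs_sub_abs_le_abs_sub (c (n + 1)).2.1 (c n).2.1
      rw [pow_succ]
      linarith
  have hVd : ∀ n, dist (c n).2.2 (c (n + 1)).2.2 ≤ 2 * M / 2 / 2 ^ n := by
    intro n
    rw [dist_comm, Real.dist_eq]
    refine (hinc n).2.2.trans (le_of_eq ?_)
    rw [one_div, inv_pow]; ring
  obtain ⟨V, hV⟩ := cauchySeq_tendsto_of_complete (cauchySeq_of_le_geometric_two hVd)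
  have hVn : ∀ n, |(c n).2.2 - V| ≤ 2 * M * (1 / 2) ^ n := by
    intro n
    have := dist_le_of_le_geometric_two_of_tendsto hVd hV n
    rw [Real.dist_eq] at this
    refine this.trans (le_of_eq ?_)
    rw [one_div, inv_pow]; ring
  have hV0 : |V| ≤ 2 * M := by
    have := hVn 0
    rw [hc0 0 rfl] at this
    simpa using this
  refine ⟨V, fun n y hy hy' => ?_⟩
  set ε : ℝ := (1 / 2) ^ n with hε
  have hε0 : 0 < ε := by positivity
  have hε1 : ε ≤ 1 := pow_le_one₀ (by norm_num) (by norm_num)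
  have hε2 : (1 / 2 : ℝ) ^ (n + 1) = ε / 2 := by rw [hε, pow_succ]; ring
  rw [hε2] at hy'
  have h2n : (2 : ℝ) ^ n * ε = 1 := by
    rw [hε, ← mul_pow]; norm_num
  refine norm_sub_end_le hM n.cast_nonneg hε0 hε1 hy (by linarith) (hc n y hy (by linarith)) (hP n)
    ((hU n).trans (le_of_eq ?_)) (hVn n) hV0
  rw [eq_div_iff hε0.ne']; linear_combination (24 * M) * h2n

/-! ### Continuous boundary values -/

/-- The continuous function `y` on the circle is the uniform limit of the restrictions of `X` to the
circles of radius `r`, as `r → 1`. -/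
def HasUniformExtension (X : 𝔻 → ℂ) (y : S1 → ℂ) : Prop :=
  Continuous y ∧ TendstoUniformly (fun (r : ℝ) (θ : S1) => zeroExt X (r * pt θ)) y (𝓝[<] 1)

lemma HasUniformExtension.hasL2Extension {X : 𝔻 → ℂ} {y : S1 → ℂ} (h : HasUniformExtension X y) :
    HasL2Extension X (memLp_of_continuous h.1).toLp := by
  rw [HasL2Extension.congr_ae (MemLp.coeFn_toLp _), ENNReal.tendsto_nhds_zero]
  intro ε hε
  rcases eq_or_ne ε ⊤ with rfl | hε'
  · exact Eventually.of_forall fun _ => le_top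
  have h0 : 0 < ε.toReal := ENNReal.toReal_pos hε.ne' hε'
  filter_upwards [Metric.tendstoUniformly_iff.1 h.2 ε.toReal h0] with r hr
  refine (eLpNorm_le_of_ae_bound (C := ε.toReal) (ae_of_all _ fun θ => ?_)).trans ?_
  · rw [← dist_eq_norm, dist_comm]; exact (hr θ).le
  · simp [ENNReal.ofReal_toReal hε']

lemma pt_coe_arg {z : ℂ} : (‖z‖ : ℂ) * pt ((arg z : ℝ) : S1) = z := by
  have h : pt ((arg z : ℝ) : S1) = exp (arg z * I) := by
    rw [pt, AddCircle.toCircle_apply_mk, div_self Real.two_pi_pos.ne', one_mul, Circle.coe_exp]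
  rw [h, norm_mul_exp_arg_mul_I]

lemma coe_arg_pt (θ : S1) : ((arg (pt θ) : ℝ) : S1) = θ := by
  have h := pt_coe_arg (z := pt θ)
  rw [norm_pt, ofReal_one, one_mul] at h
  exact AddCircle.injective_toCircle Real.two_pi_pos.ne' (Subtype.ext h)

lemma continuousAt_coe_arg {z : ℂ} (hz : z ≠ 0) : ContinuousAt (fun z => ((arg z : ℝ) : S1)) z :=
  continuousAt_arg_coe_angle hz

/-- A uniform radial limit is an unrestricted limit. -/
lemma HasUniformExtension.tendsto {X : 𝔻 → ℂ} {y : S1 → ℂ} (h : HasUniformExtension X y)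
    {ι : Type*} {l : Filter ι} {f : ι → ℂ} {θ : S1} (hf : Tendsto f l (𝓝 (pt θ)))
    (hd : ∀ᶠ i in l, f i ∈ disc) : Tendsto (fun i => zeroExt X (f i)) l (𝓝 (y θ)) := by
  have h1 : Tendsto (fun i => ‖f i‖) l (𝓝[<] 1) := by
    refine tendsto_nhdsWithin_iff.2 ⟨?_, hd.mono fun i hi => mem_disc.1 hi⟩
    simpa [norm_pt] using hf.norm
  have h2 : TendstoUniformly (fun (i : ι) (θ : S1) => zeroExt X (‖f i‖ * pt θ)) y l :=
    fun u hu => h1.eventually (h.2 u hu)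
  have h3 : Tendsto (fun i => ((arg (f i) : ℝ) : S1)) l (𝓝 θ) := by
    have := (continuousAt_coe_arg (pt_ne_zero θ)).tendsto.comp hf
    rwa [coe_arg_pt] at this
  have h4 := h2.tendsto_comp h.1.continuousAt h3
  simpa only [pt_coe_arg] using h4

lemma tendsto_radius (θ : S1) : Tendsto (fun r : ℝ => (r * pt θ : ℂ)) (𝓝[<] 1) (𝓝 (pt θ)) := by
  have h : Tendsto (fun r : ℝ => (r * pt θ : ℂ)) (𝓝 1) (𝓝 ((1 : ℝ) * pt θ)) :=
    (Continuous.tendsto (by fun_prop) 1)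
  rw [ofReal_one, one_mul] at h
  exact h.mono_left nhdsWithin_le_nhds

/-- The boundary value of `γ^* X`. -/
lemma HasUniformExtension.tendsto_pull {X : 𝔻 → ℂ} {y : S1 → ℂ} (h : HasUniformExtension X y)
    (A : SU11) (θ : S1) : Tendsto (fun r : ℝ => zeroExt (pull (A : PSU11) X) (r * pt θ)) (𝓝[<] 1)
      (𝓝 (autFactor A (pt θ) ^ 2 * y (bdryMap A θ))) := by
  have hr := tendsto_radius θ
  have hd : ∀ᶠ r : ℝ in 𝓝[<] 1, (r * pt θ : ℂ) ∈ disc := by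
    filter_upwards [eventually_radius] with r hr using mul_pt_mem_disc hr.1.le hr.2 θ
  have h1 : Tendsto (fun r : ℝ => moebius A (r * pt θ)) (𝓝[<] 1) (𝓝 (pt (bdryMap A θ))) := by
    rw [pt_bdryMap]
    exact (hasDerivAt_moebius A (autFactor_pt_ne_zero A θ)).continuousAt.tendsto.comp hr
  have h2 := h.tendsto h1 (hd.mono fun r hr => mapsTo_moebius A hr)
  have h3 := (((contDiff_autFactor A).continuous.tendsto (pt θ)).comp hr).pow 2
  refine (h3.mul h2).congr' ?_
  filter_upwards [hd] with r hr
  exact (mul_comm _ _).trans (eqOn_zeroExt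
    (F := fun z => zeroExt X (moebius A z) * autFactor A z ^ 2) (pull_mk A X) hr).symm

/-- The coboundary `γ^* ψ - ψ` of a field with continuous boundary value `y` has boundary value
`γ^* y - y`. -/
lemma HasUniformExtension.bdryPull_eq {ψ κ : 𝔻 → ℂ} {y k : S1 → ℂ} {Y K : L2S1}
    (hψ : HasUniformExtension ψ y) (hκ : HasUniformExtension κ k) (A : SU11)
    (h : pull (A : PSU11) ψ = ψ + κ) (hY : Y =ᵐ[haarS1] y) (hK : K =ᵐ[haarS1] k) :
    bdryPull A Y = Y + K := by
  have key : ∀ θ, autFactor A (pt θ) ^ 2 * y (bdryMap A θ) = y θ + k θ := by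
    intro θ
    refine tendsto_nhds_unique (hψ.tendsto_pull A θ) ?_
    rw [h, zeroExt_add]
    exact (hψ.2.tendsto_at θ).add (hκ.2.tendsto_at θ)
  refine Lp.ext ?_
  filter_upwards [coeFn_bdryPull A Y, ae_bdryMap A hY, hY, hK, Lp.coeFn_add Y K] with θ h1 h2 h3 h4 h5
  rw [h1, h2, h5, Pi.add_apply, h3, h4, key]

/-- Smooth vector fields with coboundary in `𝔤` for a cocompact group have tangential boundary
values. -/
theorem exists_hasUniformExtension (Γ : Subgroup PSU11) [CompactSpace (PSU11 ⧸ Γ)] {ψ : 𝔻 → ℂ}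
    (hψ : IsSmooth ψ) (h : ∀ γ : Γ, delta Γ ψ γ ∈ killing) :
    ∃ y : S1 → ℂ, HasUniformExtension ψ y ∧ ∀ θ, ∃ s : ℝ, y θ = s * (I * pt θ) := by
  obtain ⟨M, hM0, hM⟩ := exists_radialField_approx Γ hψ h
  obtain ⟨C, hC⟩ := (isCompact_norm_le (ρ := 3 / 4) (by norm_num)).exists_bound_of_continuousOn
    hψ.continuous.continuousOn
  set N := max M C with hN
  have hN0 : 0 ≤ N := hM0.trans (le_max_left _ _)
  have hlim : ∀ θ : S1, ∃ V : ℝ, ∀ (n : ℕ) (y : ℝ), 1 - (1 / 2) ^ n ≤ y → y ≤ 1 - (1 / 2) ^ (n + 1) →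
      ‖conj (pt θ) * zeroExt ψ (y * pt θ) - 4 * V * I‖ ≤ (41 + 8 * n) * N * (1 / 2) ^ n := by
    intro θ
    refine exists_radial_limit hN0 (fun t ht ht1 => ?_) fun y hy hy1 => ?_
    · obtain ⟨P, U, V, hb⟩ := hM θ t ht ht1
      refine ⟨P, U, V, fun y hy hy1 => (hb y hy hy1).trans ?_⟩
      have : 0 ≤ 1 - t := by linarith
      gcongr
      exact le_max_left _ _
    · have h1 : ‖(y * pt θ : ℂ)‖ ≤ 3 / 4 := by
        rwa [norm_mul, norm_pt, mul_one, norm_real, Real.norm_of_nonneg hy]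
      have h2 := hC (UnitDisc.mk _ (h1.trans_lt (by norm_num))) h1
      rw [← zeroExt_coe ψ] at h2
      rw [norm_mul, norm_conj, norm_pt, one_mul]
      exact h2.trans (le_max_right _ _)
  choose V hV using hlim
  have hunif : TendstoUniformly (fun (r : ℝ) (θ : S1) => zeroExt ψ (r * pt θ))
      (fun θ => ((4 * V θ : ℝ) : ℂ) * (I * pt θ)) (𝓝[<] 1) := by
    rw [Metric.tendstoUniformly_iff]
    intro ε hε
    have hb : Tendsto (fun n : ℕ => (41 + 8 * (n : ℝ)) * N * (1 / 2) ^ n) atTop (𝓝 0) := by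
      have h1 := tendsto_pow_atTop_nhds_zero_of_lt_one (r := (1 / 2 : ℝ)) (by norm_num) (by norm_num)
      have h2 := tendsto_self_mul_const_pow_of_lt_one (r := (1 / 2 : ℝ)) (by norm_num) (by norm_num)
      have h3 := (h1.const_mul (41 * N)).add (h2.const_mul (8 * N))
      rw [mul_zero, mul_zero, add_zero] at h3
      exact h3.congr fun n => by ring
    obtain ⟨n₀, hn₀⟩ := eventually_atTop.1 (hb.eventually_lt_const hε)
    have hr : ∀ᶠ r : ℝ in 𝓝[<] 1, 1 - (1 / 2) ^ (n₀ + 1) < r ∧ r < 1 :=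
      Ioo_mem_nhdsLT (by have : (0 : ℝ) < (1 / 2) ^ (n₀ + 1) := by positivity
                         linarith)
    filter_upwards [hr, eventually_radius] with r hr hr' θ
    obtain ⟨n, hn1, hn2⟩ := exists_nat_pow_near_of_lt_one (x := 1 - r) (y := 1 / 2) (by linarith)
      (by linarith) (by norm_num) (by norm_num)
    have hn : n₀ ≤ n := by
      have h3 : (1 / 2 : ℝ) ^ (n + 1) < (1 / 2) ^ (n₀ + 1) := by linarith
      have h4 := (pow_lt_pow_iff_right_of_lt_one₀ (by norm_num) (by norm_num)).1 h3
      omega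
    have h5 := (hV θ n r (by linarith) (by linarith)).trans_lt (hn₀ n hn)
    refine lt_of_eq_of_lt ?_ h5
    have h6 : pt θ * conj (pt θ) = 1 := by rw [← inv_pt, mul_inv_cancel₀ (pt_ne_zero θ)]
    rw [dist_comm, dist_eq_norm, ← one_mul ‖conj (pt θ) * _ - _‖, ← norm_pt θ, ← norm_mul]
    congr 1
    push_cast
    linear_combination (-(zeroExt ψ (r * pt θ))) * h6
  refine ⟨_, ⟨hunif.continuous ?_, hunif⟩, fun θ => ⟨_, rfl⟩⟩
  refine Eventually.frequently ?_
  filter_upwards [eventually_radius] with r hr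
  exact continuous_slice (ContDiffOn.continuousOn hψ) hr.1.le hr.2

/-! ### Coboundaries of harmonic vector fields -/

lemma quadDiff_of_mem_killing {X : 𝔻 → ℂ} (hX : X ∈ killing) : quadDiff X = 0 := by
  ext z
  simp [quadDiff, hX.2]

lemma isHarmonic_of_mem_killing {X : 𝔻 → ℂ} (hX : X ∈ killing) : IsHarmonic X := by
  refine isHarmonic_iff.2 ⟨hX.1, ?_⟩
  rw [quadDiff_of_mem_killing hX, zeroExt_zero]
  exact differentiableOn_const 0

lemma poissonMap_add (Y Z : L2S1) : poissonMap (Y + Z) = poissonMap Y + poissonMap Z :=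
  (((isHarmonic_poissonMap Y).add (isHarmonic_poissonMap Z)).eq_poissonMap
    ((hasL2Extension_poissonMap Y).add (isHarmonic_poissonMap Y).1 (isHarmonic_poissonMap Z).1
      (hasL2Extension_poissonMap Z))).symm

lemma poissonMap_smul (a : ℝ) (Y : L2S1) : poissonMap (a • Y) = a • poissonMap Y :=
  (((isHarmonic_poissonMap Y).smul a).eq_poissonMap
    ((hasL2Extension_poissonMap Y).smul a)).symm

lemma delta_add (Γ : Subgroup PSU11) (X Y : 𝔻 → ℂ) : delta Γ (X + Y) = delta Γ X + delta Γ Y := by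
  funext γ
  simp only [delta, Pi.add_apply, pull_add]
  abel

lemma delta_smul (Γ : Subgroup PSU11) (a : ℝ) (X : 𝔻 → ℂ) : delta Γ (a • X) = a • delta Γ X := by
  funext γ
  simp only [delta, Pi.smul_apply, pull_smul, smul_sub]

lemma delta_sub (Γ : Subgroup PSU11) (X Y : 𝔻 → ℂ) : delta Γ (X - Y) = delta Γ X - delta Γ Y := by
  funext γ
  simp only [delta, Pi.sub_apply, pull_sub]
  abel

lemma delta_mem_Z1 {Γ : Subgroup PSU11} {X : 𝔻 → ℂ} (h : ∀ γ : Γ, delta Γ X γ ∈ killing) :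
    delta Γ X ∈ Z1 Γ := by
  refine ⟨h, fun γ₁ γ₂ => ?_⟩
  simp only [delta, Subgroup.coe_mul, pull_mul, pull_sub]
  abel

lemma delta_mem_killing (Γ : Subgroup PSU11) {X : 𝔻 → ℂ} (hX : X ∈ killing) (γ : Γ) :
    delta Γ X γ ∈ killing :=
  killing.sub_mem (pull_mem_killing γ hX) hX

lemma isTangential_toLp {y : S1 → ℂ} (hy : MemLp y 2 haarS1)
    (h : ∀ θ, ∃ s : ℝ, y θ = s * (I * pt θ)) : IsTangential hy.toLp := by
  filter_upwards [hy.coeFn_toLp] with θ hθ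
  rw [hθ]
  exact h θ

/-- The Poisson integral of the boundary value of `ψ` has the same coboundary as `ψ`. -/
theorem delta_poissonMap (Γ : Subgroup PSU11) [CompactSpace (PSU11 ⧸ Γ)] {ψ : 𝔻 → ℂ}
    (hψ : IsSmooth ψ) (h : ∀ γ : Γ, delta Γ ψ γ ∈ killing) {Y : L2S1} (hY : HasL2Extension ψ Y) :
    delta Γ (poissonMap Y) = delta Γ ψ := by
  obtain ⟨y, hy, -⟩ := exists_hasUniformExtension Γ hψ h
  funext γ
  obtain ⟨A, hA⟩ := QuotientGroup.mk_surjective (γ : PSU11)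
  obtain ⟨k, hk, -⟩ := exists_hasUniformExtension Γ (h γ).1 (delta_mem_killing Γ (h γ))
  have hK := (isHarmonic_of_mem_killing (h γ)).eq_poissonMap hk.hasL2Extension
  have hp : pull (A : PSU11) ψ = ψ + delta Γ ψ γ := by
    rw [delta, ← hA]; abel
  have hYy : Y =ᵐ[haarS1] y := by
    rw [hY.unique hψ hy.hasL2Extension]
    exact MemLp.coeFn_toLp _
  have hb := hy.bdryPull_eq hk A hp hYy (MemLp.coeFn_toLp (memLp_of_continuous hk.1))
  have e : delta Γ (poissonMap Y) γ = pull (A : PSU11) (poissonMap Y) - poissonMap Y := by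
    rw [delta, ← hA]
  rw [e, pull_poissonMap, hb, poissonMap_add, ← hK, add_sub_cancel_left]

/-- The boundary value of a smooth field depends only on its coboundary: invariant fields are bounded
in the hyperbolic norm and hence vanish at the boundary. -/
lemma HasL2Extension.eq_of_delta_eq (Γ : Subgroup PSU11) [CompactSpace (PSU11 ⧸ Γ)]
    {ψ ψ' : 𝔻 → ℂ} (hψ : IsSmooth ψ) (hψ' : IsSmooth ψ') (h : delta Γ ψ = delta Γ ψ')
    {Y Y' : L2S1} (hY : HasL2Extension ψ Y) (hY' : HasL2Extension ψ' Y') : Y = Y' := by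
  have hs := hψ.sub hψ'
  have hd : ∀ γ : Γ, delta Γ (ψ - ψ') γ = 0 := by
    intro γ
    rw [delta_sub, h, sub_self]; rfl
  obtain ⟨M, hM⟩ := exists_bound_of_delta_eq_zero Γ hs.continuous fun γ hγ =>
    sub_eq_zero.1 (hd ⟨γ, hγ⟩)
  have hbound : ∀ r : ℝ, 0 < r → r < 1 → ∀ θ : S1,
      ‖zeroExt (ψ - ψ') (r * pt θ)‖ ≤ M * (1 - r ^ 2) := by
    intro r h0 h1 θ
    have h2 := hM (UnitDisc.mk _ (mem_disc.1 (mul_pt_mem_disc h0.le h1 θ)))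
    rw [← zeroExt_coe (ψ - ψ'), UnitDisc.coe_mk] at h2
    rwa [norm_mul, norm_pt, mul_one, norm_real, Real.norm_of_nonneg h0.le] at h2
  obtain ⟨y, hy, -⟩ := exists_hasUniformExtension Γ hs fun γ => by
    rw [hd]; exact killing.zero_mem
  have hy0 : y = 0 := by
    ext θ
    refine tendsto_nhds_unique (hy.2.tendsto_at θ) (squeeze_zero_norm' (a := fun r => M * (1 - r ^ 2))
      ?_ ?_)
    · filter_upwards [eventually_radius] with r hr using hbound r hr.1 hr.2 θ
    · have h1 : Tendsto (fun r : ℝ => M * (1 - r ^ 2)) (𝓝 1) (𝓝 (M * (1 - 1 ^ 2))) :=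
        Continuous.tendsto (by fun_prop) 1
      rw [one_pow, sub_self, mul_zero] at h1
      exact h1.mono_left nhdsWithin_le_nhds
  have h0 : Y - Y' = 0 := by
    rw [(hY.sub hψ hψ' hY').unique hs hy.hasL2Extension]
    subst hy0
    exact MemLp.toLp_zero _
  exact sub_eq_zero.1 h0

/-- If the coboundary of a harmonic field is `𝔤`-valued, then its quadratic differential is
invariant, as that of a Killing field vanishes. -/
lemma quadDiff_mem_HQD {Γ : Subgroup PSU11} {X : 𝔻 → ℂ} (hX : IsHarmonic X)
    (h : ∀ γ : Γ, delta Γ X γ ∈ killing) : quadDiff X ∈ HQD Γ := by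
  refine ⟨(isHarmonic_iff.1 hX).2, fun γ hγ z => ?_⟩
  have h1 : pull γ X = X + delta Γ X ⟨γ, hγ⟩ := by rw [delta]; abel
  rw [← quadDiff_pull hX.1, h1, quadDiff_add hX.1 (h ⟨γ, hγ⟩).1, quadDiff_of_mem_killing (h _),
    add_zero]

/-! ### The map from quadratic differentials to cohomology -/

lemma exists_isHarmonicPotential (Γ : Subgroup PSU11) [CompactSpace (PSU11 ⧸ Γ)] (q : HQD Γ) :
    ∃ χ : 𝔻 → ℂ, IsHarmonicPotential χ q := by
  obtain ⟨M, hM⟩ := exists_bound_of_mem_HQD Γ q.2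
  obtain ⟨Y, hY, h⟩ := exists_tangential_quadDiff_eq q.2.1 hM
  exact ⟨poissonMap Y, isHarmonic_poissonMap Y, ⟨Y, hasL2Extension_poissonMap Y, hY⟩, h⟩

/-- `γ^* χ - χ` has vanishing quadratic differential, by invariance of `q`, and a tangential boundary
value, by equivariance of the Poisson map. -/
lemma IsHarmonicPotential.delta_mem_killing {Γ : Subgroup PSU11} {q : HQD Γ} {χ : 𝔻 → ℂ}
    (h : IsHarmonicPotential χ q) (γ : Γ) : delta Γ χ γ ∈ killing := by
  obtain ⟨hχ, ⟨Y, hY, ht⟩, hq⟩ := h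
  obtain ⟨A, hA⟩ := QuotientGroup.mk_surjective (γ : PSU11)
  have hp : pull (γ : PSU11) χ = poissonMap (bdryPull A Y) := by
    rw [← hA, hχ.eq_poissonMap hY, pull_poissonMap]
  change pull (γ : PSU11) χ - χ ∈ killing
  refine mem_killing_of_tangential ((hχ.1.pull γ).sub hχ.1) ?_
    (Y := bdryPull A Y - Y) ?_ ((ht.bdryPull A).sub ht)
  · rw [quadDiff_sub (hχ.1.pull γ) hχ.1, sub_eq_zero]
    ext z
    rw [quadDiff_pull hχ.1, hq]
    exact q.2.2 γ γ.2 z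
  · refine HasL2Extension.sub (hχ.1.pull γ) hχ.1 ?_ hY
    rw [hp]
    exact hasL2Extension_poissonMap _

lemma H1.mk_eq_of_sub {Γ : Subgroup PSU11} {X X' : 𝔻 → ℂ} (hX : delta Γ X ∈ Z1 Γ)
    (hX' : delta Γ X' ∈ Z1 Γ) (h : X - X' ∈ killing) :
    H1.mk Γ ⟨delta Γ X, hX⟩ = H1.mk Γ ⟨delta Γ X', hX'⟩ := by
  refine (Submodule.Quotient.eq _).2 ⟨X - X', h, (delta_sub Γ X X').symm⟩

lemma IsHarmonicPotential.sub_mem_killing {χ χ' q : 𝔻 → ℂ} (h : IsHarmonicPotential χ q)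
    (h' : IsHarmonicPotential χ' q) : χ - χ' ∈ killing := by
  obtain ⟨hχ, ⟨Y, hY, ht⟩, hq⟩ := h
  obtain ⟨hχ', ⟨Y', hY', ht'⟩, hq'⟩ := h'
  refine mem_killing_of_tangential (hχ.1.sub hχ'.1) ?_ (hY.sub hχ.1 hχ'.1 hY') (ht.sub ht')
  rw [quadDiff_sub hχ.1 hχ'.1, hq, hq', sub_self]

/-- The map `Φ` exists: two potentials of the same `q` differ by a Killing field. -/
theorem exists_isPhi (Γ : Subgroup PSU11) [CompactSpace (PSU11 ⧸ Γ)] :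
    ∃ Φ : HQD Γ → H1 Γ, IsPhi Γ Φ := by
  choose χ hχ using exists_isHarmonicPotential Γ
  refine ⟨fun q => H1.mk Γ ⟨delta Γ (χ q), delta_mem_Z1 (hχ q).delta_mem_killing⟩,
    exists_isHarmonicPotential Γ, fun q χ' h => ⟨delta_mem_Z1 h.delta_mem_killing, ?_⟩⟩
  exact H1.mk_eq_of_sub _ _ ((hχ q).sub_mem_killing h)

/-! ### The map from cohomology to quadratic differentials -/

/-- `q` is the quadratic differential of the Poisson integral of the boundary value of some smooth
field with coboundary `c`. -/
def IsPsiValue (Γ : Subgroup PSU11) (c : Γ → 𝔻 → ℂ) (q : 𝔻 → ℂ) : Prop :=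
  ∃ (ψ : 𝔻 → ℂ) (Y : L2S1), IsSmooth ψ ∧ delta Γ ψ = c ∧ HasL2Extension ψ Y ∧
    quadDiff (poissonMap Y) = q

lemma IsPsiValue.unique {Γ : Subgroup PSU11} [CompactSpace (PSU11 ⧸ Γ)] {c : Γ → 𝔻 → ℂ}
    {q q' : 𝔻 → ℂ} (h : IsPsiValue Γ c q) (h' : IsPsiValue Γ c q') : q = q' := by
  obtain ⟨ψ, Y, hψ, hc, hY, rfl⟩ := h
  obtain ⟨ψ', Y', hψ', hc', hY', rfl⟩ := h'
  rw [hY.eq_of_delta_eq Γ hψ hψ' (hc.trans hc'.symm) hY']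

lemma IsPsiValue.add {Γ : Subgroup PSU11} {c c' : Γ → 𝔻 → ℂ} {q q' : 𝔻 → ℂ}
    (h : IsPsiValue Γ c q) (h' : IsPsiValue Γ c' q') : IsPsiValue Γ (c + c') (q + q') := by
  obtain ⟨ψ, Y, hψ, rfl, hY, rfl⟩ := h
  obtain ⟨ψ', Y', hψ', rfl, hY', rfl⟩ := h'
  refine ⟨ψ + ψ', Y + Y', hψ.add hψ', delta_add Γ ψ ψ', hY.add hψ hψ' hY', ?_⟩
  rw [poissonMap_add, quadDiff_add (isHarmonic_poissonMap Y).1 (isHarmonic_poissonMap Y').1]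

lemma IsPsiValue.smul {Γ : Subgroup PSU11} {c : Γ → 𝔻 → ℂ} {q : 𝔻 → ℂ} (a : ℝ)
    (h : IsPsiValue Γ c q) : IsPsiValue Γ (a • c) (a • q) := by
  obtain ⟨ψ, Y, hψ, rfl, hY, rfl⟩ := h
  refine ⟨a • ψ, a • Y, hψ.smul a, delta_smul Γ a ψ, hY.smul a, ?_⟩
  rw [poissonMap_smul, quadDiff_smul a (isHarmonic_poissonMap Y).1]

/-- A Killing field is the Poisson integral of its boundary value. -/
lemma isPsiValue_zero {Γ : Subgroup PSU11} [CompactSpace (PSU11 ⧸ Γ)] {c : Γ → 𝔻 → ℂ}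
    (h : c ∈ B1 Γ) : IsPsiValue Γ c 0 := by
  obtain ⟨X, hX, rfl⟩ := h
  obtain ⟨y, hy, -⟩ := exists_hasUniformExtension Γ hX.1 (delta_mem_killing Γ hX)
  refine ⟨X, _, hX.1, rfl, hy.hasL2Extension, ?_⟩
  rw [← (isHarmonic_of_mem_killing hX).eq_poissonMap hy.hasL2Extension, quadDiff_of_mem_killing hX]

lemma exists_isPsiValue {Γ : Subgroup PSU11} [DiscreteTopology Γ] [CompactSpace (PSU11 ⧸ Γ)]
    (c : Z1 Γ) : ∃ q : HQD Γ, IsPsiValue Γ c q := by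
  obtain ⟨ψ, hψ, hc⟩ := exists_isSmooth_delta_eq Γ c.2
  have h : ∀ γ : Γ, delta Γ ψ γ ∈ killing := by rw [hc]; exact c.2.1
  obtain ⟨y, hy, -⟩ := exists_hasUniformExtension Γ hψ h
  have hd := delta_poissonMap Γ hψ h hy.hasL2Extension
  refine ⟨⟨_, quadDiff_mem_HQD (isHarmonic_poissonMap _) fun γ => ?_⟩, ψ, _, hψ, hc,
    hy.hasL2Extension, rfl⟩
  rw [hd]
  exact h γ

/-- The linear map `Ψ` exists: it is defined on cocycles, and it vanishes on coboundaries. -/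
theorem exists_isPsi (Γ : Subgroup PSU11) [DiscreteTopology Γ] [CompactSpace (PSU11 ⧸ Γ)] :
    ∃ Ψ : H1 Γ →ₗ[ℝ] HQD Γ, IsPsi Γ Ψ := by
  choose Q hQ using exists_isPsiValue (Γ := Γ)
  let L : Z1 Γ →ₗ[ℝ] HQD Γ :=
    { toFun := Q
      map_add' := fun c d => Subtype.ext ((hQ (c + d)).unique ((hQ c).add (hQ d)))
      map_smul' := fun a c => Subtype.ext ((hQ (a • c)).unique ((hQ c).smul a)) }
  refine ⟨((B1 Γ).submoduleOf (Z1 Γ)).liftQ L fun c hc => ?_, fun c => exists_isSmooth_delta_eq Γ c.2,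
    fun c ψ hψ hc => ?_⟩
  · exact LinearMap.mem_ker.2
      (Subtype.ext ((hQ c).unique (isPsiValue_zero hc)))
  · have h : ∀ γ : Γ, delta Γ ψ γ ∈ killing := by rw [hc]; exact c.2.1
    obtain ⟨y, hy, ht⟩ := exists_hasUniformExtension Γ hψ h
    refine ⟨_, hy.hasL2Extension, isTangential_toLp _ ht, isHarmonic_poissonMap _, ?_⟩
    exact (hQ c).unique ⟨ψ, _, hψ, hc, hy.hasL2Extension, rfl⟩

/-- The Poisson integral of the boundary value of `ψ` is an admissible potential with the same
coboundary as `ψ`, so that `Φ` is a left inverse of `Ψ`. -/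
lemma IsPhi.apply_isPsi {Γ : Subgroup PSU11} [CompactSpace (PSU11 ⧸ Γ)] {Φ : HQD Γ → H1 Γ}
    {Ψ : H1 Γ → HQD Γ} (hΦ : IsPhi Γ Φ) (hΨ : IsPsi Γ Ψ) (x : H1 Γ) : Φ (Ψ x) = x := by
  obtain ⟨c, rfl⟩ := Submodule.Quotient.mk_surjective _ x
  obtain ⟨ψ, hψ, hc⟩ := hΨ.1 c
  obtain ⟨Y, hY, ht, hh, hq⟩ := hΨ.2 c ψ hψ hc
  have h : ∀ γ : Γ, delta Γ ψ γ ∈ killing := by rw [hc]; exact c.2.1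
  obtain ⟨h', he⟩ := hΦ.2 (Ψ (H1.mk Γ c)) (poissonMap Y)
    ⟨hh, ⟨Y, hasL2Extension_poissonMap Y, ht⟩, hq.symm⟩
  refine he.trans ?_
  have hd : (⟨delta Γ (poissonMap Y), h'⟩ : Z1 Γ) = c :=
    Subtype.ext ((delta_poissonMap Γ hψ h hY).trans hc)
  rw [hd]
  rfl

end HarmonicVF

end

/-- For a discrete cocompact subgroup `Γ` of `PSU(1,1)`, the map `Φ : HQD(𝔻, Γ) → H¹(Γ; 𝔤)` and the
homomorphism `Ψ : H¹(Γ; 𝔤) → HQD(𝔻, Γ)` are well defined, and `Φ ∘ Ψ = Id`. (The conditions `IsPhi`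
and `IsPsi` determine `Φ` and `Ψ` uniquely.) -/
theorem mainTheorem8 (Γ : Subgroup PSU11) [DiscreteTopology Γ] [CompactSpace (PSU11 ⧸ Γ)] :
    ∃ (Φ : HQD Γ → H1 Γ) (Ψ : H1 Γ →ₗ[ℝ] HQD Γ),
      IsPhi Γ Φ ∧ IsPsi Γ Ψ ∧ Φ ∘ Ψ = id := by
  obtain ⟨Φ, hΦ⟩ := exists_isPhi Γ
  obtain ⟨Ψ, hΨ⟩ := exists_isPsi Γ
  exact ⟨Φ, Ψ, hΦ, hΨ, funext (hΦ.apply_isPsi hΨ)⟩
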